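/- **Model.** $p\ge 2$ asynchronous processes share a memory. A *step* of an operation is one access to shared memory (a read or write of a word, or a CAS), followed by $O(1)$ local computation. $\mathrm{CAS}(x,a,b)$ sets $x:=b$ and returns true if $x=a$, and returns false otherwise. Executions are arbitrary interleavings of the steps of the processes; each process performs one operation at a time, and it chooses its operations arbitrarily. The *point contention* at a moment is the number of operations that have been invoked and have not terminated at that moment. **Data structure.** Consider the following queue implementation. A static full binary tree of height $\lceil\log_2 p\rceil$ has one leaf per process. Each node $v$ has an infinite array $v.\mathit{blocks}[0..\infty]$ and an integer $v.\mathit{head}$, initially $1$. Initially $v.\mathit{blocks}[0]$ is a dummy block whose integer fields are $0$, and all other entries are null. A block has integer fields $\mathit{sum}_{enq},\mathit{sum}_{deq}$ and a field $\mathit{super}$, initially null; blocks of internal nodes also have $\mathit{end}_{left},\mathit{end}_{right}$, blocks of leaves have $\mathit{element}$, and blocks of the root have $\mathit{size}$. Below, *leaf* is the leaf of the executing process. * Enqueue$(x)$: Append a new block with $\mathit{element}=x$, $\mathit{sum}_{enq}=\mathit{leaf.blocks}[\mathit{leaf.head}-1].\mathit{sum}_{enq}+1$ and $\mathit{sum}_{deq}=\mathit{leaf.blocks}[\mathit{leaf.head}-1].\mathit{sum}_{deq}$.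 * Dequeue: Append a new block with $\mathit{element}=$ null, $\mathit{sum}_{enq}=\mathit{leaf.blocks}[\mathit{leaf.head}-1].\mathit{sum}_{enq}$ and $\mathit{sum}_{deq}=\mathit{leaf.blocks}[\mathit{leaf.head}-1].\mathit{sum}_{deq}+1$; then $\langle b,i\rangle:=$ IndexDequeue$(\mathit{leaf},\mathit{leaf.head}-1,1)$; return FindResponse$(b,i)$. * Append$(B)$: $h:=\mathit{leaf.head}$; $\mathit{leaf.blocks}[h]:=B$; Advance$(\mathit{leaf},h)$; then for each internal node $v$ on the path from the leaf's parent up to the root: if Refresh$(v)$ returns false, call Refresh$(v)$ again. * Refresh$(v)$: $h:=v.\mathit{head}$; for each child $w$ of $v$ (left, then right): $h_w:=w.\mathit{head}$, and if $w.\mathit{blocks}[h_w]\ne$ null then Advance$(w,h_w)$. Then $B:=$ CreateBlock$(v,h)$; if $B=$ null return true; else $r:=\mathrm{CAS}(v.\mathit{blocks}[h],\text{null},B)$, Advance$(v,h)$, return $r$. * CreateBlock$(v,i)$: a new block $B$ with $B.\mathit{end}_{left}=v.\mathit{left.head}-1$, $B.\mathit{end}_{right}=v.\mathit{right.head}-1$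 and, for $\ast\in\{enq,deq\}$, $B.\mathit{sum}_\ast=v.\mathit{left.blocks}[B.\mathit{end}_{left}].\mathit{sum}_\ast+v.\mathit{right.blocks}[B.\mathit{end}_{right}].\mathit{sum}_\ast$. Let $n_\ast=B.\mathit{sum}_\ast-v.\mathit{blocks}[i-1].\mathit{sum}_\ast$. If $v$ is the root, $B.\mathit{size}=\max(0,v.\mathit{blocks}[i-1].\mathit{size}+n_{enq}-n_{deq})$. Return null if $n_{enq}+n_{deq}=0$, and $B$ otherwise. * Advance$(v,h)$: if $v$ is not the root, $h_p:=v.\mathit{parent.head}$ and $\mathrm{CAS}(v.\mathit{blocks}[h].\mathit{super},\text{null},h_p)$; then $\mathrm{CAS}(v.\mathit{head},h,h+1)$. * IndexDequeue$(v,b,i)$: if $v$ is the root return $\langle b,i\rangle$. Otherwise let $u$ be the parent of $v$ and *dir* the direction from $u$ to $v$; $s:=v.\mathit{blocks}[b].\mathit{super}$, and if $b>u.\mathit{blocks}[s].\mathit{end}_{dir}$ then $s:=s+1$; add $v.\mathit{blocks}[b-1].\mathit{sum}_{deq}-v.\mathit{blocks}[u.\mathit{blocks}[s-1].\mathit{end}_{dir}].\mathit{sum}_{deq}$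 to $i$; if *dir* is right, also add $w.\mathit{blocks}[u.\mathit{blocks}[s].\mathit{end}_{left}].\mathit{sum}_{deq}-w.\mathit{blocks}[u.\mathit{blocks}[s-1].\mathit{end}_{left}].\mathit{sum}_{deq}$, where $w=u.\mathit{left}$; return IndexDequeue$(u,s,i)$. * FindResponse$(b,i)$, with $R=\mathit{root.blocks}$: if $R[b-1].\mathit{size}+R[b].\mathit{sum}_{enq}-R[b-1].\mathit{sum}_{enq}<i$ return null. Otherwise $e:=i+R[b-1].\mathit{sum}_{enq}-R[b-1].\mathit{size}$; find the least $b_e\le b$ with $R[b_e].\mathit{sum}_{enq}\ge e$, by a doubling search (comparing $e$ with the $\mathit{sum}_{enq}$ fields at indices $b-1,b-2,b-4,b-8,\dots$) followed by a binary search; return GetEnqueue$(\mathit{root},b_e,e-R[b_e-1].\mathit{sum}_{enq})$. * GetEnqueue$(v,b,i)$: if $v$ is a leaf return $v.\mathit{blocks}[b].\mathit{element}$. Otherwise for $d\in\{left,right\}$ let $\mathit{prev}_d=v.d.\mathit{blocks}[v.\mathit{blocks}[b-1].\mathit{end}_d].\mathit{sum}_{enq}$, and let $n=v.\mathit{left.blocks}[v.\mathit{blocks}[b].\mathit{end}_{left}].\mathit{sum}_{enq}-\mathit{prev}_{left}$.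 If $i\le n$ let $d=left$; else let $d=right$ and subtract $n$ from $i$. Find by binary search the least $b'$ in $[v.\mathit{blocks}[b-1].\mathit{end}_d+1,\ v.\mathit{blocks}[b].\mathit{end}_d]$ with $v.d.\mathit{blocks}[b'].\mathit{sum}_{enq}\ge i+\mathit{prev}_d$; return GetEnqueue$(v.d,b',i-(v.d.\mathit{blocks}[b'-1].\mathit{sum}_{enq}-\mathit{prev}_d))$. **Linearization.** A leaf block contains the operation that appended it. A block $v.\mathit{blocks}[b]$ of an internal node contains the operations of the blocks with indices in $(v.\mathit{blocks}[b-1].\mathit{end}_{left},v.\mathit{blocks}[b].\mathit{end}_{left}]$ of $v$'s left child and then those of the blocks with indices in $(v.\mathit{blocks}[b-1].\mathit{end}_{right},v.\mathit{blocks}[b].\mathit{end}_{right}]$ of its right child. Let $E(B)$ and $D(B)$ be the resulting sequences of enqueues and of dequeues in $B$. If the root's blocks after the dummy block are $B_1,\dots,B_k$, the operations are linearized in the order $L=E(B_1)D(B_1)E(B_2)D(B_2)\cdots E(B_k)D(B_k)$. A dequeue is *null* if the queue is empty when it is linearized; it then returns null. **Theorem.** There is an absolute constant $K$ such that the following holds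 for all $p\ge 2$, all such trees, and all finite executions of this implementation. Let $c$ be the maximum point contention during the execution. 1. Each Enqueue and each null Dequeue takes at most $K\log_2 p$ steps. So does each Dequeue during the time before it has been linearized. 2. Each non-null Dequeue takes at most $K\big(\log_2 p\,(1+\log_2 c)+\log_2 q_e+\log_2 q_d\big)$ steps, where $q_d$ is the size of the queue when the Dequeue is linearized (counting the element it removes) and $q_e$ is the size of the queue when the Enqueue of the value returned is linearized (counting the element it inserts). More precisely, the Enqueue meant is the one whose element the Dequeue removes in the sequential execution $L$; if the Dequeue terminates, its response is the argument of that Enqueue. 3. Consequently each Enqueue takes $O(\log p)$ steps, and each Dequeue takes $O(\log^2 p+\log q)$ steps: a non-null Dequeue takes at most $K(\log_2^2 p+\log_2 q)$ steps, where $q=\max(q_e,q_d)$. The bounds hold for terminated operations and for operations that are still running. -/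

import Mathlib

namespace WFQueue

/-! ## The ordering tree -/

/-- Full binary trees whose leaves carry process names. -/
inductive OTree (p : ℕ) : Type where
  | leaf (i : Fin p) : OTree p
  | node (l r : OTree p) : OTree p

namespace OTree

/-- The height (number of edges on a longest path from the root to a leaf). -/
def height {p : ℕ} : OTree p → ℕ
  | leaf _ => 0
  | node l r => max l.height r.height + 1

/-- The processes at the leaves, from left to right. -/
def leaves {p : ℕ} : OTree p → List (Fin p)
  | leaf i => [i]
  | node l r => l.leaves ++ r.leaves

/-- An ordering tree for `p` processes: a full binary tree of height `⌈log₂ p⌉` with exactly one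
leaf for each process. -/
structure IsOrderingTree {p : ℕ} (T : OTree p) : Prop where
  one_leaf_per_process : ∀ i : Fin p, T.leaves.count i = 1
  height_eq : T.height = Nat.clog 2 p

end OTree

/-- The two directions, left and right. -/
inductive Dir : Type where
  | left : Dir
  | right : Dir
  deriving DecidableEq

/-- A tree node is named by the path that leads to it, written from the node up to the root: the
root is `[]`, the child of `v` in direction `d` is `d :: v`, and the parent of `d :: v` is `v`. -/
abbrev Node : Type := List Dir

/-- The leaf of process `i`. -/
def OTree.leafOf {p : ℕ} : OTree p → Fin p → Node
  | .leaf _, _ => []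
  | .node l r, i => if i ∈ l.leaves then l.leafOf i ++ [Dir.left] else r.leafOf i ++ [Dir.right]

/-! ## Blocks, shared memory, and its atomic instructions -/

/-- A block. All fields but `super` are immutable. The fields `endLeft`, `endRight` are meaningful
in internal nodes, `element` in leaves (`none` is the null value, marking a dequeue), `size` in the
root. Integer fields that do not apply to a block are set to 0. -/
structure Block (V : Type) : Type where
  sumEnq : ℕ
  sumDeq : ℕ
  super : Option ℕ
  endLeft : ℕ
  endRight : ℕ
  element : Option V
  size : ℕ

/-- The dummy block stored in `blocks[0]` of each node. -/
def Block.empty (V : Type) : Block V := ⟨0, 0, none, 0, 0, none, 0⟩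

/-- The integer fields of a block. -/
inductive Field : Type where
  | sumEnq : Field
  | sumDeq : Field
  | super : Field
  | endOf (d : Dir) : Field
  | size : Field

def Block.get {V : Type} (B : Block V) : Field → ℕ
  | .sumEnq => B.sumEnq
  | .sumDeq => B.sumDeq
  | .super => B.super.getD 0
  | .endOf .left => B.endLeft
  | .endOf .right => B.endRight
  | .size => B.size

/-- The shared memory: each node has an infinite array `blocks` (`none` is null) and an index
`head`. -/
structure Memory (V : Type) : Type where
  blocks : Node → ℕ → Option (Block V)
  head : Node → ℕ

/-- Initially `blocks[0]` is the dummy block, the other entries are null, and `head = 1`. -/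
def Memory.init (V : Type) : Memory V where
  blocks := fun _ b => if b = 0 then some (Block.empty V) else none
  head := fun _ => 1

/-- The atomic instructions on the shared memory. Each execution of one of them is one step. -/
inductive MemOp (V : Type) : Type where
  /-- read `v.head` -/
  | readHead (v : Node) : MemOp V
  /-- test whether `v.blocks[b]` is different from null -/
  | notNull (v : Node) (b : ℕ) : MemOp V
  /-- read the integer field `f` of the block `v.blocks[b]` -/
  | readField (v : Node) (b : ℕ) (f : Field) : MemOp V
  /-- read `v.blocks[b].element` -/
  | readElement (v : Node) (b : ℕ) : MemOp V
  /-- `v.blocks[b] := B` -/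
  | writeBlock (v : Node) (b : ℕ) (B : Block V) : MemOp V
  /-- `CAS(v.blocks[b], null, B)` -/
  | casBlock (v : Node) (b : ℕ) (B : Block V) : MemOp V
  /-- `CAS(v.blocks[b].super, null, x)` -/
  | casSuper (v : Node) (b : ℕ) (x : ℕ) : MemOp V
  /-- `CAS(v.head, h, h')` -/
  | casHead (v : Node) (h h' : ℕ) : MemOp V

/-- The type of the value an instruction returns to the process executing it. -/
def MemOp.Resp {V : Type} : MemOp V → Type
  | readHead _ => ℕ
  | notNull _ _ => Bool
  | readField _ _ _ => ℕ
  | readElement _ _ => Option V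
  | writeBlock _ _ _ => Unit
  | casBlock _ _ _ => Bool
  | casSuper _ _ _ => Unit
  | casHead _ _ _ => Unit

def Memory.setBlock {V : Type} (m : Memory V) (v : Node) (b : ℕ) (B : Block V) : Memory V :=
  { m with blocks := Function.update m.blocks v (Function.update (m.blocks v) b (some B)) }

def Memory.setHead {V : Type} (m : Memory V) (v : Node) (h : ℕ) : Memory V :=
  { m with head := Function.update m.head v h }

/-- The semantics of the instructions: the value returned and the new memory. (The algorithm never
dereferences null; for definiteness such a read returns 0 or null.) -/
def MemOp.exec {V : Type} (m : Memory V) : (a : MemOp V) → a.Resp × Memory V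
  | readHead v => (m.head v, m)
  | notNull v b => ((m.blocks v b).isSome, m)
  | readField v b f => ((((m.blocks v b).map fun B => B.get f).getD 0 : ℕ), m)
  | readElement v b => ((m.blocks v b).bind fun B => B.element, m)
  | writeBlock v b B => ((), m.setBlock v b B)
  | casBlock v b B =>
      match m.blocks v b with
      | none => (true, m.setBlock v b B)
      | some _ => (false, m)
  | casSuper v b x =>
      match m.blocks v b with
      | none => ((), m)
      | some B =>
          match B.super with
          | none => ((), m.setBlock v b { B with super := some x })
          | some _ => ((), m)
  | casHead v h h' => ((), if m.head v = h then m.setHead v h' else m)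

/-! ## Sequential code of a process

A program either returns a value, or executes one instruction and continues according to the value
this instruction returned. In the code below, only a bounded amount of computation on
local variables takes place between two consecutive instructions. -/

inductive Prog (V : Type) (α : Type) : Type where
  | ret (a : α) : Prog V α
  | op (a : MemOp V) (k : a.Resp → Prog V α) : Prog V α

def Prog.bind {V α β : Type} : Prog V α → (α → Prog V β) → Prog V β
  | .ret a, f => f a
  | .op a k, f => .op a fun r => (k r).bind f

instance (V : Type) : Monad (Prog V) where
  pure := Prog.ret
  bind := Prog.bind

section Code

variable {V : Type}

def readHead (v : Node) : Prog V ℕ := .op (.readHead v) .ret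
def notNull (v : Node) (b : ℕ) : Prog V Bool := .op (.notNull v b) .ret
def readField (v : Node) (b : ℕ) (f : Field) : Prog V ℕ := .op (.readField v b f) .ret
def readElement (v : Node) (b : ℕ) : Prog V (Option V) := .op (.readElement v b) .ret
def writeBlock (v : Node) (b : ℕ) (B : Block V) : Prog V Unit := .op (.writeBlock v b B) .ret
def casBlock (v : Node) (b : ℕ) (B : Block V) : Prog V Bool := .op (.casBlock v b B) .ret
def casSuper (v : Node) (b x : ℕ) : Prog V Unit := .op (.casSuper v b x) .ret
def casHead (v : Node) (h h' : ℕ) : Prog V Unit := .op (.casHead v h h') .ret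

/-- `Advance(v, h)`: set `v.blocks[h].super` (if `v` is not the root) and increment `v.head` from
`h` to `h + 1`. -/
def advance : Node → ℕ → Prog V Unit
  | [], h => casHead [] h (h + 1)
  | d :: par, h => do
      let hp ← readHead par
      casSuper (d :: par) h hp
      casHead (d :: par) h (h + 1)

/-- `CreateBlock(v, i)`: create a new block to be installed in `v.blocks[i]`; the result is null
if there is nothing to propagate to `v`. (Here and below subtraction of natural numbers only
occurs with a result that is nonnegative, except for `size`, which the algorithm sets to
`max(0, v.blocks[i-1].size + numEnq - numDeq)`.) -/
def createBlock (v : Node) (i : ℕ) : Prog V (Option (Block V)) := do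
  let endLeft := (← readHead (.left :: v)) - 1
  let endRight := (← readHead (.right :: v)) - 1
  let sumEnq := (← readField (.left :: v) endLeft .sumEnq)
    + (← readField (.right :: v) endRight .sumEnq)
  let sumDeq := (← readField (.left :: v) endLeft .sumDeq)
    + (← readField (.right :: v) endRight .sumDeq)
  let numEnq := sumEnq - (← readField v (i - 1) .sumEnq)
  let numDeq := sumDeq - (← readField v (i - 1) .sumDeq)
  let size ← if v = [] then do
      let prevSize ← readField v (i - 1) .size
      pure (prevSize + numEnq - numDeq)
    else pure 0
  if numEnq + numDeq = 0 then
    pure none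
  else
    pure (some { sumEnq := sumEnq, sumDeq := sumDeq, super := none, endLeft := endLeft,
                 endRight := endRight, element := none, size := size })

/-- The body of the loop in `Refresh`: help to advance the child `w` if its head lags behind. -/
def helpChild (w : Node) : Prog V Unit := do
  let childHead ← readHead w
  let installed ← notNull w childHead
  if installed then advance w childHead else pure ()

/-- `Refresh(v)`: try to append a new block to `v.blocks`. -/
def refresh (v : Node) : Prog V Bool := do
  let h ← readHead v
  helpChild (.left :: v)
  helpChild (.right :: v)
  let new ← createBlock v h
  match new with
  | none => pure true
  | some B => do
      let result ← casBlock v h B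
      advance v h
      pure result

/-- The double refresh on `v`. -/
def doubleRefresh (v : Node) : Prog V Unit := do
  let ok ← refresh v
  if ok then pure () else do
    let _ ← refresh v
    pure ()

/-- `Propagate(v)`: a double refresh on each node from `v` up to the root. -/
def propagate : Node → Prog V Unit
  | [] => doubleRefresh []
  | d :: par => do
      doubleRefresh (d :: par)
      propagate par

/-- `Append(B)`: append the block to the leaf and propagate it to the root. -/
def append (leaf : Node) (B : Block V) : Prog V Unit := do
  let h ← readHead leaf
  writeBlock leaf h B
  advance leaf h
  propagate leaf.tail

/-- `IndexDequeue(v, b, i)`: the index `b'` of a block of the root and the rank `i'` such that the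
`i`th dequeue in `v.blocks[b]` is the `i'`th dequeue in `root.blocks[b']`. -/
def indexDequeue : Node → ℕ → ℕ → Prog V (ℕ × ℕ)
  | [], b, i => pure (b, i)
  | dir :: par, b, i => do
      let super ← readField (dir :: par) b .super
      let endSuper ← readField par super (.endOf dir)
      let sup := if endSuper < b then super + 1 else super
      let before ← readField (dir :: par) (b - 1) .sumDeq
      let prevEnd ← readField par (sup - 1) (.endOf dir)
      let prevSum ← readField (dir :: par) prevEnd .sumDeq
      let i₁ := i + (before - prevSum)
      let i₂ ← match dir with
        | .left => pure i₁
        | .right => do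
            let lastLeft ← readField par sup (.endOf .left)
            let lastSum ← readField (.left :: par) lastLeft .sumDeq
            let prevLeft ← readField par (sup - 1) (.endOf .left)
            let prevLeftSum ← readField (.left :: par) prevLeft .sumDeq
            pure (i₁ + (lastSum - prevLeftSum))
      indexDequeue par sup i₂

/-- Binary search for the least `b` in `[lo, hi]` with `v.blocks[b].sumEnq ≥ t`, given that `hi`
has this property. -/
def binarySearch (v : Node) (t : ℕ) (lo hi : ℕ) : Prog V ℕ :=
  if lo < hi then do
    let s ← readField v ((lo + hi) / 2) .sumEnq
    if t ≤ s then binarySearch v t lo ((lo + hi) / 2)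
    else binarySearch v t ((lo + hi) / 2 + 1) hi
  else pure lo
termination_by hi - lo

/-- Doubling search in the root from `b` downwards: compare `e` with the `sumEnq` fields at the
indices `b - 2 ^ k`, `b - 2 ^ (k + 1)`, …, until an index is found whose prefix sum is less than
`e` (index 0, with prefix sum 0, at the latest). -/
def doublingSearch (b e : ℕ) (k : ℕ) : Prog V ℕ :=
  if 2 ^ k < b then do
    let s ← readField [] (b - 2 ^ k) .sumEnq
    if s < e then pure (b - 2 ^ k) else doublingSearch b e (k + 1)
  else pure 0
termination_by b - 2 ^ k
decreasing_by
  have : 2 ^ k < 2 ^ (k + 1) := Nat.pow_lt_pow_succ (by norm_num)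
  omega

/-- The search for the least `b' ≤ b` with `root.blocks[b'].sumEnq ≥ e`. -/
def rootSearch (b e : ℕ) : Prog V ℕ := do
  let lo ← doublingSearch b e 0
  binarySearch [] e (lo + 1) b

/-- `GetEnqueue(v, b, i)`: the argument of the `i`th enqueue in `v.blocks[b]`. The first argument is
the subtree rooted at `v`. -/
def getEnqueue {p : ℕ} : OTree p → Node → ℕ → ℕ → Prog V (Option V)
  | .leaf _, v, b, _ => readElement v b
  | .node l r, v, b, i => do
      let lastLeft ← readField v b (.endOf .left)
      let sumLeft ← readField (.left :: v) lastLeft .sumEnq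
      let prevEndLeft ← readField v (b - 1) (.endOf .left)
      let prevLeft ← readField (.left :: v) prevEndLeft .sumEnq
      let prevEndRight ← readField v (b - 1) (.endOf .right)
      let prevRight ← readField (.right :: v) prevEndRight .sumEnq
      if i ≤ sumLeft - prevLeft then do
        let lo ← readField v (b - 1) (.endOf .left)
        let hi ← readField v b (.endOf .left)
        let b' ← binarySearch (.left :: v) (i + prevLeft) (lo + 1) hi
        let s ← readField (.left :: v) (b' - 1) .sumEnq
        getEnqueue l (.left :: v) b' (i - (s - prevLeft))
      else do
        let i₁ := i - (sumLeft - prevLeft)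
        let lo ← readField v (b - 1) (.endOf .right)
        let hi ← readField v b (.endOf .right)
        let b' ← binarySearch (.right :: v) (i₁ + prevRight) (lo + 1) hi
        let s ← readField (.right :: v) (b' - 1) .sumEnq
        getEnqueue r (.right :: v) b' (i₁ - (s - prevRight))

/-- `FindResponse(b, i)`: the response to the `i`th dequeue in `root.blocks[b]`. -/
def findResponse {p : ℕ} (T : OTree p) (b i : ℕ) : Prog V (Option V) := do
  let numEnq := (← readField [] b .sumEnq) - (← readField [] (b - 1) .sumEnq)
  let prevSize ← readField [] (b - 1) .size
  if prevSize + numEnq < i then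
    pure none
  else do
    let e := i + (← readField [] (b - 1) .sumEnq) - (← readField [] (b - 1) .size)
    let bₑ ← rootSearch b e
    let iₑ := e - (← readField [] (bₑ - 1) .sumEnq)
    getEnqueue T [] bₑ iₑ

/-- `Enqueue(x)` by the process with the given leaf. -/
def enqueue (leaf : Node) (x : V) : Prog V Unit := do
  let sumEnq ← readField leaf ((← readHead leaf) - 1) .sumEnq
  let sumDeq ← readField leaf ((← readHead leaf) - 1) .sumDeq
  append leaf { sumEnq := sumEnq + 1, sumDeq := sumDeq, super := none, endLeft := 0,
                endRight := 0, element := some x, size := 0 }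

/-- `Dequeue()` by the process with the given leaf. -/
def dequeue {p : ℕ} (T : OTree p) (leaf : Node) : Prog V (Option V) := do
  let sumEnq ← readField leaf ((← readHead leaf) - 1) .sumEnq
  let sumDeq ← readField leaf ((← readHead leaf) - 1) .sumDeq
  append leaf { sumEnq := sumEnq, sumDeq := sumDeq + 1, super := none, endLeft := 0,
                endRight := 0, element := none, size := 0 }
  let h ← readHead leaf
  let bi ← indexDequeue leaf (h - 1) 1
  findResponse T bi.1 bi.2

end Code

/-- The operations of the queue. -/
inductive QueueOp (V : Type) : Type where
  | enqueue (x : V) : QueueOp V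
  | dequeue : QueueOp V

/-- The code process `i` runs to perform an operation. The result is the response of a dequeue
(`none` is the null response), and `none` for an enqueue, which has no response value. -/
def code {p : ℕ} {V : Type} (T : OTree p) (i : Fin p) : QueueOp V → Prog V (Option V)
  | .enqueue x => do
      enqueue (T.leafOf i) x
      pure none
  | .dequeue => dequeue T (T.leafOf i)

/-! ## Asynchronous executions -/

/-- `(i, k)` names the `k`th operation of process `i` (`k = 1, 2, …`). -/
abbrev OpId (p : ℕ) : Type := Fin p × ℕ

inductive Event (p : ℕ) (V : Type) : Type where
  /-- operation `o` is invoked -/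
  | invoke (o : OpId p) (a : QueueOp V) : Event p V
  /-- operation `o` takes a step, that is, executes one instruction -/
  | step (o : OpId p) : Event p V
  /-- operation `o` terminates with the given response -/
  | respond (o : OpId p) (r : Option V) : Event p V

/-- A configuration: the shared memory, for each process the rest of the program it is running
(`none` if it is idle), and the number of operations it has invoked. -/
structure Config (p : ℕ) (V : Type) : Type where
  mem : Memory V
  running : Fin p → Option (Prog V (Option V))
  invoked : Fin p → ℕ

def Config.init (p : ℕ) (V : Type) : Config p V where
  mem := Memory.init V
  running := fun _ => none
  invoked := fun _ => 0

/-- `Execution T tr C`: from the initial configuration, the sequence of events `tr` can occur and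
leads to the configuration `C`. The processes are scheduled in an arbitrary way. -/
inductive Execution {p : ℕ} {V : Type} (T : OTree p) : List (Event p V) → Config p V → Prop where
  | init : Execution T [] (Config.init p V)
  | invoke (tr : List (Event p V)) (C : Config p V) (i : Fin p) (a : QueueOp V) :
      Execution T tr C → C.running i = none →
      Execution T (tr ++ [.invoke (i, C.invoked i + 1) a])
        { mem := C.mem
          running := Function.update C.running i (some (code T i a))
          invoked := Function.update C.invoked i (C.invoked i + 1) }
  | step (tr : List (Event p V)) (C : Config p V) (i : Fin p) (a : MemOp V)
      (k : a.Resp → Prog V (Option V)) :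
      Execution T tr C → C.running i = some (.op a k) →
      Execution T (tr ++ [.step (i, C.invoked i)])
        { mem := (a.exec C.mem).2
          running := Function.update C.running i (some (k (a.exec C.mem).1))
          invoked := C.invoked }
  | respond (tr : List (Event p V)) (C : Config p V) (i : Fin p) (r : Option V) :
      Execution T tr C → C.running i = some (.ret r) →
      Execution T (tr ++ [.respond (i, C.invoked i) r])
        { mem := C.mem
          running := Function.update C.running i none
          invoked := C.invoked }

/-- The number of steps that operation `o` takes. -/
def steps {p : ℕ} {V : Type} (tr : List (Event p V)) (o : OpId p) : ℕ :=
  tr.countP fun ev =>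
    match ev with
    | .step o' => decide (o' = o)
    | _ => false

/-- The point contention at the end of `tr`: the number of operations that have been invoked and
have not terminated. -/
noncomputable def pointContention {p : ℕ} {V : Type} (tr : List (Event p V)) : ℕ :=
  Set.ncard {o : OpId p | (∃ a, Event.invoke o a ∈ tr) ∧ ∀ r, Event.respond o r ∉ tr}

/-- The maximum point contention at any time during `tr`. -/
noncomputable def maxContention {p : ℕ} {V : Type} (tr : List (Event p V)) : ℕ :=
  (Finset.range (tr.length + 1)).sup fun n => pointContention (tr.take n)

/-! ## The linearization -/

/-- The list `m, m + 1, …, n` with `m = a + 1`. -/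
def indexRange (a n : ℕ) : List ℕ := List.range' (a + 1) (n - a)

/-- The operations contained in the block `v.blocks[b]`, in order: the enqueues `E(B)` if `enq` is
true, the dequeues `D(B)` otherwise. A block at index `b ≥ 1` of the leaf of process `i` represents
the `b`th operation of `i` (each operation appends exactly one block to the leaf); a block of
an internal node contains the operations of its direct subblocks, those of the left child first.
The first explicit argument after the memory is the subtree rooted at `v`. -/
def blockOps {p : ℕ} {V : Type} (enq : Bool) (m : Memory V) : OTree p → Node → ℕ → List (OpId p)
  | .leaf i, v, b =>
      match m.blocks v b with
      | some B => if 1 ≤ b ∧ B.element.isSome = enq then [(i, b)] else []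
      | none => []
  | .node l r, v, b =>
      match m.blocks v (b - 1), m.blocks v b with
      | some B', some B =>
          (indexRange B'.endLeft B.endLeft).flatMap (blockOps enq m l (.left :: v)) ++
          (indexRange B'.endRight B.endRight).flatMap (blockOps enq m r (.right :: v))
      | _, _ => []

/-- An enqueue or a dequeue in a sequential execution of a queue. -/
inductive SeqOp (p : ℕ) : Type where
  | enq (o : OpId p) : SeqOp p
  | deq (o : OpId p) : SeqOp p

/-- The linearization ordering `L = E(B₁) D(B₁) E(B₂) D(B₂) ⋯ E(Bₖ) D(Bₖ)`, where `B₁, …, Bₖ` are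
the blocks of the root (the root's `blocks` array is null beyond index `head`, and null entries
contribute no operations). -/
def linearization {p : ℕ} {V : Type} (T : OTree p) (m : Memory V) : List (SeqOp p) :=
  (indexRange 0 (m.head [])).flatMap fun b =>
    (blockOps true m T [] b).map SeqOp.enq ++ (blockOps false m T [] b).map SeqOp.deq

/-- The content of the queue (front first) after the given operations have been applied one after
the other to an empty queue. An element of the queue is represented by the operation that
enqueued it. -/
def queueAfter {p : ℕ} (L : List (SeqOp p)) : List (OpId p) :=
  L.foldl (fun q a =>
    match a with
    | .enq o => q ++ [o]
    | .deq _ => q.tail) []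

/-- The dequeue `d` is not in `L`. -/
def NotLinearized {p : ℕ} (L : List (SeqOp p)) (d : OpId p) : Prop := SeqOp.deq d ∉ L

/-- The dequeue `d` occurs in `L` at a point where the queue is empty. -/
def IsNullDequeue {p : ℕ} (L : List (SeqOp p)) (d : OpId p) : Prop :=
  ∃ L₁ L₂, L = L₁ ++ SeqOp.deq d :: L₂ ∧ queueAfter L₁ = []

/-- In the sequential execution `L`, the dequeue `d` removes the element inserted by the
enqueue `e`; the queue contains `qd` elements when `d` removes it (this element included). -/
def Dequeues {p : ℕ} (L : List (SeqOp p)) (d e : OpId p) (qd : ℕ) : Prop :=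
  ∃ L₁ L₂ rest, L = L₁ ++ SeqOp.deq d :: L₂ ∧ queueAfter L₁ = e :: rest ∧
    qd = (queueAfter L₁).length

/-- In the sequential execution `L`, the queue contains `qe` elements once the enqueue `e` has
inserted its element (this element included). -/
def EnqueuedAt {p : ℕ} (L : List (SeqOp p)) (e : OpId p) (qe : ℕ) : Prop :=
  ∃ L₁ L₂, L = L₁ ++ SeqOp.enq e :: L₂ ∧ qe = (queueAfter (L₁ ++ [SeqOp.enq e])).length

end WFQueue

open WFQueue

/-! The bounds rest on three facts about the tree of blocks.

Propagation: `refresh` reads `v.head` before it looks at the children, so the block installed at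
index `b` contains everything the children held at any earlier moment with `v.head < b` (the field
`snap` of `Inv`). If both attempts of a double refresh fail, then two blocks were installed
meanwhile, and the second one covers all that was there at the start (`wp_doubleRefresh`). Hence
`append` brings an operation to the root in O(1) steps per level. By the same fact the head of the
parent that `advance` stores in `super` is the index of the superblock or one less, so
`rd_indexDequeue` also needs O(1) steps per level.

Width: finished operations are in the root already, so a new block contains only running operations,
at most one per process. As no subblock is empty, a block has at most `c` subblocks in each child
(`NewBlock.width`), and each binary search in `rd_getEnqueue` takes about log `c` steps.

Distance: after a prefix of the root's blocks the queue is the suffix of length `size` of the list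
of all enqueues (`queueAfter_rootOps`), so the element a dequeue removes is found by arithmetic with
prefix sums. The blocks between its enqueue and its dequeue hold only enqueues behind it and
dequeues of elements in front of it, fewer than `qd` and `qe` respectively (`block_distance`). This
bounds the doubling search by the logarithm of `qe + qd`.

Concurrency is handled by rely-guarantee reasoning. `wp` lets other processes change the state
according to `Le` before each instruction, and the ghost field `past` records all earlier memories.
Once an operation is in the root, its code reads almost only data that are frozen, and `rd` treats
such code as a sequential program on one fixed memory. A dequeue is split by `staged`: within
`opSteps` steps it knows whether its response is null, and only one that is already linearized as
non-null continues. The linearization has no repetitions and grows only at its end, so the enqueue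
and the queue sizes found at that point remain valid. `Describes` carries all this along a trace. -/

namespace WFQueue

variable {p : ℕ} {V : Type}

/-! ## Nodes and subtrees -/

/-- The subtree of a node in a given direction. -/
def OTree.child : Dir → OTree p → OTree p → OTree p
  | .left, l, _ => l
  | .right, _, r => r

/-- `T.Sub v t`: the subtree of `T` rooted at the node `v` is `t`. -/
inductive OTree.Sub (T : OTree p) : Node → OTree p → Prop
  | root : OTree.Sub T [] T
  | down {v : Node} {l r : OTree p} (d : Dir) :
      OTree.Sub T v (.node l r) → OTree.Sub T (d :: v) (OTree.child d l r)

theorem OTree.Sub.left {T l r : OTree p} {v : Node} (h : T.Sub v (.node l r)) :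
    T.Sub (.left :: v) l := h.down .left

theorem OTree.Sub.right {T l r : OTree p} {v : Node} (h : T.Sub v (.node l r)) :
    T.Sub (.right :: v) r := h.down .right

theorem OTree.Sub.parent {T t : OTree p} {v : Node} {d : Dir} (h : T.Sub (d :: v) t) :
    ∃ l r, T.Sub v (.node l r) ∧ t = OTree.child d l r := by
  cases h with
  | down d h => exact ⟨_, _, h, rfl⟩

theorem OTree.Sub.unique {T : OTree p} {v : Node} {t t' : OTree p} (h : T.Sub v t)
    (h' : T.Sub v t') : t = t' := by
  induction h generalizing t' with
  | root => cases h'; rfl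
  | down d _ ih =>
    cases h' with
    | down _ h' => cases ih h'; rfl

theorem OTree.Sub.trans_append {T t s : OTree p} {v w : Node} (h : T.Sub v t) (h' : t.Sub w s) :
    T.Sub (w ++ v) s := by
  induction h' with
  | root => exact h
  | down d _ ih => exact ih.down d

theorem OTree.leaves_child {d : Dir} {l r : OTree p} {i : Fin p}
    (h : i ∈ (OTree.child d l r).leaves) : i ∈ (OTree.node l r).leaves := by
  cases d <;> simp_all [OTree.child, OTree.leaves]

theorem OTree.Sub.leaves_sublist {T t : OTree p} {v : Node} (h : T.Sub v t) :
    t.leaves.Sublist T.leaves := by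
  induction h with
  | root => exact List.Sublist.refl _
  | down d _ ih =>
    refine List.Sublist.trans ?_ ih
    cases d
    · exact List.sublist_append_left _ _
    · exact List.sublist_append_right _ _

theorem OTree.sub_leafOf {t : OTree p} {i : Fin p} (h : i ∈ t.leaves) :
    t.Sub (t.leafOf i) (.leaf i) := by
  induction t with
  | leaf j =>
    simp only [OTree.leaves, List.mem_singleton] at h
    subst h
    exact .root
  | node l r ihl ihr =>
    unfold OTree.leafOf
    split_ifs with hl
    · exact (OTree.Sub.root.down (l := l) (r := r) .left).trans_append (ihl hl)
    · refine (OTree.Sub.root.down (l := l) (r := r) .right).trans_append (ihr ?_)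
      simpa [OTree.leaves, hl] using h

theorem OTree.length_leafOf (t : OTree p) (i : Fin p) : (t.leafOf i).length ≤ t.height := by
  induction t with
  | leaf j => simp [OTree.leafOf]
  | node l r ihl ihr =>
    unfold OTree.leafOf OTree.height
    split_ifs <;> simp <;> omega

/-- On the way down to a subtree containing `i`, `leafOf` takes the same turns, since `i` cannot
occur on both sides of a node. -/
theorem OTree.Sub.leaf_eq_leafOf {T : OTree p} (hT : T.leaves.Nodup) {v : Node} {i : Fin p}
    (h : T.Sub v (.leaf i)) : v = T.leafOf i := by
  have key : ∀ {v : Node} {t : OTree p}, T.Sub v t → i ∈ t.leaves →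
      T.leafOf i = t.leafOf i ++ v := by
    intro v t h
    induction h with
    | root => simp
    | @down v l r d h ih =>
      intro hi
      rw [ih (OTree.leaves_child hi)]
      have hnd : (l.leaves ++ r.leaves).Nodup := hT.sublist h.leaves_sublist
      cases d
      · simp only [OTree.child] at hi ⊢
        simp [OTree.leafOf, hi]
      · simp only [OTree.child] at hi ⊢
        have : i ∉ l.leaves := fun hl => (List.nodup_append.1 hnd).2.2 _ hl _ hi rfl
        simp [OTree.leafOf, this]
  have := key h (by simp [OTree.leaves])
  simpa [OTree.leafOf] using this.symm

/-! ## Reading the memory -/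

/-- `v.blocks[b]` is not null. -/
def Memory.ex (m : Memory V) (v : Node) (b : ℕ) : Prop := (m.blocks v b).isSome

/-- The value returned by reading the integer field `f` of `v.blocks[b]`. -/
def Memory.fld (m : Memory V) (v : Node) (b : ℕ) (f : Field) : ℕ :=
  ((m.blocks v b).map fun B => B.get f).getD 0

/-- The value returned by reading the element of `v.blocks[b]`. -/
def Memory.elem (m : Memory V) (v : Node) (b : ℕ) : Option V :=
  (m.blocks v b).bind fun B => B.element

/-- The field `super` of `v.blocks[b]`. -/
def Memory.sup (m : Memory V) (v : Node) (b : ℕ) : Option ℕ :=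
  (m.blocks v b).bind fun B => B.super

theorem Memory.ex_of_eq {m : Memory V} {v : Node} {b : ℕ} {B : Block V}
    (h : m.blocks v b = some B) : m.ex v b := by simp [Memory.ex, h]

theorem Memory.fld_of_eq {m : Memory V} {v : Node} {b : ℕ} {B : Block V}
    (h : m.blocks v b = some B) (f : Field) : m.fld v b f = B.get f := by simp [Memory.fld, h]

theorem Memory.sup_of_eq {m : Memory V} {v : Node} {b : ℕ} {B : Block V}
    (h : m.blocks v b = some B) : m.sup v b = B.super := by simp [Memory.sup, h]

theorem Memory.ex_of_sup {m : Memory V} {v : Node} {b x : ℕ} (h : m.sup v b = some x) :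
    m.ex v b := by
  unfold Memory.sup at h
  unfold Memory.ex
  cases hB : m.blocks v b <;> simp_all

theorem Memory.fld_super_of_sup {m : Memory V} {v : Node} {b x : ℕ} (h : m.sup v b = some x) :
    m.fld v b .super = x := by
  unfold Memory.sup at h
  cases hB : m.blocks v b with
  | none => simp [hB] at h
  | some B =>
    rw [hB] at h
    simp only [Option.bind_some] at h
    rw [Memory.fld_of_eq hB]
    simp [Block.get, h]

/-- The memory `m'` may occur later than `m`: heads have not decreased, blocks have not disappeared,
and apart from assignments to `super` fields that were null they have not changed. -/
structure MLe (m m' : Memory V) : Prop where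
  head : ∀ v, m.head v ≤ m'.head v
  ex : ∀ {v b}, m.ex v b → m'.ex v b
  fld : ∀ {v b f}, m.ex v b → f ≠ .super → m'.fld v b f = m.fld v b f
  elem : ∀ {v b}, m.ex v b → m'.elem v b = m.elem v b
  sup : ∀ {v b x}, m.sup v b = some x → m'.sup v b = some x

theorem MLe.refl (m : Memory V) : MLe m m :=
  ⟨fun _ => le_rfl, fun h => h, fun _ _ => rfl, fun _ => rfl, fun h => h⟩

theorem MLe.trans {m₁ m₂ m₃ : Memory V} (h : MLe m₁ m₂) (h' : MLe m₂ m₃) : MLe m₁ m₃ :=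
  ⟨fun v => (h.head v).trans (h'.head v), fun e => h'.ex (h.ex e),
    fun e hf => (h'.fld (h.ex e) hf).trans (h.fld e hf),
    fun e => (h'.elem (h.ex e)).trans (h.elem e), fun e => h'.sup (h.sup e)⟩

/-- The field that counts enqueues (`true`) or dequeues (`false`). -/
def cntField : Bool → Field
  | true => .sumEnq
  | false => .sumDeq

@[simp] theorem cntField_ne_super (e : Bool) : cntField e ≠ .super := by cases e <;> simp [cntField]

/-- The invariant of the tree of blocks. -/
structure MInv (T : OTree p) (m : Memory V) : Prop where
  head_pos : ∀ {v t}, T.Sub v t → 1 ≤ m.head v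
  ex_lt : ∀ {v t b}, T.Sub v t → b < m.head v → m.ex v b
  -- With `ex_lt`, only the slot at the head itself is undetermined: it is filled after a block is
  -- installed and before the head moves on.
  le_head : ∀ {v t b}, T.Sub v t → m.ex v b → b ≤ m.head v
  zero : ∀ {v t f}, T.Sub v t → f ≠ .super → m.fld v 0 f = 0
  leaf : ∀ {v i b}, T.Sub v (.leaf i) → m.ex v (b + 1) → ∀ e, m.fld v (b + 1) (cntField e) =
    m.fld v b (cntField e) + if (m.elem v (b + 1)).isSome = e then 1 else 0
  end_mono : ∀ {v l r b}, T.Sub v (.node l r) → m.ex v (b + 1) → ∀ d,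
    m.fld v b (.endOf d) ≤ m.fld v (b + 1) (.endOf d)
  end_lt : ∀ {v l r b}, T.Sub v (.node l r) → m.ex v b → ∀ d,
    m.fld v b (.endOf d) < m.head (d :: v)
  sum : ∀ {v l r b}, T.Sub v (.node l r) → m.ex v b → ∀ e, m.fld v b (cntField e) =
    m.fld (.left :: v) (m.fld v b (.endOf .left)) (cntField e) +
    m.fld (.right :: v) (m.fld v b (.endOf .right)) (cntField e)
  strict : ∀ {v l r b}, T.Sub v (.node l r) → m.ex v (b + 1) →
    m.fld v b .sumEnq + m.fld v b .sumDeq < m.fld v (b + 1) .sumEnq + m.fld v (b + 1) .sumDeq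
  size : ∀ {l r b}, T.Sub [] (.node l r) → m.ex [] (b + 1) → m.fld [] (b + 1) .size = m.fld [] b .size +
    (m.fld [] (b + 1) .sumEnq - m.fld [] b .sumEnq) -
    (m.fld [] (b + 1) .sumDeq - m.fld [] b .sumDeq)
  -- `advance` sets `super` before it moves the head. Index 0 is excluded because the dummy block is
  -- never advanced over.
  sup : ∀ {d v t b}, T.Sub (d :: v) t → 1 ≤ b → b < m.head (d :: v) → ∃ x, m.sup (d :: v) b = some x

section MInv

variable {T : OTree p} {m : Memory V}

theorem MInv.ex_zero (h : MInv T m) {v : Node} {t : OTree p} (hv : T.Sub v t) : m.ex v 0 :=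
  h.ex_lt hv (h.head_pos hv)

theorem MInv.ex_of_le (h : MInv T m) {v : Node} {t : OTree p} (hv : T.Sub v t) {b b' : ℕ}
    (hb : m.ex v b) (hle : b' ≤ b) : m.ex v b' := by
  rcases hle.lt_or_eq with hlt | rfl
  · exact h.ex_lt hv (hlt.trans_le (h.le_head hv hb))
  · exact hb

theorem MInv.ex_end (h : MInv T m) {v : Node} {l r : OTree p} (hv : T.Sub v (.node l r)) {b : ℕ}
    (hb : m.ex v b) (d : Dir) : m.ex (d :: v) (m.fld v b (.endOf d)) :=
  h.ex_lt (hv.down d) (h.end_lt hv hb d)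

theorem MInv.end_le (h : MInv T m) {v : Node} {l r : OTree p} (hv : T.Sub v (.node l r))
    {b b' : ℕ} (hb : m.ex v b) (hle : b' ≤ b) (d : Dir) :
    m.fld v b' (.endOf d) ≤ m.fld v b (.endOf d) := by
  induction b, hle using Nat.le_induction with
  | base => exact le_rfl
  | succ n hn ih =>
    exact (ih (h.ex_of_le hv hb n.le_succ)).trans (h.end_mono hv hb d)

/-- The sums of a block increase from block to block. -/
theorem MInv.sum_le (h : MInv T m) (e : Bool) {v : Node} {t : OTree p} (hv : T.Sub v t)
    {b b' : ℕ} (hb : m.ex v b) (hle : b' ≤ b) :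
    m.fld v b' (cntField e) ≤ m.fld v b (cntField e) := by
  induction t generalizing v b b' with
  | leaf i =>
    induction b, hle using Nat.le_induction with
    | base => exact le_rfl
    | succ n hn ih =>
      refine (ih (h.ex_of_le hv hb n.le_succ)).trans ?_
      rw [h.leaf hv hb e]
      omega
  | node l r ihl ihr =>
    have hb' := h.ex_of_le hv hb hle
    rw [h.sum hv hb, h.sum hv hb']
    exact Nat.add_le_add (ihl hv.left (h.ex_end hv hb .left) (h.end_le hv hb hle .left))
      (ihr hv.right (h.ex_end hv hb .right) (h.end_le hv hb hle .right))

/-- At a leaf exactly one of the two sums grows by one. -/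
theorem MInv.strict' (h : MInv T m) {v : Node} {t : OTree p} (hv : T.Sub v t) {b : ℕ}
    (hb : m.ex v (b + 1)) :
    m.fld v b .sumEnq + m.fld v b .sumDeq < m.fld v (b + 1) .sumEnq + m.fld v (b + 1) .sumDeq := by
  cases t with
  | node l r => exact h.strict hv hb
  | leaf i =>
    have h1 := h.leaf hv hb true
    have h2 := h.leaf hv hb false
    simp only [cntField] at h1 h2
    rw [h1, h2]
    cases (m.elem v (b + 1)).isSome <;> simp

/-- Each block after the dummy block contains an operation. -/
theorem MInv.sub_le_sums (h : MInv T m) {v : Node} {t : OTree p} (hv : T.Sub v t) {b b' : ℕ}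
    (hb : m.ex v b) (hle : b' ≤ b) : m.fld v b' .sumEnq + m.fld v b' .sumDeq + (b - b') ≤
      m.fld v b .sumEnq + m.fld v b .sumDeq := by
  induction b, hle using Nat.le_induction with
  | base => simp
  | succ n hn ih =>
    have h1 := ih (h.ex_of_le hv hb n.le_succ)
    have h2 := h.strict' hv hb
    omega

end MInv

/-! ## The operations contained in blocks -/

/-- The enqueues (`e = true`) or dequeues (`e = false`) in the blocks `v.blocks[1..b]`. -/
def content (e : Bool) (m : Memory V) (t : OTree p) (v : Node) (b : ℕ) : List (OpId p) :=
  (indexRange 0 b).flatMap (blockOps e m t v)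

theorem indexRange_append {a b c : ℕ} (hab : a ≤ b) (hbc : b ≤ c) :
    indexRange a c = indexRange a b ++ indexRange b c := by
  unfold indexRange
  have : c - a = (b - a) + (c - b) := by omega
  rw [this, ← List.range'_append_1]
  congr 2
  omega

theorem indexRange_succ (b : ℕ) : indexRange b (b + 1) = [b + 1] := by simp [indexRange]

theorem indexRange_self (b : ℕ) : indexRange b b = [] := by simp [indexRange]

theorem mem_indexRange {a c x : ℕ} : x ∈ indexRange a c ↔ a < x ∧ x ≤ c := by
  simp only [indexRange, List.mem_range'_1]
  omega

theorem content_zero (e : Bool) (m : Memory V) (t : OTree p) (v : Node) :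
    content e m t v 0 = [] := by simp [content, indexRange_self]

theorem content_append (e : Bool) (m : Memory V) (t : OTree p) (v : Node) {a b : ℕ} (h : a ≤ b) :
    content e m t v b = content e m t v a ++ (indexRange a b).flatMap (blockOps e m t v) := by
  rw [content, indexRange_append (Nat.zero_le a) h, List.flatMap_append, content]

theorem content_succ (e : Bool) (m : Memory V) (t : OTree p) (v : Node) (b : ℕ) :
    content e m t v (b + 1) = content e m t v b ++ blockOps e m t v (b + 1) := by
  rw [content_append e m t v b.le_succ, indexRange_succ]
  simp

theorem content_subset (e : Bool) (m : Memory V) (t : OTree p) (v : Node) {a b : ℕ} (h : a ≤ b) :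
    content e m t v a ⊆ content e m t v b := by
  rw [content_append e m t v h]
  exact List.subset_append_left _ _

theorem blockOps_leaf (e : Bool) {m : Memory V} (i : Fin p) {v : Node} {b : ℕ} (h : m.ex v b) :
    blockOps e m (.leaf i) v b = if 1 ≤ b ∧ (m.elem v b).isSome = e then [(i, b)] else [] := by
  unfold Memory.ex at h
  obtain ⟨B, hB⟩ := Option.isSome_iff_exists.1 h
  simp [blockOps, hB, Memory.elem]

theorem blockOps_node (e : Bool) {m : Memory V} (l r : OTree p) {v : Node} {b : ℕ}
    (h' : m.ex v (b - 1)) (h : m.ex v b) :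
    blockOps e m (.node l r) v b =
      (indexRange (m.fld v (b - 1) (.endOf .left)) (m.fld v b (.endOf .left))).flatMap
        (blockOps e m l (.left :: v)) ++
      (indexRange (m.fld v (b - 1) (.endOf .right)) (m.fld v b (.endOf .right))).flatMap
        (blockOps e m r (.right :: v)) := by
  unfold Memory.ex at h h'
  obtain ⟨B, hB⟩ := Option.isSome_iff_exists.1 h
  obtain ⟨B', hB'⟩ := Option.isSome_iff_exists.1 h'
  simp [blockOps, hB, hB', Memory.fld, Block.get]

theorem blockOps_of_not_ex (e : Bool) {m : Memory V} (t : OTree p) {v : Node} {b : ℕ}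
    (h : ¬ m.ex v b) : blockOps e m t v b = [] := by
  have hB : m.blocks v b = none := by simpa [Memory.ex] using h
  cases t with
  | leaf i => simp [blockOps, hB]
  | node l r => 
    unfold blockOps
    rw [hB]
    cases m.blocks v (b - 1) <;> rfl

section Content

variable {T : OTree p} {m : Memory V}

/-- Only the order differs: `v` alternates between its children block by block, so the induction
step moves the new left part past the old right part. Up to order is enough for counting, membership
and absence of repetitions. -/
theorem content_perm (h : MInv T m) (e : Bool) {v : Node} {l r : OTree p}
    (hv : T.Sub v (.node l r)) {b : ℕ} (hb : m.ex v b) :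
    (content e m (.node l r) v b).Perm
      (content e m l (.left :: v) (m.fld v b (.endOf .left)) ++
        content e m r (.right :: v) (m.fld v b (.endOf .right))) := by
  induction b with
  | zero =>
    rw [h.zero hv (by simp), h.zero hv (by simp)]
    simp [content_zero]
  | succ b ih =>
    have hb' := h.ex_of_le hv hb b.le_succ
    rw [content_succ, blockOps_node e l r hb' hb, content_append e m l _ (h.end_mono hv hb .left),
      content_append e m r _ (h.end_mono hv hb .right)]
    refine ((ih hb').append_right _).trans ?_
    simp only [Nat.add_sub_cancel]
    simp only [List.append_assoc]
    refine List.Perm.append_left _ ?_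
    rw [← List.append_assoc, ← List.append_assoc]
    exact List.perm_append_comm.append_right _

/-- The stored prefix sums are true counts. This links the arithmetic of the algorithm to lists of
operations. -/
theorem length_content (h : MInv T m) (e : Bool) {v : Node} {t : OTree p} (hv : T.Sub v t) {b : ℕ}
    (hb : m.ex v b) : (content e m t v b).length = m.fld v b (cntField e) := by
  induction t generalizing v b with
  | leaf i =>
    induction b with
    | zero => rw [h.zero hv (by simp)]; simp [content_zero]
    | succ b ih =>
      rw [content_succ, List.length_append, ih (h.ex_of_le hv hb b.le_succ), h.leaf hv hb e,
        blockOps_leaf e i hb]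
      split_ifs <;> simp_all
  | node l r ihl ihr =>
    rw [(content_perm h e hv hb).length_eq, List.length_append, ihl hv.left (h.ex_end hv hb .left),
      ihr hv.right (h.ex_end hv hb .right), h.sum hv hb]

theorem length_blockOps (h : MInv T m) (e : Bool) {v : Node} {t : OTree p} (hv : T.Sub v t) {b : ℕ}
    (hb : m.ex v (b + 1)) :
    m.fld v b (cntField e) + (blockOps e m t v (b + 1)).length = m.fld v (b + 1) (cntField e) := by
  have h1 := length_content h e hv hb
  have h2 := length_content h e hv (h.ex_of_le hv hb b.le_succ)
  rw [content_succ, List.length_append] at h1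
  omega

theorem length_flatMap_blockOps (h : MInv T m) (e : Bool) {v : Node} {t : OTree p}
    (hv : T.Sub v t) {a b : ℕ} (hb : m.ex v b) (hab : a ≤ b) :
    m.fld v a (cntField e) + ((indexRange a b).flatMap (blockOps e m t v)).length =
      m.fld v b (cntField e) := by
  have h1 := length_content h e hv hb
  have h2 := length_content h e hv (h.ex_of_le hv hb hab)
  rw [content_append e m t v hab, List.length_append] at h1
  omega

/-- Every operation in a block stems from a leaf block, whose process fixes the child it came
through and whose element fixes its kind. -/
theorem content_sound (h : MInv T m) {e : Bool} {v : Node} {t : OTree p} (hv : T.Sub v t) {b : ℕ}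
    (hb : m.ex v b) {o : OpId p} (ho : o ∈ content e m t v b) :
    o.1 ∈ t.leaves ∧ 1 ≤ o.2 ∧ ∃ w, T.Sub w (.leaf o.1) ∧ m.ex w o.2 ∧
      (m.elem w o.2).isSome = e := by
  induction t generalizing v b with
  | leaf i =>
    simp only [content, List.mem_flatMap] at ho
    obtain ⟨k, hk, ho⟩ := ho
    rw [mem_indexRange] at hk
    rw [blockOps_leaf e i (h.ex_of_le hv hb hk.2)] at ho
    split_ifs at ho with hc
    · simp only [List.mem_singleton] at ho
      subst ho
      exact ⟨by simp [OTree.leaves], hc.1, v, hv, h.ex_of_le hv hb hk.2, hc.2⟩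
    · simp at ho
  | node l r ihl ihr =>
    rw [(content_perm h e hv hb).mem_iff, List.mem_append] at ho
    rcases ho with ho | ho
    · obtain ⟨h1, h2⟩ := ihl hv.left (h.ex_end hv hb .left) ho
      exact ⟨by simp [OTree.leaves, h1], h2⟩
    · obtain ⟨h1, h2⟩ := ihr hv.right (h.ex_end hv hb .right) ho
      exact ⟨by simp [OTree.leaves, h1], h2⟩

/-- Blocks of one leaf have different indices, and the two children of a node have disjoint sets of
processes. -/
theorem nodup_content (hT : T.leaves.Nodup) (h : MInv T m) (e : Bool) {v : Node} {t : OTree p}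
    (hv : T.Sub v t) {b : ℕ} (hb : m.ex v b) : (content e m t v b).Nodup := by
  induction t generalizing v b with
  | leaf i =>
    induction b with
    | zero => simp [content_zero]
    | succ b ih =>
      rw [content_succ, List.nodup_append]
      refine ⟨ih (h.ex_of_le hv hb b.le_succ), ?_, ?_⟩
      · rw [blockOps_leaf e i hb]
        split_ifs <;> simp
      · intro o ho o' ho' heq
        subst heq
        rw [blockOps_leaf e i hb] at ho'
        split_ifs at ho' with hc
        · simp only [List.mem_singleton] at ho'
          subst ho'
          simp only [content, List.mem_flatMap] at ho
          obtain ⟨k, hk, ho⟩ := ho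
          rw [mem_indexRange] at hk
          rw [blockOps_leaf e i (h.ex_of_le hv hb (by omega))] at ho
          split_ifs at ho
          · simp only [List.mem_singleton, Prod.mk.injEq, true_and] at ho
            omega
          · simp at ho
        · simp at ho'
  | node l r ihl ihr =>
    rw [(content_perm h e hv hb).nodup_iff, List.nodup_append]
    refine ⟨ihl hv.left (h.ex_end hv hb .left), ihr hv.right (h.ex_end hv hb .right), ?_⟩
    intro o ho o' ho' heq
    subst heq
    have hnd : (l.leaves ++ r.leaves).Nodup := hT.sublist hv.leaves_sublist
    exact (List.nodup_append.1 hnd).2.2 _ (content_sound h hv.left (h.ex_end hv hb .left) ho).1 _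
      (content_sound h hv.right (h.ex_end hv hb .right) ho').1 rfl

/-- The part of the content of a block that comes from a given child. -/
theorem content_child_iff (hT : T.leaves.Nodup) (h : MInv T m) {e : Bool} {v : Node}
    {l r : OTree p} (hv : T.Sub v (.node l r)) {b : ℕ} (hb : m.ex v b) {d : Dir} {o : OpId p}
    (ho : o.1 ∈ (OTree.child d l r).leaves) :
    o ∈ content e m (.node l r) v b ↔
      o ∈ content e m (OTree.child d l r) (d :: v) (m.fld v b (.endOf d)) := by
  have hnd : (l.leaves ++ r.leaves).Nodup := hT.sublist hv.leaves_sublist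
  have hdis := (List.nodup_append.1 hnd).2.2
  rw [(content_perm h e hv hb).mem_iff, List.mem_append]
  cases d
  · refine ⟨fun h' => h'.resolve_right fun hr => ?_, Or.inl⟩
    exact hdis _ ho _ (content_sound h hv.right (h.ex_end hv hb .right) hr).1 rfl
  · refine ⟨fun h' => h'.resolve_left fun hl => ?_, Or.inr⟩
    exact hdis _ (content_sound h hv.left (h.ex_end hv hb .left) hl).1 _ ho rfl

/-- An operation that has been propagated to the root has been propagated to all nodes on the way. -/
theorem content_down (hT : T.leaves.Nodup) (h : MInv T m) {e : Bool} {o : OpId p} {k : ℕ}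
    (hk : k < m.head []) (ho : o ∈ content e m T [] k) {v : Node} {t : OTree p} (hv : T.Sub v t)
    (hi : o.1 ∈ t.leaves) : ∃ k' < m.head v, o ∈ content e m t v k' := by
  induction hv with
  | root => exact ⟨k, hk, ho⟩
  | @down v l r d hv ih =>
    obtain ⟨k', hk', ho'⟩ := ih (OTree.leaves_child hi)
    have hex := h.ex_lt hv hk'
    exact ⟨_, h.end_lt hv hex d, (content_child_iff hT h hv hex hi).1 ho'⟩

/-- Only immutable fields of existing blocks enter the definition, so later changes of the memory do
not matter. -/
theorem blockOps_mono {m' : Memory V} (h : MInv T m) (hm : MLe m m') (e : Bool) {v : Node}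
    {t : OTree p} (hv : T.Sub v t) {b : ℕ} (hb : m.ex v b) :
    blockOps e m' t v b = blockOps e m t v b := by
  induction t generalizing v b with
  | leaf i => rw [blockOps_leaf e i hb, blockOps_leaf e i (hm.ex hb), hm.elem hb]
  | node l r ihl ihr =>
    have hb' := h.ex_of_le hv hb (Nat.sub_le b 1)
    rw [blockOps_node e l r hb' hb, blockOps_node e l r (hm.ex hb') (hm.ex hb)]
    rw [hm.fld hb (by simp), hm.fld hb (by simp), hm.fld hb' (by simp), hm.fld hb' (by simp)]
    congr 1
    · refine List.flatMap_congr fun k hk => ihl hv.left ?_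
      exact h.ex_of_le hv.left (h.ex_end hv hb .left) (mem_indexRange.1 hk).2
    · refine List.flatMap_congr fun k hk => ihr hv.right ?_
      exact h.ex_of_le hv.right (h.ex_end hv hb .right) (mem_indexRange.1 hk).2

theorem content_mono {m' : Memory V} (h : MInv T m) (hm : MLe m m') (e : Bool) {v : Node}
    {t : OTree p} (hv : T.Sub v t) {b : ℕ} (hb : m.ex v b) :
    content e m' t v b = content e m t v b := by
  refine List.flatMap_congr fun k hk => blockOps_mono h hm e hv ?_
  exact h.ex_of_le hv hb (mem_indexRange.1 hk).2

end Content

end WFQueue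

namespace WFQueue

variable {p : ℕ} {V : Type}

/-! ## Updates of the memory -/

section Update

variable {T : OTree p} {m m' : Memory V}

theorem Memory.setBlock_blocks (m : Memory V) (v : Node) (b : ℕ) (B : Block V) (v' : Node) (b' : ℕ) :
    (m.setBlock v b B).blocks v' b' = if v' = v ∧ b' = b then some B else m.blocks v' b' := by
  unfold Memory.setBlock
  by_cases hv : v' = v
  · subst hv
    by_cases hb : b' = b
    · subst hb; simp
    · simp [hb]
  · simp [hv]

/-- Changes of heads and of `super` fields preserve the invariant of the tree of blocks. -/
theorem MInv.of_same_blocks (h : MInv T m) (hle : MLe m m') (hex : ∀ {v b}, m'.ex v b → m.ex v b)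
    (hfld : ∀ {v b f}, f ≠ .super → m'.fld v b f = m.fld v b f)
    (helem : ∀ {v b}, m'.elem v b = m.elem v b)
    (hlt : ∀ {v t b}, T.Sub v t → b < m'.head v → m.ex v b)
    (hsup : ∀ {d v t b}, T.Sub (d :: v) t → 1 ≤ b → b < m'.head (d :: v) →
      ∃ x, m'.sup (d :: v) b = some x) : MInv T m' where
  head_pos hv := (h.head_pos hv).trans (hle.head _)
  ex_lt hv hb := hle.ex (hlt hv hb)
  le_head hv hb := (h.le_head hv (hex hb)).trans (hle.head _)
  zero hv hf := by rw [hfld hf, h.zero hv hf]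
  leaf hv hb e := by
    rw [hfld (by simp), hfld (by simp), helem]
    exact h.leaf hv (hex hb) e
  end_mono hv hb d := by
    rw [hfld (by simp), hfld (by simp)]
    exact h.end_mono hv (hex hb) d
  end_lt hv hb d := by
    rw [hfld (by simp)]
    exact (h.end_lt hv (hex hb) d).trans_le (hle.head _)
  sum hv hb e := by
    simp only [hfld (cntField_ne_super e), ne_eq, reduceCtorEq, not_false_eq_true, hfld]
    exact h.sum hv (hex hb) e
  strict hv hb := by
    simp only [ne_eq, reduceCtorEq, not_false_eq_true, hfld]
    exact h.strict hv (hex hb)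
  size hT hb := by
    simp only [ne_eq, reduceCtorEq, not_false_eq_true, hfld]
    exact h.size hT (hex hb)
  sup := hsup

theorem mle_setHead (m : Memory V) (v : Node) : MLe m (m.setHead v (m.head v + 1)) where
  head v' := by
    unfold Memory.setHead
    by_cases h : v' = v
    · subst h; simp
    · simp [h]
  ex h := h
  fld _ _ := rfl
  elem _ := rfl
  sup h := h

theorem MInv.setHead (h : MInv T m) {v : Node} {t : OTree p} (hv : T.Sub v t)
    (hex : m.ex v (m.head v)) (hsup : ∀ {d u}, v = d :: u → ∃ x, m.sup v (m.head v) = some x) :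
    MInv T (m.setHead v (m.head v + 1)) := by
  refine h.of_same_blocks (mle_setHead m v) (fun h => h) (fun _ => rfl) rfl ?_ ?_
  · intro v' t' b hv' hb
    by_cases hvv : v' = v
    · subst hvv
      simp only [Memory.setHead, Function.update_self] at hb
      exact h.ex_of_le hv hex (by omega)
    · simp only [Memory.setHead, Function.update_of_ne hvv] at hb
      exact h.ex_lt hv' hb
  · intro d u t' b hv' h1 hb
    by_cases hvv : d :: u = v
    · subst hvv
      simp only [Memory.setHead, Function.update_self] at hb
      rcases Nat.lt_succ_iff_lt_or_eq.1 hb with hb | rfl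
      · exact h.sup hv' h1 hb
      · exact hsup rfl
    · simp only [Memory.setHead, Function.update_of_ne hvv] at hb
      exact h.sup hv' h1 hb

section SetSuper

variable {v : Node} {b : ℕ} {B : Block V} (x : ℕ)

theorem setSuper_ex (hB : m.blocks v b = some B) (v' : Node) (b' : ℕ) :
    (m.setBlock v b { B with super := some x }).ex v' b' ↔ m.ex v' b' := by
  unfold Memory.ex
  rw [Memory.setBlock_blocks]
  split_ifs with hc
  · obtain ⟨rfl, rfl⟩ := hc
    simp [hB]
  · rfl

theorem setSuper_fld (hB : m.blocks v b = some B) (v' : Node) (b' : ℕ) {f : Field}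
    (hf : f ≠ .super) :
    (m.setBlock v b { B with super := some x }).fld v' b' f = m.fld v' b' f := by
  unfold Memory.fld
  rw [Memory.setBlock_blocks]
  split_ifs with hc
  · obtain ⟨rfl, rfl⟩ := hc
    rw [hB]
    cases f with
    | super => exact absurd rfl hf
    | endOf d => cases d <;> rfl
    | _ => rfl
  · rfl

theorem setSuper_elem (hB : m.blocks v b = some B) (v' : Node) (b' : ℕ) :
    (m.setBlock v b { B with super := some x }).elem v' b' = m.elem v' b' := by
  unfold Memory.elem
  rw [Memory.setBlock_blocks]
  split_ifs with hc
  · obtain ⟨rfl, rfl⟩ := hc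
    simp [hB]
  · rfl

theorem setSuper_sup (v' : Node) (b' : ℕ) :
    (m.setBlock v b { B with super := some x }).sup v' b' =
      if v' = v ∧ b' = b then some x else m.sup v' b' := by
  unfold Memory.sup
  rw [Memory.setBlock_blocks]
  split_ifs <;> rfl

theorem mle_setSuper (hB : m.blocks v b = some B) (hs : B.super = none) :
    MLe m (m.setBlock v b { B with super := some x }) where
  head _ := le_rfl
  ex h := (setSuper_ex x hB _ _).2 h
  fld _ hf := setSuper_fld x hB _ _ hf
  elem _ := setSuper_elem x hB _ _
  sup {v' b' y} h := by
    rw [setSuper_sup]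
    split_ifs with hc
    · obtain ⟨rfl, rfl⟩ := hc
      rw [Memory.sup_of_eq hB, hs] at h
      cases h
    · exact h

theorem MInv.setSuper (h : MInv T m) (hB : m.blocks v b = some B) (hs : B.super = none) :
    MInv T (m.setBlock v b { B with super := some x }) := by
  have hle := mle_setSuper x hB hs
  refine h.of_same_blocks hle (fun h => (setSuper_ex x hB _ _).1 h)
    (fun hf => setSuper_fld x hB _ _ hf) (setSuper_elem x hB _ _) (fun hv hb => h.ex_lt hv hb) ?_
  intro d u t b' hv h1 hb
  obtain ⟨y, hy⟩ := h.sup hv h1 hb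
  exact ⟨y, hle.sup hy⟩

end SetSuper

/-- The block `B` may be installed in `v.blocks[h]` of an internal node. -/
structure NewBlock (m : Memory V) (v : Node) (h : ℕ) (B : Block V) : Prop where
  super : B.super = none
  end_lt : ∀ d, B.get (.endOf d) < m.head (d :: v)
  end_mono : ∀ d, m.fld v (h - 1) (.endOf d) ≤ B.get (.endOf d)
  sum : ∀ e, B.get (cntField e) = m.fld (.left :: v) (B.get (.endOf .left)) (cntField e) +
    m.fld (.right :: v) (B.get (.endOf .right)) (cntField e)
  strict : m.fld v (h - 1) .sumEnq + m.fld v (h - 1) .sumDeq < B.sumEnq + B.sumDeq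
  size : v = [] → B.size = m.fld [] (h - 1) .size + (B.sumEnq - m.fld [] (h - 1) .sumEnq) -
    (B.sumDeq - m.fld [] (h - 1) .sumDeq)

/-- The conditions involve frozen fields and lower bounds on heads only, so a block computed by
`createBlock` is still acceptable when the CAS that installs it is executed. -/
theorem NewBlock.mono {v : Node} {l r : OTree p} {h : ℕ} {B : Block V} (hB : NewBlock m v h B)
    (hm : MInv T m) (hv : T.Sub v (.node l r)) (hex : m.ex v (h - 1)) (hle : MLe m m') :
    NewBlock m' v h B where
  super := hB.super
  end_lt d := (hB.end_lt d).trans_le (hle.head _)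
  end_mono d := by
    rw [hle.fld hex (by simp)]
    exact hB.end_mono d
  sum e := by
    rw [hle.fld (hm.ex_lt hv.left (hB.end_lt .left)) (by simp),
      hle.fld (hm.ex_lt hv.right (hB.end_lt .right)) (by simp)]
    exact hB.sum e
  strict := by
    rw [hle.fld hex (by simp), hle.fld hex (by simp)]
    exact hB.strict
  size h0 := by
    subst h0
    rw [hle.fld hex (by simp), hle.fld hex (by simp), hle.fld hex (by simp)]
    exact hB.size rfl

/-- The block `B` may be written to `v.blocks[h]` of a leaf. -/
structure NewLeafBlock (m : Memory V) (v : Node) (h : ℕ) (B : Block V) : Prop where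
  super : B.super = none
  sum : ∀ e, B.get (cntField e) =
    m.fld v (h - 1) (cntField e) + if B.element.isSome = e then 1 else 0

section AddBlock

variable {v : Node} {h : ℕ} {B : Block V}

theorem addBlock_ex (v' : Node) (b' : ℕ) :
    (m.setBlock v h B).ex v' b' ↔ (v' = v ∧ b' = h) ∨ m.ex v' b' := by
  unfold Memory.ex
  rw [Memory.setBlock_blocks]
  split_ifs with hc <;> simp [hc]

theorem addBlock_fld (v' : Node) (b' : ℕ) (f : Field) :
    (m.setBlock v h B).fld v' b' f = if v' = v ∧ b' = h then B.get f else m.fld v' b' f := by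
  unfold Memory.fld
  rw [Memory.setBlock_blocks]
  split_ifs <;> rfl

theorem addBlock_elem (v' : Node) (b' : ℕ) :
    (m.setBlock v h B).elem v' b' = if v' = v ∧ b' = h then B.element else m.elem v' b' := by
  unfold Memory.elem
  rw [Memory.setBlock_blocks]
  split_ifs <;> rfl

theorem addBlock_sup (v' : Node) (b' : ℕ) :
    (m.setBlock v h B).sup v' b' = if v' = v ∧ b' = h then B.super else m.sup v' b' := by
  unfold Memory.sup
  rw [Memory.setBlock_blocks]
  split_ifs <;> rfl

theorem mle_addBlock (hn : ¬ m.ex v h) : MLe m (m.setBlock v h B) where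
  head _ := le_rfl
  ex h := (addBlock_ex _ _).2 (.inr h)
  fld {v' b' f} hb _ := by
    rw [addBlock_fld, if_neg]
    rintro ⟨rfl, rfl⟩
    exact hn hb
  elem {v' b'} hb := by
    rw [addBlock_elem, if_neg]
    rintro ⟨rfl, rfl⟩
    exact hn hb
  sup {v' b' x} hx := by
    rw [addBlock_sup, if_neg]
    · exact hx
    rintro ⟨rfl, rfl⟩
    exact hn (Memory.ex_of_sup hx)

/-- Old blocks keep their fields because the slot was null; for the new one, each clause about
fields is a condition of `NewLeafBlock` or `NewBlock`. That the slot lies exactly at the head gives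
`le_head`. -/
theorem MInv.addBlock (hm : MInv T m) (hn : ¬ m.ex v h) (h1 : 1 ≤ h) (hh : m.head v = h)
    (hleaf : ∀ i, T.Sub v (.leaf i) → NewLeafBlock m v h B)
    (hnode : ∀ l r, T.Sub v (.node l r) → NewBlock m v h B) : MInv T (m.setBlock v h B) := by
  have hle : MLe m (m.setBlock v h B) := mle_addBlock hn
  refine ⟨hm.head_pos, fun hv hb => hle.ex (hm.ex_lt hv hb), ?_, ?_, ?_, ?_, ?_, ?_, ?_, ?_, ?_⟩
  · intro v' t b hv hb
    rcases (addBlock_ex _ _).1 hb with ⟨rfl, rfl⟩ | hb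
    · exact hh.ge
    · exact hm.le_head hv hb
  · intro v' t f hv hf
    rw [hle.fld (hm.ex_zero hv) hf, hm.zero hv hf]
  · intro v' i b hv hb e
    rcases (addBlock_ex _ _).1 hb with ⟨rfl, rfl⟩ | hb
    · have := (hleaf i hv).sum e
      simp only [Nat.add_sub_cancel] at this
      simp only [addBlock_fld, addBlock_elem, and_self, if_true]
      rw [if_neg (by omega)]
      exact this
    · rw [hle.fld hb (by simp), hle.fld (hm.ex_of_le hv hb b.le_succ) (by simp), hle.elem hb]
      exact hm.leaf hv hb e
  · intro v' l r b hv hb d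
    rcases (addBlock_ex _ _).1 hb with ⟨rfl, rfl⟩ | hb
    · have := (hnode l r hv).end_mono d
      simp only [Nat.add_sub_cancel] at this
      simp only [addBlock_fld, and_self, if_true]
      rw [if_neg (by omega)]
      exact this
    · rw [hle.fld hb (by simp), hle.fld (hm.ex_of_le hv hb b.le_succ) (by simp)]
      exact hm.end_mono hv hb d
  · intro v' l r b hv hb d
    rcases (addBlock_ex _ _).1 hb with ⟨rfl, rfl⟩ | hb
    · simp only [addBlock_fld, and_self, if_true]
      exact (hnode l r hv).end_lt d
    · rw [hle.fld hb (by simp)]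
      exact hm.end_lt hv hb d
  · intro v' l r b hv hb e
    rcases (addBlock_ex _ _).1 hb with ⟨rfl, rfl⟩ | hb
    · have hB := hnode l r hv
      have hl := hle.fld (hm.ex_lt hv.left (hB.end_lt .left)) (cntField_ne_super e)
      have hr := hle.fld (hm.ex_lt hv.right (hB.end_lt .right)) (cntField_ne_super e)
      have hown : ∀ f, (m.setBlock v' b B).fld v' b f = B.get f := by simp [addBlock_fld]
      rw [hown, hown, hown, hl, hr]
      exact hB.sum e
    · rw [hle.fld hb (by simp), hle.fld hb (by simp), hle.fld hb (by simp),
        hle.fld (hm.ex_end hv hb _) (by simp), hle.fld (hm.ex_end hv hb _) (by simp)]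
      exact hm.sum hv hb e
  · intro v' l r b hv hb
    rcases (addBlock_ex _ _).1 hb with ⟨rfl, rfl⟩ | hb
    · have := (hnode l r hv).strict
      simp only [Nat.add_sub_cancel] at this
      simp only [addBlock_fld, and_self, if_true]
      rw [if_neg (by omega), if_neg (by omega)]
      exact this
    · have hb' := hm.ex_of_le hv hb b.le_succ
      rw [hle.fld hb (by simp), hle.fld hb' (by simp), hle.fld hb (by simp), hle.fld hb' (by simp)]
      exact hm.strict hv hb
  · intro l r b hv hb
    rcases (addBlock_ex _ _).1 hb with ⟨rfl, rfl⟩ | hb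
    · have := (hnode l r hv).size rfl
      simp only [Nat.add_sub_cancel] at this
      simp only [addBlock_fld, and_self, if_true]
      rw [if_neg (by omega), if_neg (by omega), if_neg (by omega)]
      exact this
    · have hb' := hm.ex_of_le .root hb b.le_succ
      rw [hle.fld hb (by simp), hle.fld hb' (by simp), hle.fld hb (by simp), hle.fld hb' (by simp),
        hle.fld hb (by simp), hle.fld hb' (by simp)]
      exact hm.size hv hb
  · intro d u t b hv h1 hb
    obtain ⟨y, hy⟩ := hm.sup hv h1 hb
    exact ⟨y, hle.sup hy⟩

end AddBlock

end Update

end WFQueue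

namespace WFQueue

variable {p : ℕ} {V : Type}

/-- Each process has exactly one leaf, and there is an internal node. -/
structure OTree.Good (T : OTree p) : Prop where
  nodup : T.leaves.Nodup
  mem : ∀ i, i ∈ T.leaves
  node : ∃ l r, T = .node l r

/-! ## The state of an execution -/

/-- The state of an execution: the shared memory, its past contents (including the present one), the
number of operations each process has invoked, whether a process is running, which operations have
been invoked, and a bound on the point contention. -/
structure World (p : ℕ) (V : Type) : Type where
  mem : Memory V
  past : Set (Memory V)
  invoked : Fin p → ℕ
  run : Fin p → Bool
  arg : OpId p → QueueOp V → Prop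
  cmax : ℕ

/-- The state after a change of the memory. -/
def World.setMem (w : World p V) (m : Memory V) : World p V :=
  { w with mem := m, past := insert m w.past }

/-- The operation represented by a leaf block with the given element. -/
def opOf : Option V → QueueOp V
  | some x => .enqueue x
  | none => .dequeue

/-- The invariant of the states of an execution. -/
structure Inv (T : OTree p) (w : World p V) : Prop where
  past_inv : ∀ m ∈ w.past, MInv T m
  past_le : ∀ m ∈ w.past, MLe m w.mem
  mem_past : w.mem ∈ w.past
  -- Whoever installed block `b` saw `v.head = b` before examining the children, hence saw all that
  -- was present while the head was still smaller.
  snap : ∀ {v l r b d b' m}, T.Sub v (.node l r) → w.mem.ex v b → m ∈ w.past → m.head v < b →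
    m.ex (d :: v) b' → b' ≤ w.mem.fld v b (.endOf d)
  -- The recorded value is a head the parent had when `b` existed but the child's head had not
  -- passed it. Earlier blocks of the parent cannot contain `b`, and by `snap` block `x + 1`, if it
  -- exists, reaches at least to `b`.
  sup : ∀ {d v t b x}, T.Sub (d :: v) t → w.mem.sup (d :: v) b = some x →
    ∃ m ∈ w.past, m.head v = x ∧ m.ex (d :: v) b ∧ m.head (d :: v) ≤ b
  -- Bounds the range of each binary search in `getEnqueue`.
  width : ∀ {v l r b}, T.Sub v (.node l r) → w.mem.ex v (b + 1) → ∀ d,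
    w.mem.fld v (b + 1) (.endOf d) ≤ w.mem.fld v b (.endOf d) + w.cmax
  owner : ∀ {v i b}, T.Sub v (.leaf i) → w.mem.ex v b → b ≤ w.invoked i
  elem : ∀ {v i b}, T.Sub v (.leaf i) → 1 ≤ b → w.mem.ex v b →
    w.arg (i, b) (opOf (w.mem.elem v b))
  -- The third hypothesis exempts only the last operation of a running process. This is what forces
  -- new blocks to consist of running operations.
  done : ∀ {i b}, 1 ≤ b → b ≤ w.invoked i → (w.run i = true → b < w.invoked i) →
    ∃ e, ∃ k < w.mem.head [], (i, b) ∈ content e w.mem T [] k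
  contention : (Finset.univ.filter fun i => w.run i = true).card ≤ w.cmax

/-- How the state may change between two steps of process `i`. -/
structure Le (T : OTree p) (i : Fin p) (w w' : World p V) : Prop where
  mem : MLe w.mem w'.mem
  past : w.past ⊆ w'.past
  -- Hence a past memory of `w'` with some head smaller than in `w` belongs to the past of `w`
  -- already.
  fresh : ∀ m ∈ w'.past, m ∈ w.past ∨ MLe w.mem m
  cmax : w.cmax ≤ w'.cmax
  invoked : w'.invoked i = w.invoked i
  run : w'.run i = w.run i
  -- Other processes never add blocks to the leaf of `i`.
  own : ∀ {b}, w'.mem.ex (T.leafOf i) b → w.mem.ex (T.leafOf i) b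
  arg : ∀ {o a}, w.arg o a → w'.arg o a

theorem Le.refl (T : OTree p) (i : Fin p) (w : World p V) : Le T i w w :=
  ⟨MLe.refl _, subset_rfl, fun _ h => .inl h, le_rfl, rfl, rfl, fun h => h, fun h => h⟩

theorem Le.trans {T : OTree p} {i : Fin p} {w₁ w₂ w₃ : World p V} (h : Le T i w₁ w₂)
    (h' : Le T i w₂ w₃) : Le T i w₁ w₃ where
  mem := h.mem.trans h'.mem
  past := h.past.trans h'.past
  fresh m hm := (h'.fresh m hm).elim (h.fresh m) fun hle => .inr (h.mem.trans hle)
  cmax := h.cmax.trans h'.cmax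
  invoked := h'.invoked.trans h.invoked
  run := h'.run.trans h.run
  own hb := h.own (h'.own hb)
  arg ha := h'.arg (h.arg ha)

/-! ### Instructions that preserve the invariant -/

section Inv

variable {T : OTree p} {w : World p V} {m : Memory V} {i : Fin p}

theorem Inv.minv (h : Inv T w) : MInv T w.mem := h.past_inv _ h.mem_past

theorem Inv.setMem_self (h : Inv T w) : w.setMem w.mem = w := by
  unfold World.setMem
  rw [Set.insert_eq_of_mem h.mem_past]

theorem Le.setMem (hle : MLe w.mem m) (hown : ∀ {b}, m.ex (T.leafOf i) b → w.mem.ex (T.leafOf i) b) :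
    Le T i w (w.setMem m) where
  mem := hle
  past := Set.subset_insert _ _
  fresh m' hm' := by
    rcases hm' with rfl | hm'
    · exact .inr hle
    · exact .inl hm'
  cmax := le_rfl
  invoked := rfl
  run := rfl
  own := hown
  arg h := h

/-- A change of the memory preserves the invariant if the new blocks and the new `super` fields satisfy
the required conditions. -/
theorem Inv.setMem (h : Inv T w) (hle : MLe w.mem m) (hm : MInv T m)
    (hsup : ∀ {d v t b x}, T.Sub (d :: v) t → m.sup (d :: v) b = some x →
      w.mem.sup (d :: v) b ≠ some x →
      ∃ m' ∈ w.past, m'.head v = x ∧ m'.ex (d :: v) b ∧ m'.head (d :: v) ≤ b)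
    (hnode : ∀ {v l r b}, T.Sub v (.node l r) → m.ex v (b + 1) → ¬ w.mem.ex v (b + 1) → ∀ d,
      m.fld v (b + 1) (.endOf d) ≤ m.fld v b (.endOf d) + w.cmax ∧
      ∀ m' ∈ w.past, m'.head v < b + 1 → ∀ b', m'.ex (d :: v) b' →
        b' ≤ m.fld v (b + 1) (.endOf d))
    (hleaf : ∀ {v i b}, T.Sub v (.leaf i) → m.ex v b → ¬ w.mem.ex v b → b ≤ w.invoked i ∧
      (1 ≤ b → w.arg (i, b) (opOf (m.elem v b)))) :
    Inv T (w.setMem m) where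
  past_inv m' hm' := by
    rcases hm' with rfl | hm'
    · exact hm
    · exact h.past_inv m' hm'
  past_le m' hm' := by
    rcases hm' with rfl | hm'
    · exact MLe.refl _
    · exact (h.past_le m' hm').trans hle
  mem_past := Set.mem_insert _ _
  snap {v l r b d b' m'} hv hb hm' hlt hb' := by
    rcases hm' with rfl | hm'
    -- The present memory has no block beyond its head, so for it the condition is vacuous.
    · exact absurd (hm.le_head hv hb) (not_le.2 hlt)
    · by_cases hex : w.mem.ex v b
      · show b' ≤ m.fld v b _
        rw [hle.fld hex (by simp)]
        exact h.snap hv hex hm' hlt hb'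
      · obtain ⟨b, rfl⟩ : ∃ c, b = c + 1 := ⟨b - 1, by omega⟩
        exact (hnode hv hb hex d).2 m' hm' hlt b' hb'
  sup {d v t b x} hv hx := by
    by_cases hold : w.mem.sup (d :: v) b = some x
    · obtain ⟨m', hm', h'⟩ := h.sup hv hold
      exact ⟨m', .inr hm', h'⟩
    · obtain ⟨m', hm', h'⟩ := hsup hv hx hold
      exact ⟨m', .inr hm', h'⟩
  width {v l r b} hv hb d := by
    by_cases hex : w.mem.ex v (b + 1)
    · show m.fld v (b + 1) _ ≤ m.fld v b _ + w.cmax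
      rw [hle.fld hex (by simp), hle.fld (h.minv.ex_of_le hv hex b.le_succ) (by simp)]
      exact h.width hv hex d
    · exact (hnode hv hb hex d).1
  owner {v i b} hv hb := by
    by_cases hex : w.mem.ex v b
    · exact h.owner hv hex
    · exact (hleaf hv hb hex).1
  elem {v i b} hv h1 hb := by
    by_cases hex : w.mem.ex v b
    · show w.arg (i, b) (opOf (m.elem v b))
      rw [hle.elem hex]
      exact h.elem hv h1 hex
    · exact (hleaf hv hb hex).2 h1
  done {i b} h1 hb hr := by
    obtain ⟨e, k, hk, hmem⟩ := h.done h1 hb hr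
    refine ⟨e, k, hk.trans_le (hle.head _), ?_⟩
    show _ ∈ content e m T [] k
    rw [content_mono h.minv hle e .root (h.minv.ex_lt .root hk)]
    exact hmem
  contention := h.contention

/-- A failing CAS is as good as a successful one: since `b` exists, the head is at least `b`, and if
it differs from `b` it is already larger. -/
theorem Inv.casHead (h : Inv T w) {v : Node} {t : OTree p} {b : ℕ} (hv : T.Sub v t)
    (hb : w.mem.ex v b) (hsup : ∀ {d u}, v = d :: u → ∃ x, w.mem.sup v b = some x) :
    let w' := w.setMem ((MemOp.casHead v b (b + 1)).exec w.mem).2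
    Inv T w' ∧ (∀ j, Le T j w w') ∧ b < w'.mem.head v := by
  by_cases hh : w.mem.head v = b
  · subst hh
    simp only [MemOp.exec, if_true]
    have hle := mle_setHead w.mem v
    refine ⟨h.setMem hle (h.minv.setHead hv hb hsup) ?_ ?_ ?_, fun j => Le.setMem hle ?_, ?_⟩
    · exact fun _ hx hnx => absurd hx hnx
    · exact fun _ hx hnx => absurd hx hnx
    · exact fun _ hx hnx => absurd hx hnx
    · exact fun hb => hb
    · simp [World.setMem, Memory.setHead]
  · simp only [MemOp.exec, hh, if_false, h.setMem_self]
    exact ⟨h, fun j => Le.refl _ _ _, lt_of_le_of_ne (h.minv.le_head hv hb) (Ne.symm hh)⟩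

/-- The condition on `x` is needed only while the head has not passed `b`; afterwards `super` is
already set and the CAS has no effect. -/
theorem Inv.casSuper (h : Inv T w) {d : Dir} {v : Node} {t : OTree p} {b x : ℕ}
    (hv : T.Sub (d :: v) t) (h1 : 1 ≤ b) (hb : w.mem.ex (d :: v) b)
    (hx : w.mem.head (d :: v) ≤ b →
      ∃ m ∈ w.past, m.head v = x ∧ m.ex (d :: v) b ∧ m.head (d :: v) ≤ b) :
    let w' := w.setMem ((MemOp.casSuper (d :: v) b x).exec w.mem).2
    Inv T w' ∧ (∀ j, Le T j w w') ∧ (∃ y, w'.mem.sup (d :: v) b = some y) := by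
  obtain ⟨B, hB⟩ := Option.isSome_iff_exists.1 hb
  cases hs : B.super with
  | some y =>
    simp only [MemOp.exec, hB, hs, h.setMem_self]
    exact ⟨h, fun j => Le.refl _ _ _, y, by rw [Memory.sup_of_eq hB, hs]⟩
  | none =>
    simp only [MemOp.exec, hB, hs]
    have hle := mle_setSuper x hB hs
    refine ⟨h.setMem hle (h.minv.setSuper x hB hs) ?_ ?_ ?_, fun j => Le.setMem hle ?_, x, ?_⟩
    · intro d' v' t' b' y hv' hy hny
      rw [setSuper_sup] at hy
      split_ifs at hy with hc
      · obtain ⟨hc, rfl⟩ := hc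
        cases hc
        cases hy
        refine hx (not_lt.1 fun hlt => ?_)
        obtain ⟨z, hz⟩ := h.minv.sup hv h1 hlt
        rw [Memory.sup_of_eq hB, hs] at hz
        cases hz
      · exact absurd hy hny
    · exact fun _ hx' hnx => absurd ((setSuper_ex x hB _ _).1 hx') hnx
    · exact fun _ hx' hnx => absurd ((setSuper_ex x hB _ _).1 hx') hnx
    · exact fun hb => (setSuper_ex x hB _ _).1 hb
    · simp [World.setMem, setSuper_sup]

/-- `Le T i` fails for the writer, whose own leaf receives a block; this is why `wp` demands the
guarantee only for `j ≠ i`. -/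
theorem Inv.writeBlock (hT : T.Good) (h : Inv T w) {i : Fin p} {b : ℕ} {B : Block V} (hb : ¬ w.mem.ex (T.leafOf i) b) (hh : w.mem.head (T.leafOf i) = b)
    (hinv : w.invoked i = b) (harg : w.arg (i, b) (opOf B.element))
    (hB : NewLeafBlock w.mem (T.leafOf i) b B) :
    let w' := w.setMem ((MemOp.writeBlock (T.leafOf i) b B).exec w.mem).2
    Inv T w' ∧ (∀ j, j ≠ i → Le T j w w') ∧ w'.mem = w.mem.setBlock (T.leafOf i) b B := by
  simp only [MemOp.exec]
  have hv := OTree.sub_leafOf (hT.mem i)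
  have hle := mle_addBlock (B := B) hb
  have h1 : 1 ≤ b := hh ▸ h.minv.head_pos hv
  refine ⟨h.setMem hle (h.minv.addBlock hb h1 hh (fun _ _ => hB) ?_) ?_ ?_ ?_,
    fun j hj => Le.setMem hle ?_, rfl⟩
  · exact fun l r hv' => by cases hv.unique hv'
  · intro d v t b' x hv' hx hnx
    rw [addBlock_sup] at hx
    split_ifs at hx
    · rw [hB.super] at hx
      cases hx
    · exact absurd hx hnx
  · intro v l r b' hv' hx hnx
    rcases (addBlock_ex _ _).1 hx with ⟨rfl, rfl⟩ | hx
    · cases hv.unique hv'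
    · exact absurd hx hnx
  · intro v j b' hv' hx hnx
    rcases (addBlock_ex _ _).1 hx with ⟨rfl, rfl⟩ | hx
    · cases hv.unique hv'
      refine ⟨hinv.ge, fun _ => ?_⟩
      rw [addBlock_elem, if_pos ⟨rfl, rfl⟩]
      exact harg
    · exact absurd hx hnx
  · intro b' hx
    rcases (addBlock_ex _ _).1 hx with ⟨heq, rfl⟩ | hx
    · refine absurd ?_ hj
      have := OTree.sub_leafOf (hT.mem j)
      rw [heq] at this
      cases hv.unique this
      rfl
    · exact hx

/-- The operations in the blocks `v.blocks[1..b]`. -/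
def contentSet (m : Memory V) (t : OTree p) (v : Node) (b : ℕ) : Finset (OpId p) :=
  (content true m t v b).toFinset ∪ (content false m t v b).toFinset

theorem mem_contentSet {t : OTree p} {v : Node} {b : ℕ} {o : OpId p} :
    o ∈ contentSet m t v b ↔ ∃ e, o ∈ content e m t v b := by
  simp [contentSet, or_comm]

/-- No operation is both an enqueue and a dequeue, because the element in its leaf block decides. -/
theorem card_contentSet (hT : T.leaves.Nodup) (h : MInv T m) {v : Node} {t : OTree p}
    (hv : T.Sub v t) {b : ℕ} (hb : m.ex v b) :
    (contentSet m t v b).card = m.fld v b .sumEnq + m.fld v b .sumDeq := by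
  rw [contentSet, Finset.card_union_of_disjoint, List.toFinset_card_of_nodup,
    List.toFinset_card_of_nodup, length_content h true hv hb, length_content h false hv hb]
  · rfl
  · exact nodup_content hT h _ hv hb
  · exact nodup_content hT h _ hv hb
  · rw [Finset.disjoint_left]
    intro o h1 h2
    obtain ⟨-, -, u, hu, -, he⟩ := content_sound h hv hb (List.mem_toFinset.1 h1)
    obtain ⟨-, -, u', hu', -, he'⟩ := content_sound h hv hb (List.mem_toFinset.1 h2)
    rw [hu.leaf_eq_leafOf hT] at he
    rw [hu'.leaf_eq_leafOf hT, he] at he'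
    cases he'

/-- A new block contains only operations that are running, hence has few subblocks. -/
theorem NewBlock.width (hT : T.leaves.Nodup) (h : Inv T w) {v : Node} {l r : OTree p}
    (hv : T.Sub v (.node l r)) {b : ℕ} {B : Block V} (hb : ¬ w.mem.ex v b)
    (hb' : w.mem.ex v (b - 1)) (hB : NewBlock w.mem v b B) (d : Dir) :
    B.get (.endOf d) ≤ w.mem.fld v (b - 1) (.endOf d) + w.cmax := by
  have hm := h.minv
  have hc := hv.down d
  have hle := hB.end_mono d
  have hex := hm.ex_lt hc (hB.end_lt d)
  have hex' := hm.ex_of_le hc hex hle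
  have hsum := hm.sub_le_sums hc hex hle
  rw [← card_contentSet hT hm hc hex, ← card_contentSet hT hm hc hex'] at hsum
  have hsub : contentSet w.mem (OTree.child d l r) (d :: v) (w.mem.fld v (b - 1) (.endOf d)) ⊆
      contentSet w.mem (OTree.child d l r) (d :: v) (B.get (.endOf d)) := by
    intro o ho
    rw [mem_contentSet] at ho ⊢
    exact ho.imp fun e he => content_subset _ _ _ _ hle he
  have hcard := Finset.card_sdiff_add_card_eq_card hsub
  -- A finished operation is in the root, hence by `content_down` in `v` below the head. As slot `b`
  -- is null, it is in a block of index at most `b - 1`, so it is not new.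
  have hnew : ∀ o ∈ contentSet w.mem (OTree.child d l r) (d :: v) (B.get (.endOf d)) \
      contentSet w.mem (OTree.child d l r) (d :: v) (w.mem.fld v (b - 1) (.endOf d)),
      w.run o.1 = true ∧ o.2 = w.invoked o.1 := by
    rintro ⟨i, k⟩ ho
    rw [Finset.mem_sdiff, mem_contentSet, mem_contentSet] at ho
    obtain ⟨⟨e, ho⟩, hno⟩ := ho
    obtain ⟨hi, h1, u, hu, hk, -⟩ := content_sound hm hc hex ho
    have hki := h.owner hu hk
    by_contra hcon
    refine hno ?_
    obtain ⟨e', k', hk', hmem⟩ := h.done h1 hki fun hr =>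
      lt_of_le_of_ne hki fun heq => hcon ⟨hr, heq⟩
    obtain ⟨k'', hk'', hmem'⟩ := content_down hT hm hk' hmem hv (OTree.leaves_child hi)
    have hk3 : k'' ≤ b - 1 := by
      have : ¬ b < w.mem.head v := fun hlt => hb (hm.ex_lt hv hlt)
      omega
    refine ⟨e', ?_⟩
    rw [← content_child_iff hT hm hv hb' hi]
    exact content_subset _ _ _ _ hk3 hmem'
  -- Each running process contributes at most its last operation.
  have := Finset.card_le_card_of_injOn (t := Finset.univ.filter fun i => w.run i = true) Prod.fst
    (fun o ho => by simpa using (hnew o ho).1) (fun o ho o' ho' heq => Prod.ext heq (by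
      rw [(hnew o ho).2, (hnew o' ho').2, heq]))
  have := h.contention
  omega

/-- If the slot is null then the head has not passed it, so by `hb` the head is exactly `b`.
Afterwards the slot is filled in any case, but its ends are known only to the winner of the CAS. -/
theorem Inv.casBlock (hT : T.Good) (h : Inv T w) {v : Node} {l r : OTree p}
    (hv : T.Sub v (.node l r)) {b : ℕ} {B : Block V} (h1 : 1 ≤ b) (hb : b ≤ w.mem.head v)
    (hB : NewBlock w.mem v b B)
    (hsnap : ∀ d, ∀ m ∈ w.past, m.head v < b → ∀ b', m.ex (d :: v) b' → b' ≤ B.get (.endOf d)) :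
    let w' := w.setMem ((MemOp.casBlock v b B).exec w.mem).2
    Inv T w' ∧ (∀ j, Le T j w w') ∧ w'.mem.ex v b ∧
      (((MemOp.casBlock v b B).exec w.mem).1 = true →
        ∀ d, w'.mem.fld v b (.endOf d) = B.get (.endOf d)) := by
  cases hbl : w.mem.blocks v b with
  | some B' =>
    simp only [MemOp.exec, hbl, h.setMem_self]
    exact ⟨h, fun j => Le.refl _ _ _, Memory.ex_of_eq hbl, fun h => by cases h⟩
  | none =>
    simp only [MemOp.exec, hbl]
    have hn : ¬ w.mem.ex v b := by simp [Memory.ex, hbl]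
    have hle := mle_addBlock (B := B) hn
    have hm := h.minv
    have hhead : w.mem.head v = b :=
      le_antisymm (not_lt.1 fun hlt => hn (hm.ex_lt hv hlt)) hb
    have hb' : w.mem.ex v (b - 1) := hm.ex_lt hv (by omega)
    refine ⟨h.setMem hle (hm.addBlock hn h1 hhead ?_ ?_) ?_ ?_ ?_,
      fun j => Le.setMem hle ?_, ?_, fun _ d => ?_⟩
    · exact fun i hv' => by cases hv.unique hv'
    · exact fun _ _ _ => hB
    · intro d u t b' x hv' hx hnx
      rw [addBlock_sup] at hx
      split_ifs at hx
      · rw [hB.super] at hx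
        cases hx
      · exact absurd hx hnx
    · intro u l' r' b' hv' hx hnx d
      rcases (addBlock_ex _ _).1 hx with ⟨rfl, rfl⟩ | hx
      · simp only [addBlock_fld, and_self, if_true]
        rw [if_neg (by omega)]
        exact ⟨hB.width hT.nodup h hv hn hb' d, hsnap d⟩
      · exact absurd hx hnx
    · intro u j b' hv' hx hnx
      rcases (addBlock_ex _ _).1 hx with ⟨rfl, rfl⟩ | hx
      · cases hv.unique hv'
      · exact absurd hx hnx
    · intro b'' hx
      rcases (addBlock_ex _ _).1 hx with ⟨heq, rfl⟩ | hx
      · have := OTree.sub_leafOf (hT.mem j)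
        rw [heq] at this
        cases hv.unique this
      · exact hx
    · exact (addBlock_ex _ _).2 (.inl ⟨rfl, rfl⟩)
    · simp [World.setMem, addBlock_fld]

end Inv

end WFQueue

namespace WFQueue

variable {p : ℕ} {V : Type}

/-! ## A program logic for the code of a process -/

/-- `wp T i P n Q w`: if process `i` runs `P` from the state `w`, then, whatever the other processes
do, it preserves the invariant, takes at most `n` steps, and if it terminates then with a result and a
state that satisfy `Q`. -/
def wp {α : Type} (T : OTree p) (i : Fin p) :
    Prog V α → ℕ → (α → World p V → Prop) → World p V → Prop
  | .ret a, _, Q, w => Q a w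
  | .op a k, n, Q, w => ∃ n', n = n' + 1 ∧ ∀ w', Le T i w w' → Inv T w' →
      Inv T (w'.setMem (a.exec w'.mem).2) ∧
      (∀ j, j ≠ i → Le T j w' (w'.setMem (a.exec w'.mem).2)) ∧
      wp T i (k (a.exec w'.mem).1) n' Q (w'.setMem (a.exec w'.mem).2)

section WP

variable {α β : Type} {T : OTree p} {i : Fin p} {w : World p V} {n n' : ℕ}

theorem wp_weaken {P : Prog V α} {Q Q' : α → World p V → Prop} (h : wp T i P n Q w) (hn : n ≤ n')
    (hQ : ∀ a w, Q a w → Q' a w) : wp T i P n' Q' w := by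
  induction P generalizing n n' w with
  | ret a => exact hQ _ _ h
  | op a k ih =>
    obtain ⟨m, rfl, h⟩ := h
    obtain ⟨m', rfl⟩ : ∃ m', n' = m' + 1 := ⟨n' - 1, by omega⟩
    refine ⟨m', rfl, fun w' hle hI => ?_⟩
    obtain ⟨h1, h2, h3⟩ := h w' hle hI
    exact ⟨h1, h2, ih _ h3 (by omega)⟩

theorem wp_bind {P : Prog V α} {f : α → Prog V β} {Q : β → World p V → Prop}
    (h : wp T i P n (fun a w' => wp T i (f a) n' Q w') w) : wp T i (P >>= f) (n + n') Q w := by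
  induction P generalizing n w with
  | ret a => exact wp_weaken (P := f a) h (by omega) fun _ _ h => h
  | op a k ih =>
    obtain ⟨m, rfl, h⟩ := h
    refine ⟨m + n', by omega, fun w' hle hI => ?_⟩
    obtain ⟨h1, h2, h3⟩ := h w' hle hI
    exact ⟨h1, h2, ih _ h3⟩

/-- Interference before each instruction is already part of `wp`; only for a program that has
returned must the postcondition be stable. -/
theorem wp_mono {P : Prog V α} {Q : α → World p V → Prop} {w' : World p V} (h : wp T i P n Q w)
    (hle : Le T i w w') (hQ : ∀ a, Q a w → Q a w') : wp T i P n Q w' := by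
  cases P with
  | ret a => exact hQ _ h
  | op a k =>
    obtain ⟨m, rfl, h⟩ := h
    exact ⟨m, rfl, fun w'' hle' hI => h w'' (hle.trans hle') hI⟩

theorem bind_pure_prog (P : Prog V α) : P >>= pure = P := by
  induction P with
  | ret a => rfl
  | op a k ih =>
    show Prog.op a (fun r => k r >>= pure) = Prog.op a k
    congr
    exact funext ih

theorem wp_readHead {v : Node} {f : ℕ → Prog V β} {Q : β → World p V → Prop}
    (h : ∀ w', Le T i w w' → Inv T w' → wp T i (f (w'.mem.head v)) n Q w') :
    wp T i (readHead v >>= f) (n + 1) Q w := by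
  refine ⟨n, rfl, fun w' hle hI => ?_⟩
  simp only [MemOp.exec, hI.setMem_self]
  exact ⟨hI, fun j _ => Le.refl _ _ _, h w' hle hI⟩

theorem wp_notNull {v : Node} {b : ℕ} {f : Bool → Prog V β} {Q : β → World p V → Prop}
    (h : ∀ w', Le T i w w' → Inv T w' → ∀ c : Bool, (c = true ↔ w'.mem.ex v b) →
      wp T i (f c) n Q w') :
    wp T i (notNull v b >>= f) (n + 1) Q w := by
  refine ⟨n, rfl, fun w' hle hI => ?_⟩
  simp only [MemOp.exec, hI.setMem_self]
  exact ⟨hI, fun j _ => Le.refl _ _ _, h w' hle hI _ Iff.rfl⟩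

/-- The value may be taken from the earlier state `w`: fields other than `super` of an existing
block are frozen. -/
theorem wp_readField {v : Node} {b : ℕ} {fd : Field} {f : ℕ → Prog V β}
    {Q : β → World p V → Prop} (hex : w.mem.ex v b) (hfd : fd ≠ .super)
    (h : ∀ w', Le T i w w' → Inv T w' → wp T i (f (w.mem.fld v b fd)) n Q w') :
    wp T i (readField v b fd >>= f) (n + 1) Q w := by
  refine ⟨n, rfl, fun w' hle hI => ?_⟩
  simp only [MemOp.exec, hI.setMem_self]
  refine ⟨hI, fun j _ => Le.refl _ _ _, ?_⟩
  have := h w' hle hI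
  rw [← hle.mem.fld hex hfd] at this
  exact this

theorem wp_casHead {v : Node} {t : OTree p} {b : ℕ} (hv : T.Sub v t) (hb : w.mem.ex v b)
    (hsup : ∀ {d u}, v = d :: u → ∃ x, w.mem.sup v b = some x) :
    wp T i (casHead v b (b + 1)) 1
      (fun _ w' => Le T i w w' ∧ Inv T w' ∧ b < w'.mem.head v) w := by
  refine ⟨0, rfl, fun w' hle hI => ?_⟩
  obtain ⟨h1, h2, h3⟩ := hI.casHead hv (hle.mem.ex hb) fun hd =>
    (hsup hd).imp fun x hx => hle.mem.sup hx
  exact ⟨h1, fun j _ => h2 j, hle.trans (h2 i), h1, h3⟩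

/-- `advance` moves the head of `v` past the block `b`. -/
theorem wp_advance {v : Node} {t : OTree p} {b : ℕ} (hv : T.Sub v t) (h1 : 1 ≤ b)
    (hb : w.mem.ex v b) :
    wp T i (advance v b) 3 (fun _ w' => Le T i w w' ∧ Inv T w' ∧ b < w'.mem.head v) w := by
  cases v with
  | nil => exact wp_weaken (wp_casHead hv hb fun h => by cases h) (by omega) fun _ _ h => h
  | cons d u =>
    refine wp_readHead fun w₁ hle₁ hI₁ => ?_
    refine ⟨1, rfl, fun w₂ hle₂ hI₂ => ?_⟩
    have hb₂ := hle₂.mem.ex (hle₁.mem.ex hb)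
    -- The witness is the memory from which the parent's head was read: `b` existed in it, and the
    -- head of the child was no larger than at the CAS.
    obtain ⟨hI₃, hle₃, hsup⟩ := hI₂.casSuper (x := w₁.mem.head u) hv h1 hb₂ fun hh =>
      ⟨w₁.mem, hle₂.past hI₁.mem_past, rfl, hle₁.mem.ex hb, (hle₂.mem.head _).trans hh⟩
    refine ⟨hI₃, fun j _ => hle₃ j, ?_⟩
    refine wp_weaken (wp_casHead hv ((hle₃ i).mem.ex hb₂) fun _ => hsup) le_rfl ?_
    rintro _ w₄ ⟨hle₄, hI₄, hh⟩
    exact ⟨(hle₁.trans hle₂).trans ((hle₃ i).trans hle₄), hI₄, hh⟩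

/-- `helpChild` moves the head of `v` past all blocks present at its start. -/
theorem wp_helpChild {v : Node} {t : OTree p} (hv : T.Sub v t) :
    wp T i (helpChild v) 5 (fun _ w' => Le T i w w' ∧ Inv T w' ∧
      ∀ b, w.mem.ex v b → b < w'.mem.head v) w := by
  refine wp_readHead fun w₁ hle₁ hI₁ => wp_notNull fun w₂ hle₂ hI₂ c hc => ?_
  have hle := hle₁.trans hle₂
  have hh : ∀ b, w.mem.ex v b → b ≤ w₁.mem.head v :=
    fun b hb => hI₁.minv.le_head hv (hle₁.mem.ex hb)
  split_ifs with h
  · refine wp_weaken (wp_advance hv (hI₁.minv.head_pos hv) (hc.1 h)) le_rfl ?_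
    rintro _ w₃ ⟨hle₃, hI₃, hlt⟩
    exact ⟨hle.trans hle₃, hI₃, fun b hb => (hh b hb).trans_lt hlt⟩
  · refine ⟨hle, hI₂, fun b hb => ?_⟩
    -- The slot at the head that was read is still null, so blocks present at the start lie strictly
    -- below it.
    refine lt_of_lt_of_le (lt_of_le_of_ne (hh b hb) ?_) (hle₂.mem.head v)
    rintro rfl
    exact h (hc.2 (hle.mem.ex hb))

end WP

end WFQueue

namespace WFQueue

variable {p : ℕ} {V : Type}

/-! ### Propagation of an operation to the root -/

section Append

variable {T : OTree p} {i : Fin p} {w : World p V}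

/-- Everything that the children of `v` contained in `w` has been propagated to `v` in `w'`. -/
def Covered (w w' : World p V) (v : Node) : Prop :=
  ∀ d b, b < w.mem.head (d :: v) → ∃ k < w'.mem.head v, b ≤ w'.mem.fld v k (.endOf d)

/-- Since no block of a child is empty, equal sums force equal ends: if nothing counts as new then
nothing is left to propagate. The natural subtractions that count new operations are exact because
sums grow with the index. -/
theorem newBlock_of_heads {m : Memory V} (hm : MInv T m) {v : Node} {l r : OTree p}
    (hv : T.Sub v (.node l r)) {h el er s : ℕ} (hex : m.ex v (h - 1))
    (hel : m.fld v (h - 1) (.endOf .left) ≤ el) (hel' : el < m.head (.left :: v))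
    (her : m.fld v (h - 1) (.endOf .right) ≤ er) (her' : er < m.head (.right :: v))
    {E D : ℕ} (hE : E = m.fld (.left :: v) el .sumEnq + m.fld (.right :: v) er .sumEnq)
    (hD : D = m.fld (.left :: v) el .sumDeq + m.fld (.right :: v) er .sumDeq)
    (hs : v = [] → s = m.fld v (h - 1) .size + (E - m.fld v (h - 1) .sumEnq) -
      (D - m.fld v (h - 1) .sumDeq)) :
    (E - m.fld v (h - 1) .sumEnq + (D - m.fld v (h - 1) .sumDeq) = 0 →
      el = m.fld v (h - 1) (.endOf .left) ∧ er = m.fld v (h - 1) (.endOf .right)) ∧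
    (E - m.fld v (h - 1) .sumEnq + (D - m.fld v (h - 1) .sumDeq) ≠ 0 →
      NewBlock m v h ⟨E, D, none, el, er, none, s⟩) := by
  have sE := hm.sum hv hex true
  have sD := hm.sum hv hex false
  have hexl := hm.ex_lt hv.left hel'
  have hexr := hm.ex_lt hv.right her'
  have lE := hm.sum_le true hv.left hexl hel
  have rE := hm.sum_le true hv.right hexr her
  have lD := hm.sum_le false hv.left hexl hel
  have rD := hm.sum_le false hv.right hexr her
  have lS := hm.sub_le_sums hv.left hexl hel
  have rS := hm.sub_le_sums hv.right hexr her
  simp only [cntField] at sE sD lE rE lD rD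
  refine ⟨fun h0 => by omega, fun h0 => ⟨rfl, ?_, ?_, ?_, ?_, ?_⟩⟩
  · rintro (_ | _)
    · exact hel'
    · exact her'
  · rintro (_ | _)
    · exact hel
    · exact her
  · rintro (_ | _)
    · exact hD
    · exact hE
  · show _ < E + D
    omega
  · intro h0
    subst h0
    exact hs rfl

/-- A block proposed by `createBlock` is acceptable and contains everything that the children
contained at the start; if there is none then this has been propagated already. -/
theorem wp_createBlock {v : Node} {l r : OTree p} (hI : Inv T w) (hv : T.Sub v (.node l r)) {h : ℕ}
    (hh : h ≤ w.mem.head v) (h1 : 1 ≤ h) :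
    wp T i (createBlock v h) 9 (fun o w' => Le T i w w' ∧ Inv T w' ∧
      (∀ B, o = some B → NewBlock w'.mem v h B ∧
        ∀ d b, b < w.mem.head (d :: v) → b ≤ B.get (.endOf d)) ∧
      (o = none → Covered w w' v)) w := by
  have hm := hI.minv
  have hex : w.mem.ex v (h - 1) := hm.ex_lt hv (by omega)
  refine wp_readHead fun w₁ hle₁ hI₁ => wp_readHead fun w₂ hle₂ hI₂ => ?_
  have hle := hle₁.trans hle₂
  have hm₂ := hI₂.minv
  have hex₂ := hle.mem.ex hex
  have hp₁ := hI₁.minv.head_pos hv.left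
  have hp₂ := hI₂.minv.head_pos hv.right
  have hl₂ := hle₂.mem.head (.left :: v)
  set el := w₁.mem.head (.left :: v) - 1 with hel
  set er := w₂.mem.head (.right :: v) - 1 with her
  have hexl : w₂.mem.ex (.left :: v) el := hm₂.ex_lt hv.left (by omega)
  have hexr : w₂.mem.ex (.right :: v) er := hm₂.ex_lt hv.right (by omega)
  refine wp_readField hexl (by simp) fun w₃ hle₃ hI₃ => ?_
  refine wp_readField (hle₃.mem.ex hexr) (by simp) fun w₄ hle₄ hI₄ => ?_
  have hle' := hle₃.trans hle₄
  refine wp_readField (hle'.mem.ex hexl) (by simp) fun w₅ hle₅ hI₅ => ?_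
  replace hle' := hle'.trans hle₅
  refine wp_readField (hle'.mem.ex hexr) (by simp) fun w₆ hle₆ hI₆ => ?_
  have hle₆' := hle'.trans hle₆
  refine wp_readField (hle₆'.mem.ex hex₂) (by simp) fun w₇ hle₇ hI₇ => ?_
  have hle₇' := hle₆'.trans hle₇
  refine wp_readField (hle₇'.mem.ex hex₂) (by simp) fun w₈ hle₈ hI₈ => ?_
  have hle₈' := hle₇'.trans hle₈
  -- All fields read are frozen, so every value can be expressed in `w₂`, the state in which both
  -- ends are fixed.
  rw [hle₃.mem.fld hexr (by simp), (hle₃.trans hle₄).mem.fld hexl (by simp),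
    hle'.mem.fld hexr (by simp), hle₆'.mem.fld hex₂ (by simp), hle₇'.mem.fld hex₂ (by simp)]
  have hend : ∀ d, w₂.mem.fld v (h - 1) (.endOf d) = w.mem.fld v (h - 1) (.endOf d) :=
    fun d => hle.mem.fld hex (by simp)
  have hel1 : w₂.mem.fld v (h - 1) (.endOf .left) ≤ el := by
    have := hI₁.minv.end_lt hv (hle₁.mem.ex hex) .left
    rw [hle₁.mem.fld hex (by simp)] at this
    rw [hend]
    omega
  have her1 : w₂.mem.fld v (h - 1) (.endOf .right) ≤ er := by
    have := hm₂.end_lt hv hex₂ .right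
    omega
  -- Each end is a head read later, minus one, and heads only grow.
  have hcov : ∀ d b, b < w.mem.head (d :: v) → (d = .left → b ≤ el) ∧ (d = .right → b ≤ er) := by
    rintro d b hb
    have a1 := hle₁.mem.head (d :: v)
    have a2 := hle.mem.head (d :: v)
    constructor <;> rintro rfl <;> omega
  have key := fun s => newBlock_of_heads (s := s) hm₂ hv hex₂ hel1 (by omega) her1 (by omega) rfl rfl
  dsimp only
  generalize w₂.mem.fld (.left :: v) el .sumEnq + w₂.mem.fld (.right :: v) er .sumEnq = E at key ⊢
  generalize w₂.mem.fld (.left :: v) el .sumDeq + w₂.mem.fld (.right :: v) er .sumDeq = D at key ⊢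
  -- The common tail for the root and for the other nodes; `s` is constrained only in the root.
  have fin : ∀ (s : ℕ) (w₉ : World p V), Le T i w₈ w₉ → Inv T w₉ →
      (v = [] → s = w₂.mem.fld v (h - 1) .size + (E - w₂.mem.fld v (h - 1) .sumEnq) -
        (D - w₂.mem.fld v (h - 1) .sumDeq)) →
      wp T i (if E - w₂.mem.fld v (h - 1) .sumEnq + (D - w₂.mem.fld v (h - 1) .sumDeq) = 0 then
        pure none else pure (some ⟨E, D, none, el, er, none, s⟩)) 0
        (fun o w' => Le T i w w' ∧ Inv T w' ∧
          (∀ B, o = some B → NewBlock w'.mem v h B ∧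
            ∀ d b, b < w.mem.head (d :: v) → b ≤ B.get (.endOf d)) ∧
          (o = none → Covered w w' v)) w₉ := by
    intro s w₉ hle₉ hI₉ hs
    obtain ⟨k1, k2⟩ := key s hs
    split_ifs with h0
    · obtain ⟨e1, e2⟩ := k1 h0
      refine ⟨(hle.trans hle₈').trans hle₉, hI₉, fun _ h => (by cases h), fun _ d b hb => ?_⟩
      have a1 := (hle.trans (hle₈'.trans hle₉)).mem.head v
      -- There is nothing new, so the preceding block already reaches as far as the children did.
      refine ⟨h - 1, by omega, ?_⟩
      rw [(hle₈'.trans hle₉).mem.fld hex₂ (by simp)]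
      have := hcov d b hb
      cases d
      · rw [← e1]; exact this.1 rfl
      · rw [← e2]; exact this.2 rfl
    · refine ⟨(hle.trans hle₈').trans hle₉, hI₉, ?_, fun h => by cases h⟩
      rintro B hB
      cases hB
      refine ⟨(k2 h0).mono hm₂ hv hex₂ (hle₈'.trans hle₉).mem, fun d b hb => ?_⟩
      have := hcov d b hb
      cases d
      · exact this.1 rfl
      · exact this.2 rfl
  by_cases hv0 : v = []
  · rw [if_pos hv0]
    refine wp_readField (hle₈'.mem.ex hex₂) (by simp) fun w₉ hle₉ hI₉ => ?_
    rw [hle₈'.mem.fld hex₂ (by simp)]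
    exact fin _ w₉ hle₉ hI₉ fun _ => rfl
  · rw [if_neg hv0]
    exact wp_weaken (fin 0 w₈ (Le.refl _ _ _) hI₈ fun h => absurd h hv0) (by omega) fun _ _ h => h

/-- The outcome of `refresh`: if it succeeds then it propagates everything the children contained at
its start; if it fails then another process has installed a block in the meantime. -/
theorem wp_refresh (hT : T.Good) {v : Node} {l r : OTree p} (hv : T.Sub v (.node l r)) :
    wp T i (refresh v) 24 (fun c w' => Le T i w w' ∧ Inv T w' ∧ (c = true → Covered w w' v) ∧
      (c = false → ∃ m ∈ w'.past, MLe w.mem m ∧ m.head v < w'.mem.head v)) w := by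
  refine wp_readHead fun w₁ hle₁ hI₁ => ?_
  set h := w₁.mem.head v with hh
  have h1 : 1 ≤ h := hI₁.minv.head_pos hv
  refine wp_bind (n := 5) (n' := 18) (wp_weaken (wp_helpChild hv.left) le_rfl ?_)
  rintro - w₂ ⟨hle₂, hI₂, hc₂⟩
  refine wp_bind (n := 5) (n' := 13) (wp_weaken (wp_helpChild hv.right) le_rfl ?_)
  rintro - w₃ ⟨hle₃, hI₃, hc₃⟩
  have hh₃ : h ≤ w₃.mem.head v := (hle₂.trans hle₃).mem.head v
  refine wp_bind (n := 9) (n' := 4) (wp_weaken (wp_createBlock hI₃ hv hh₃ h1) le_rfl ?_)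
  rintro o w₄ ⟨hle₄, hI₄, hsome, hnone⟩
  have hle₁₃ := hle₂.trans hle₃
  have hle' := hle₁.trans hle₁₃
  have hcov : ∀ d b, b < w.mem.head (d :: v) → b < w₃.mem.head (d :: v) :=
    fun d b hb => hb.trans_le (hle'.mem.head _)
  cases o with
  | none =>
    exact ⟨hle'.trans hle₄, hI₄, fun _ d b hb => hnone rfl d b (hcov d b hb), fun h => by cases h⟩
  | some B =>
    obtain ⟨hB, hBc⟩ := hsome B rfl
    have hex : w₄.mem.ex v (h - 1) :=
      (hle₁₃.trans hle₄).mem.ex (hI₁.minv.ex_lt hv (by omega))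
    refine ⟨3, rfl, fun w₅ hle₅ hI₅ => ?_⟩
    have hle₁₅ := (hle₁₃.trans hle₄).trans hle₅
    obtain ⟨hI₆, hle₆, hex₆, hend⟩ := hI₅.casBlock hT hv h1 (hle₁₅.mem.head v)
      (hB.mono hI₄.minv hv hex hle₅.mem) (by
        -- By `fresh`, a memory whose head is below `h` precedes `w₁`. What it contained is
        -- overtaken by the heads of the children in the two calls of `helpChild`, before
        -- `createBlock` reads these heads.
        intro d m hm hlt b' hb'
        refine hBc d b' ?_
        have hm₁ : m ∈ w₁.past := (hle₁₅.fresh m hm).resolve_right fun hge =>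
          absurd (hge.head v) (not_le.2 hlt)
        have hb₁ := (hI₁.past_le m hm₁).ex hb'
        cases d
        · exact (hc₂ b' hb₁).trans_le (hle₃.mem.head _)
        · exact hc₃ b' (hle₂.mem.ex hb₁))
    refine ⟨hI₆, fun j _ => hle₆ j, ?_⟩
    set w₆ := w₅.setMem ((MemOp.casBlock v h B).exec w₅.mem).2
    refine wp_bind (P := advance v h) (f := fun _ => pure _) (n := 3) (n' := 0)
      (wp_weaken (wp_advance hv h1 hex₆) le_rfl ?_)
    rintro - w₇ ⟨hle₇, hI₇, hlt⟩
    refine ⟨(hle₁.trans hle₁₅).trans ((hle₆ i).trans hle₇), hI₇, fun hc d b hb => ?_, fun _ => ?_⟩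
    · refine ⟨h, hlt, ?_⟩
      rw [hle₇.mem.fld hex₆ (by simp), hend hc d]
      exact hBc d b (hcov d b hb)
    -- Whoever installed block `h`, the final `advance` has ensured that the head is beyond the
    -- value read in `w₁`.
    · exact ⟨w₁.mem, (hle₁₅.trans ((hle₆ i).trans hle₇)).past hI₁.mem_past, hle₁.mem, hlt⟩

/-- After two failures, the head in `m'` exceeds the head in `m`, and `m` is no earlier than the
start. By `snap`, the block at index `m'.head v` covers all that the children held at the start. -/
theorem wp_doubleRefresh (hT : T.Good) {v : Node} {l r : OTree p} (hI : Inv T w)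
    (hv : T.Sub v (.node l r)) :
    wp T i (doubleRefresh v) 48 (fun _ w' => Le T i w w' ∧ Inv T w' ∧ Covered w w' v) w := by
  refine wp_bind (n := 24) (n' := 24) (wp_weaken (wp_refresh hT hv) le_rfl ?_)
  rintro c w₁ ⟨hle₁, hI₁, hc, hf⟩
  cases c with
  | true => exact ⟨hle₁, hI₁, hc rfl⟩
  | false =>
    obtain ⟨m, hm, hwm, hlt⟩ := hf rfl
    refine wp_bind (n := 24) (n' := 0) (wp_weaken (wp_refresh hT hv) le_rfl ?_)
    rintro c w₂ ⟨hle₂, hI₂, hc₂, hf₂⟩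
    refine ⟨hle₁.trans hle₂, hI₂, ?_⟩
    cases c with
    | true => exact fun d b hb => hc₂ rfl d b (hb.trans_le (hle₁.mem.head _))
    | false =>
      obtain ⟨m', hm', hwm', hlt'⟩ := hf₂ rfl
      intro d b hb
      refine ⟨m'.head v, hlt', hI₂.snap hv (hI₂.minv.ex_lt hv hlt') (hle₂.past hm)
        (hlt.trans_le (hwm'.head v)) (hwm.ex (hI.minv.ex_lt (hv.down d) hb))⟩

/-- An operation contained in a node is propagated to the root. -/
theorem wp_propagate (hT : T.Good) {v : Node} {t : OTree p} (hI : Inv T w) (hv : T.Sub v t)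
    {e : Bool} {o : OpId p} (ho : o.1 ∈ t.leaves) (hv0 : v ≠ []) {k : ℕ} (hk : k < w.mem.head v)
    (hmem : o ∈ content e w.mem t v k) :
    wp T i (propagate v.tail) (48 * v.length) (fun _ w' => Le T i w w' ∧ Inv T w' ∧
      ∃ k < w'.mem.head [], o ∈ content e w'.mem T [] k) w := by
  induction v generalizing t w k with
  | nil => exact absurd rfl hv0
  | cons d u ih =>
    obtain ⟨l, r, hu, rfl⟩ := hv.parent
    have step : wp T i (doubleRefresh u) 48 (fun _ w' => Le T i w w' ∧ Inv T w' ∧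
        ∃ k < w'.mem.head u, o ∈ content e w'.mem (.node l r) u k) w := by
      refine wp_weaken (wp_doubleRefresh hT hI hu) le_rfl ?_
      rintro - w₁ ⟨hle₁, hI₁, hc⟩
      obtain ⟨k', hk', hle⟩ := hc d k hk
      refine ⟨hle₁, hI₁, k', hk', ?_⟩
      rw [content_child_iff hT.nodup hI₁.minv hu (hI₁.minv.ex_lt hu hk') ho]
      refine content_subset _ _ _ _ hle ?_
      rw [content_mono hI.minv hle₁.mem e hv (hI.minv.ex_lt hv hk)]
      exact hmem
    cases u with
    | nil =>
      refine wp_weaken step (by simp) ?_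
      rintro - w₁ ⟨hle₁, hI₁, k', hk', hmem'⟩
      cases OTree.Sub.root.unique hu
      exact ⟨hle₁, hI₁, k', hk', hmem'⟩
    | cons d' u =>
      refine wp_weaken (wp_bind (n := 48) (n' := 48 * (d' :: u).length) (wp_weaken step le_rfl ?_))
        (by simp; omega) fun _ _ h => h
      rintro - w₁ ⟨hle₁, hI₁, k', hk', hmem'⟩
      refine wp_weaken (ih hI₁ hu (OTree.leaves_child ho) (by simp) hk' hmem') le_rfl ?_
      rintro - w₂ ⟨hle₂, hI₂, h⟩
      exact ⟨hle₁.trans hle₂, hI₂, h⟩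

/-- Process `i` is about to append the block of its `k`th operation. -/
structure Ready (T : OTree p) (i : Fin p) (k : ℕ) (w : World p V) : Prop where
  invoked : w.invoked i = k
  not_ex : ¬ w.mem.ex (T.leafOf i) k
  head : w.mem.head (T.leafOf i) = k

/-- The `k`th operation of process `i`, its last one, has been propagated to the root. -/
structure Done (T : OTree p) (i : Fin p) (k : ℕ) (e : Bool) (w : World p V) : Prop where
  invoked : w.invoked i = k
  lt_head : k < w.mem.head (T.leafOf i)
  mem : ∃ b < w.mem.head [], (i, k) ∈ content e w.mem T [] b

/-- Nobody else appends to this leaf, so the slot stays null and the head cannot move past it. -/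
theorem Ready.mono (hT : T.Good) {k : ℕ} (h : Ready T i k w) {w' : World p V} (hle : Le T i w w')
    (hI : Inv T w') : Ready T i k w' where
  invoked := hle.invoked.trans h.invoked
  not_ex hex := h.not_ex (hle.own hex)
  head := by
    have h1 := hle.mem.head (T.leafOf i)
    rw [h.head] at h1
    refine le_antisymm (not_lt.1 fun hlt => h.not_ex (hle.own ?_)) h1
    exact hI.minv.ex_lt (OTree.sub_leafOf (hT.mem i)) hlt

theorem Done.mono {k : ℕ} {e : Bool} (hI : Inv T w) (h : Done T i k e w) {w' : World p V}
    (hle : Le T i w w') : Done T i k e w' where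
  invoked := hle.invoked.trans h.invoked
  lt_head := h.lt_head.trans_le (hle.mem.head _)
  mem := by
    obtain ⟨b, hb, hm⟩ := h.mem
    refine ⟨b, hb.trans_le (hle.mem.head _), ?_⟩
    rw [content_mono hI.minv hle.mem e .root (hI.minv.ex_lt .root hb)]
    exact hm

/-- A leaf never holds more blocks than operations were invoked. Hence `leaf.head - 1`, as read by a
dequeue, is the index of its own block. -/
theorem Done.head_eq (hT : T.Good) {k : ℕ} {e : Bool} (h : Done T i k e w) (hI : Inv T w) :
    w.mem.head (T.leafOf i) = k + 1 := by
  have hv := OTree.sub_leafOf (hT.mem i)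
  refine le_antisymm (not_lt.1 fun hlt => ?_) h.lt_head
  have := hI.owner hv (hI.minv.ex_lt hv hlt)
  rw [h.invoked] at this
  omega

theorem leafOf_ne_nil (hT : T.Good) (i : Fin p) : T.leafOf i ≠ [] := by
  intro h
  have hv := OTree.sub_leafOf (hT.mem i)
  obtain ⟨l, r, hlr⟩ := hT.node
  rw [h] at hv
  have := hv.unique .root
  rw [hlr] at this
  cases this

/-- Cost: one read, one write, three steps for `advance`, and 48 for the double refresh on each
proper ancestor of the leaf. -/
theorem wp_append (hT : T.Good) {k : ℕ} {B : Block V} (hr : Ready T i k w) (hI : Inv T w)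
    (ha : w.arg (i, k) (opOf B.element)) (hB : NewLeafBlock w.mem (T.leafOf i) k B) :
    wp T i (append (T.leafOf i) B) (5 + 48 * (T.leafOf i).length)
      (fun _ w' => Inv T w' ∧ Done T i k B.element.isSome w') w := by
  have hv := OTree.sub_leafOf (hT.mem i)
  have h1 : 1 ≤ k := hr.head ▸ hI.minv.head_pos hv
  refine wp_weaken (n := 48 * (T.leafOf i).length + 3 + 1 + 1) ?_ (by omega) fun _ _ h => h
  refine wp_readHead fun w₁ hle₁ hI₁ => ?_
  rw [(hr.mono hT hle₁ hI₁).head]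
  refine ⟨_, rfl, fun w₂ hle₂ hI₂ => ?_⟩
  have hle := hle₁.trans hle₂
  have hr₂ := hr.mono hT hle hI₂
  have hB₂ : NewLeafBlock w₂.mem (T.leafOf i) k B := by
    refine ⟨hB.super, fun e => ?_⟩
    rw [hle.mem.fld (hI.minv.ex_lt hv (by rw [hr.head]; omega)) (by simp)]
    exact hB.sum e
  obtain ⟨hI₃, hle₃, hmem⟩ := hI₂.writeBlock hT hr₂.not_ex hr₂.head hr₂.invoked (hle.arg ha) hB₂
  refine ⟨hI₃, hle₃, ?_⟩
  set w₃ := w₂.setMem ((MemOp.writeBlock (T.leafOf i) k B).exec w₂.mem).2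
  have hex₃ : w₃.mem.ex (T.leafOf i) k := by
    rw [hmem]
    exact (addBlock_ex _ _).2 (.inl ⟨rfl, rfl⟩)
  have hel₃ : w₃.mem.elem (T.leafOf i) k = B.element := by
    rw [hmem, addBlock_elem, if_pos ⟨rfl, rfl⟩]
  have hinv₃ : w₃.invoked i = k := hr₂.invoked
  refine wp_weaken (n := 3 + 48 * (T.leafOf i).length) (wp_bind (P := advance (T.leafOf i) k)
    (wp_weaken (wp_advance hv h1 hex₃) le_rfl ?_)) (by omega) fun _ _ h => h
  rintro - w₄ ⟨hle₄, hI₄, hlt⟩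
  refine wp_weaken (wp_propagate hT hI₄ hv (e := B.element.isSome) (o := (i, k))
    (by simp [OTree.leaves]) (leafOf_ne_nil hT i) hlt ?_) le_rfl ?_
  · obtain ⟨j, rfl⟩ : ∃ j, k = j + 1 := ⟨k - 1, by omega⟩
    rw [content_succ, blockOps_leaf _ _ (hle₄.mem.ex hex₃), hle₄.mem.elem hex₃, hel₃]
    simp
  · rintro - w₅ ⟨hle₅, hI₅, hm⟩
    exact ⟨hI₅, (hle₄.trans hle₅).invoked.trans hinv₃, hlt.trans_le (hle₅.mem.head _), hm⟩

/-- The part of an operation up to the end of `append`. -/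
theorem wp_readSums_append (hT : T.Good) {β : Type} {k n : ℕ} {x : Option V} (hr : Ready T i k w)
    (hI : Inv T w) (ha : w.arg (i, k) (opOf x)) {f : ℕ → ℕ → Prog V β} {B : ℕ → ℕ → Block V}
    {Q : β → World p V → Prop}
    (hB : ∀ a b, (B a b).super = none ∧ (B a b).element = x ∧
      ∀ e, (B a b).get (cntField e) = (if e then a else b) + if x.isSome = e then 1 else 0)
    {g : Unit → Prog V β}
    (hf : ∀ a b, f a b = append (T.leafOf i) (B a b) >>= g)
    (hg : ∀ w', Inv T w' → Done T i k x.isSome w' → wp T i (g ()) n Q w') :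
    wp T i (do
      let h ← readHead (T.leafOf i)
      let a ← readField (T.leafOf i) (h - 1) .sumEnq
      let h ← readHead (T.leafOf i)
      let b ← readField (T.leafOf i) (h - 1) .sumDeq
      f a b) (9 + 48 * (T.leafOf i).length + n) Q w := by
  have hv := OTree.sub_leafOf (hT.mem i)
  have h1 : 1 ≤ k := hr.head ▸ hI.minv.head_pos hv
  have hex : w.mem.ex (T.leafOf i) (k - 1) := hI.minv.ex_lt hv (by rw [hr.head]; omega)
  refine wp_weaken (n := 5 + 48 * (T.leafOf i).length + n + 1 + 1 + 1 + 1) ?_ (by omega)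
    fun _ _ h => h
  refine wp_readHead fun w₁ hle₁ hI₁ => ?_
  rw [(hr.mono hT hle₁ hI₁).head]
  refine wp_readField (hle₁.mem.ex hex) (by simp) fun w₂ hle₂ hI₂ => ?_
  refine wp_readHead fun w₃ hle₃ hI₃ => ?_
  have hle := (hle₁.trans hle₂).trans hle₃
  rw [(hr.mono hT hle hI₃).head]
  refine wp_readField (hle.mem.ex hex) (by simp) fun w₄ hle₄ hI₄ => ?_
  replace hle₄ := hle.trans hle₄
  rw [hle.mem.fld hex (by simp), hle₁.mem.fld hex (by simp), hf]
  obtain ⟨b1, b2, b3⟩ := hB (w.mem.fld (T.leafOf i) (k - 1) .sumEnq)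
    (w.mem.fld (T.leafOf i) (k - 1) .sumDeq)
  refine wp_bind (wp_weaken (wp_append hT (hr.mono hT hle₄ hI₄) hI₄ ?_ ⟨b1, fun e => ?_⟩) le_rfl ?_)
  · rw [b2]
    exact hle₄.arg ha
  · rw [b3, b2, hle₄.mem.fld hex (by simp)]
    cases e <;> rfl
  · rintro ⟨⟩ w₅ ⟨hI₅, hd⟩
    rw [b2] at hd
    exact hg w₅ hI₅ hd

theorem wp_enqueue (hT : T.Good) {k : ℕ} {x : V} (hr : Ready T i k w) (hI : Inv T w)
    (ha : w.arg (i, k) (.enqueue x)) :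
    wp T i (code T i (.enqueue x)) (9 + 48 * (T.leafOf i).length)
      (fun _ w' => Inv T w' ∧ Done T i k true w') w := by
  refine wp_bind (n := 9 + 48 * (T.leafOf i).length) (n' := 0) ?_
  refine wp_readSums_append hT (x := some x) (n := 0) hr hI ha
    (B := fun a b => ⟨a + 1, b, none, 0, 0, some x, 0⟩) ?_ (g := pure) ?_ ?_
  · intro a b
    refine ⟨rfl, rfl, fun e => ?_⟩
    cases e <;> simp [cntField, Block.get]
  · intro a b
    exact (bind_pure_prog _).symm
  · exact fun w' hI' hd => ⟨hI', hd⟩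

end Append

end WFQueue

namespace WFQueue

variable {p : ℕ} {V : Type}

/-! ## Code that reads only data that do not change any more -/

/-- The instruction reads something that does not change any more. -/
def StableRead (m : Memory V) : MemOp V → Prop
  | .readField v b f => m.ex v b ∧ (f = .super → ∃ x, m.sup v b = some x)
  | .readElement v b => m.ex v b
  | _ => False

/-- `rd m P n Q`: run on the memory `m`, the program `P` reads only data that do not change any more,
takes at most `n` steps, and returns a result that satisfies `Q`. -/
def rd {α : Type} (m : Memory V) : Prog V α → ℕ → (α → Prop) → Prop
  | .ret a, _, Q => Q a
  | .op a k, n, Q => ∃ n', n = n' + 1 ∧ StableRead m a ∧ rd m (k (a.exec m).1) n' Q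

section Rd

variable {α β : Type} {m : Memory V} {n n' : ℕ}

theorem StableRead.exec {m' : Memory V} (hle : MLe m m') {a : MemOp V} (h : StableRead m a) :
    a.exec m' = ((a.exec m).1, m') := by
  cases a with
  | readField v b f =>
    show (m'.fld v b f, m') = (m.fld v b f, m')
    by_cases hf : f = .super
    · subst hf
      obtain ⟨x, hx⟩ := h.2 rfl
      rw [Memory.fld_super_of_sup hx, Memory.fld_super_of_sup (hle.sup hx)]
    · rw [hle.fld h.1 hf]
  | readElement v b =>
    show (m'.elem v b, m') = (m.elem v b, m')
    rw [hle.elem h]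
  | _ => exact h.elim

/-- Interference cannot affect reads of frozen data, so a sequential analysis on an earlier memory
is valid in any later state. -/
theorem rd_wp {T : OTree p} {i : Fin p} {w : World p V} {P : Prog V α} {Q : α → Prop}
    (h : rd m P n Q) (hle : MLe m w.mem) (hI : Inv T w) :
    wp T i P n (fun a w' => Le T i w w' ∧ Inv T w' ∧ Q a) w := by
  induction P generalizing n w with
  | ret a => exact ⟨Le.refl _ _ _, hI, h⟩
  | op a k ih =>
    obtain ⟨n', rfl, hs, h⟩ := h
    refine ⟨n', rfl, fun w' hle' hI' => ?_⟩
    have hm := hle.trans hle'.mem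
    rw [hs.exec hm]
    simp only [hI'.setMem_self]
    refine ⟨hI', fun j _ => Le.refl _ _ _, wp_weaken (ih _ h hm hI') le_rfl ?_⟩
    rintro a w'' ⟨h1, h2, h3⟩
    exact ⟨hle'.trans h1, h2, h3⟩

theorem rd_weaken {P : Prog V α} {Q Q' : α → Prop} (h : rd m P n Q) (hn : n ≤ n')
    (hQ : ∀ a, Q a → Q' a) : rd m P n' Q' := by
  induction P generalizing n n' with
  | ret a => exact hQ _ h
  | op a k ih =>
    obtain ⟨m', rfl, hs, h⟩ := h
    exact ⟨n' - 1, by omega, hs, ih _ h (by omega)⟩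

theorem rd_bind {P : Prog V α} {f : α → Prog V β} {Q : β → Prop}
    (h : rd m P n (fun a => rd m (f a) n' Q)) : rd m (P >>= f) (n + n') Q := by
  induction P generalizing n with
  | ret a => exact rd_weaken (P := f a) h (by omega) fun _ h => h
  | op a k ih =>
    obtain ⟨m', rfl, hs, h⟩ := h
    exact ⟨m' + n', by omega, hs, ih _ h⟩

theorem rd_readField {v : Node} {b : ℕ} {fd : Field} {f : ℕ → Prog V β} {Q : β → Prop}
    (hex : m.ex v b) (hfd : fd ≠ .super) (h : rd m (f (m.fld v b fd)) n Q) :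
    rd m (readField v b fd >>= f) (n + 1) Q :=
  ⟨n, rfl, ⟨hex, fun h => absurd h hfd⟩, h⟩

theorem rd_readSuper {v : Node} {b x : ℕ} {f : ℕ → Prog V β} {Q : β → Prop}
    (hx : m.sup v b = some x) (h : rd m (f x) n Q) :
    rd m (readField v b .super >>= f) (n + 1) Q := by
  refine ⟨n, rfl, ⟨Memory.ex_of_sup hx, fun _ => ⟨x, hx⟩⟩, ?_⟩
  show rd m (f (m.fld v b .super)) n Q
  rw [Memory.fld_super_of_sup hx]
  exact h

theorem rd_readElement {v : Node} {b : ℕ} (hex : m.ex v b) :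
    rd m (readElement v b) 1 (fun r => r = m.elem v b) :=
  ⟨0, rfl, hex, rfl⟩

end Rd

/-! ### Binary and doubling search in prefix sums -/

section Search

variable {T : OTree p} {m : Memory V}

/-- The sum just before `lo` stays below `x` and the sum at `hi` reaches it, while each read halves
the length of the interval. -/
theorem rd_binarySearch (hm : MInv T m) {v : Node} {t : OTree p} (hv : T.Sub v t) {x lo hi n : ℕ}
    (hle : lo ≤ hi) (hex : m.ex v hi) (hhi : x ≤ m.fld v hi .sumEnq)
    (hlo : m.fld v (lo - 1) .sumEnq < x) (hn : hi - lo < 2 ^ n) :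
    rd m (binarySearch v x lo hi) n (fun b => lo ≤ b ∧ b ≤ hi ∧ x ≤ m.fld v b .sumEnq ∧
      m.fld v (b - 1) .sumEnq < x) := by
  induction n generalizing lo hi with
  | zero =>
    have : lo = hi := by simp at hn; omega
    subst this
    rw [binarySearch, if_neg (lt_irrefl _)]
    exact ⟨le_rfl, le_rfl, hhi, hlo⟩
  | succ n ih =>
    rw [binarySearch]
    have h2 : 2 ^ (n + 1) = 2 * 2 ^ n := by ring
    by_cases hlt : lo < hi
    · rw [if_pos hlt]
      have hexm := hm.ex_of_le hv hex (b' := (lo + hi) / 2) (by omega)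
      refine rd_readField hexm (by simp) ?_
      by_cases hx : x ≤ m.fld v ((lo + hi) / 2) .sumEnq
      · rw [if_pos hx]
        refine rd_weaken (ih (by omega) hexm hx hlo (by omega)) le_rfl ?_
        rintro b ⟨h1, h2, h3⟩
        exact ⟨h1, by omega, h3⟩
      · rw [if_neg hx]
        refine rd_weaken (ih (by omega) hex hhi (by simpa using hx) (by omega)) le_rfl ?_
        rintro b ⟨h1, h2, h3⟩
        exact ⟨by omega, h2, h3⟩
    · rw [if_neg hlt]
      have : lo = hi := by omega
      subst this
      exact ⟨le_rfl, le_rfl, hhi, hlo⟩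

/-- At exponent `n` the index `b - 2 ^ n` lies below `bₑ`, so the comparison must succeed there at
the latest, and the search never goes further than `2 ^ n` back. -/
theorem rd_doublingSearch (hm : MInv T m) {b e bₑ n k : ℕ} (hex : m.ex [] b) (h1 : 1 ≤ bₑ)
    (hb : bₑ ≤ b) (he : e ≤ m.fld [] bₑ .sumEnq)
    (hlo : m.fld [] (bₑ - 1) .sumEnq < e) (hn : b - bₑ < 2 ^ n) (hk : k ≤ n) :
    rd m (doublingSearch b e k) (n - k + 1)
      (fun lo => lo < bₑ ∧ m.fld [] lo .sumEnq < e ∧ b - lo ≤ 2 ^ n) := by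
  induction hd : n - k generalizing k with
  | zero =>
    obtain rfl : k = n := by omega
    rw [doublingSearch]
    by_cases hlt : 2 ^ k < b
    · rw [if_pos hlt]
      refine rd_readField (hm.ex_of_le .root hex (Nat.sub_le _ _)) (by simp) ?_
      have hs : m.fld [] (b - 2 ^ k) .sumEnq < e :=
        lt_of_le_of_lt (hm.sum_le true .root (hm.ex_of_le .root hex (b' := bₑ - 1) (by omega))
          (by omega)) hlo
      rw [if_pos hs]
      exact ⟨by omega, hs, by omega⟩
    · rw [if_neg hlt]
      refine ⟨by omega, ?_, by omega⟩
      rw [hm.zero .root (by simp)]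
      omega
  | succ d ih =>
    have h2 : 2 ^ (k + 1) ≤ 2 ^ n := Nat.pow_le_pow_right (by norm_num) (by omega)
    have h2' : 2 ^ k < 2 ^ (k + 1) := Nat.pow_lt_pow_succ (by norm_num)
    rw [doublingSearch]
    by_cases hlt : 2 ^ k < b
    · rw [if_pos hlt]
      refine rd_readField (hm.ex_of_le .root hex (Nat.sub_le _ _)) (by simp) ?_
      by_cases hs : m.fld [] (b - 2 ^ k) .sumEnq < e
      · rw [if_pos hs]
        refine ⟨not_le.1 fun hcon => ?_, hs, by omega⟩
        have := hm.sum_le true .root (hm.ex_of_le .root hex (Nat.sub_le _ _)) hcon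
        simp only [cntField] at this
        omega
      · rw [if_neg hs]
        exact ih (by omega) (by omega)
    · rw [if_neg hlt]
      refine ⟨by omega, ?_, by omega⟩
      rw [hm.zero .root (by simp)]
      omega

/-- Doubling takes at most `n + 1` reads and leaves at most `2 ^ n` indices, for which `n` more
reads suffice. Monotonicity of the sums makes `bₑ` the only possible result. -/
theorem rd_rootSearch (hm : MInv T m) {b e bₑ n : ℕ} (hex : m.ex [] b) (h1 : 1 ≤ bₑ)
    (hb : bₑ ≤ b) (he : e ≤ m.fld [] bₑ .sumEnq) (hlo : m.fld [] (bₑ - 1) .sumEnq < e)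
    (hn : b - bₑ < 2 ^ n) : rd m (rootSearch b e) (2 * n + 1) (fun b' => b' = bₑ) := by
  have hsum : ∀ {a c}, c ≤ b → a ≤ c → m.fld [] a .sumEnq ≤ m.fld [] c .sumEnq :=
    fun hc hac => hm.sum_le true .root (hm.ex_of_le .root hex hc) hac
  refine rd_weaken (n := (n - 0 + 1) + n) (rd_bind (rd_weaken
    (rd_doublingSearch hm hex h1 hb he hlo hn (Nat.zero_le n)) le_rfl ?_)) (by omega) fun _ h => h
  rintro lo ⟨h2, h3, h4⟩
  refine rd_weaken (rd_binarySearch hm .root (by omega) hex (he.trans (hsum le_rfl hb)) h3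
    (by have := Nat.pos_of_ne_zero (pow_ne_zero n (two_ne_zero (α := ℕ))); omega)) le_rfl ?_
  rintro b' ⟨h5, h6, h7, h8⟩
  rcases lt_trichotomy b' bₑ with h | h | h
  · have := hsum (a := b') (c := bₑ - 1) (by omega) (by omega)
    omega
  · exact h
  · have := hsum (a := bₑ) (c := b' - 1) (by omega) (by omega)
    omega

end Search

/-! ### Locating operations by prefix sums -/

section Content

variable {T : OTree p} {m : Memory V} {e : Bool} {v : Node} {t : OTree p}

/-- The operations of the blocks before `b` come first, and their number is a difference of prefix
sums. -/
theorem getElem?_flatMap_blockOps (hm : MInv T m) (hv : T.Sub v t) {a b c j : ℕ} {o : OpId p}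
    (hc : m.ex v c) (hab : a < b) (hbc : b ≤ c) (ho : (blockOps e m t v b)[j]? = some o) :
    ((indexRange a c).flatMap (blockOps e m t v))[
      m.fld v (b - 1) (cntField e) - m.fld v a (cntField e) + j]? = some o := by
  obtain ⟨b, rfl⟩ : ∃ d, b = d + 1 := ⟨b - 1, by omega⟩
  have hb := hm.ex_of_le hv hc (b' := b) (by omega)
  have hlen := length_flatMap_blockOps hm e hv hb (a := a) (by omega)
  have hj : j < (blockOps e m t v (b + 1)).length := (List.getElem?_eq_some_iff.1 ho).1
  rw [indexRange_append (b := b) (by omega) (by omega), indexRange_append b.le_succ hbc,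
    indexRange_succ, List.flatMap_append, List.flatMap_append, List.getElem?_append_right
    (by simp only [Nat.add_sub_cancel]; omega), List.getElem?_append_left]
  · simp only [Nat.add_sub_cancel, List.flatMap_singleton]
    rw [← ho]
    congr 1
    omega
  · simp only [Nat.add_sub_cancel, List.flatMap_singleton]
    omega

/-- A position in the concatenation belongs to the block whose prefix sums enclose it. -/
theorem getElem?_blockOps_of_flatMap (hm : MInv T m) (hv : T.Sub v t) {a b c j : ℕ} {o : OpId p}
    (hc : m.ex v c) (hab : a < b) (hbc : b ≤ c)
    (ho : ((indexRange a c).flatMap (blockOps e m t v))[j]? = some o)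
    (h1 : m.fld v (b - 1) (cntField e) ≤ m.fld v a (cntField e) + j)
    (h2 : m.fld v a (cntField e) + j < m.fld v b (cntField e)) :
    (blockOps e m t v b)[j - (m.fld v (b - 1) (cntField e) - m.fld v a (cntField e))]? =
      some o := by
  obtain ⟨b, rfl⟩ : ∃ d, b = d + 1 := ⟨b - 1, by omega⟩
  simp only [Nat.add_sub_cancel] at h1 ⊢
  have hb := hm.ex_of_le hv hc (b' := b) (by omega)
  have hlen := length_flatMap_blockOps hm e hv hb (a := a) (by omega)
  have hlen' := length_blockOps hm e hv (hm.ex_of_le hv hc hbc)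
  rw [indexRange_append (b := b) (by omega) (by omega), indexRange_append b.le_succ hbc,
    indexRange_succ, List.flatMap_append, List.flatMap_append, List.getElem?_append_right
    (by omega), List.getElem?_append_left
    (by rw [List.flatMap_singleton]; omega)] at ho
  rw [← ho, List.flatMap_singleton]
  congr 1
  omega

/-- `getEnqueue` finds the element of an enqueue from its position in a block. -/
theorem rd_getEnqueue (hm : MInv T m) {n : ℕ}
    (hW : ∀ {v l r b}, T.Sub v (.node l r) → m.ex v (b + 1) → ∀ d,
      m.fld v (b + 1) (.endOf d) ≤ m.fld v b (.endOf d) + 2 ^ n)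
    (hv : T.Sub v t) {b j : ℕ} {o : OpId p} (h1 : 1 ≤ b) (hb : m.ex v b)
    (ho : (blockOps true m t v b)[j]? = some o) :
    rd m (getEnqueue t v b (j + 1)) ((9 + n) * t.height + 1) (fun r => r.isSome ∧
      ∃ u, T.Sub u (.leaf o.1) ∧ 1 ≤ o.2 ∧ m.ex u o.2 ∧ m.elem u o.2 = r) := by
  induction t generalizing v b j with
  | leaf i =>
    rw [blockOps_leaf _ _ hb] at ho
    split_ifs at ho with hc
    · obtain ⟨rfl, rfl⟩ : j = 0 ∧ (i, b) = o := by
        cases j <;> simp_all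
      refine rd_weaken (rd_readElement hb) (by omega) ?_
      rintro r rfl
      exact ⟨hc.2, v, hv, h1, hb, rfl⟩
    · simp at ho
  | node l r ihl ihr =>
    obtain ⟨b, rfl⟩ : ∃ d, b = d + 1 := ⟨b - 1, by omega⟩
    have hb' := hm.ex_of_le hv hb b.le_succ
    rw [blockOps_node _ _ _ hb' hb] at ho
    simp only [Nat.add_sub_cancel] at ho
    have hel := hm.ex_end hv hb .left
    have her := hm.ex_end hv hb .right
    have hel' := hm.ex_end hv hb' .left
    have her' := hm.ex_end hv hb' .right
    have hml := hm.end_mono hv hb .left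
    have hmr := hm.end_mono hv hb .right
    have hlenl := length_flatMap_blockOps hm true hv.left hel hml
    have hlenr := length_flatMap_blockOps hm true hv.right her hmr
    -- Each level costs nine reads besides the `n` of the binary search.
    have hh : (9 + n) * (OTree.node l r).height + 1 =
        ((9 + n) * max l.height r.height + 1) + n + 1 + 1 + 1 + 1 + 1 + 1 + 1 + 1 + 1 := by
      simp only [OTree.height]
      ring
    have hhl : (9 + n) * l.height ≤ (9 + n) * max l.height r.height :=
      Nat.mul_le_mul_left _ (le_max_left _ _)
    have hhr : (9 + n) * r.height ≤ (9 + n) * max l.height r.height :=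
      Nat.mul_le_mul_left _ (le_max_right _ _)
    rw [hh]
    simp only [getEnqueue, Nat.add_sub_cancel]
    refine rd_readField hb (by simp) (rd_readField hel (by simp) (rd_readField hb' (by simp)
      (rd_readField hel' (by simp) (rd_readField hb' (by simp) (rd_readField her' (by simp) ?_)))))
    simp only [cntField] at hlenl hlenr
    by_cases hj : j + 1 ≤ m.fld (.left :: v) (m.fld v (b + 1) (.endOf .left)) .sumEnq -
        m.fld (.left :: v) (m.fld v b (.endOf .left)) .sumEnq
    · rw [if_pos hj]
      rw [List.getElem?_append_left (by omega)] at ho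
      refine rd_readField hb' (by simp) (rd_readField hb (by simp) ?_)
      -- The rank is positive, so an empty range of subblocks could not provide it.
      have hlt : m.fld v b (.endOf .left) < m.fld v (b + 1) (.endOf .left) := by
        rcases hml.lt_or_eq with h | h
        · exact h
        · rw [h] at hj; omega
      have hw := hW hv hb .left
      refine rd_weaken (n := n + (1 + ((9 + n) * l.height + 1))) (rd_bind (rd_weaken
        (rd_binarySearch hm hv.left (by omega) hel (by omega) (by
          rw [Nat.add_sub_cancel]; omega) (by omega)) le_rfl ?_)) (by omega) fun _ h => h
      rintro c ⟨hc1, hc2, hc3, hc4⟩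
      have hexc := hm.ex_of_le hv.left hel hc2
      rw [Nat.add_comm 1]
      refine rd_readField (hm.ex_of_le hv.left hexc (Nat.sub_le _ _)) (by simp) ?_
      have hmono := hm.sum_le true hv.left (hm.ex_of_le hv.left hexc (Nat.sub_le c 1))
        (b' := m.fld v b (.endOf .left)) (by omega)
      simp only [cntField] at hmono
      -- The result of the search encloses position `j`. Ranks in the code count from 1, positions
      -- in lists from 0.
      have := getElem?_blockOps_of_flatMap hm hv.left hel (by omega) hc2 ho
        (by simp only [cntField]; omega) (by simp only [cntField]; omega)
      have hrec := ihl hv.left (by omega) hexc this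
      simp only [cntField] at hrec
      convert hrec using 2
      omega
    · rw [if_neg hj]
      rw [List.getElem?_append_right (by omega)] at ho
      refine rd_readField hb' (by simp) (rd_readField hb (by simp) ?_)
      have hj2 := (List.getElem?_eq_some_iff.1 ho).1
      have hlt : m.fld v b (.endOf .right) < m.fld v (b + 1) (.endOf .right) := by
        rcases hmr.lt_or_eq with h | h
        · exact h
        · rw [h] at hlenr hj2; omega
      have hw := hW hv hb .right
      refine rd_weaken (n := n + (1 + ((9 + n) * r.height + 1))) (rd_bind (rd_weaken
        (rd_binarySearch hm hv.right (by omega) her (by omega) (by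
          rw [Nat.add_sub_cancel]; omega) (by omega)) le_rfl ?_)) (by omega) fun _ h => h
      rintro c ⟨hc1, hc2, hc3, hc4⟩
      have hexc := hm.ex_of_le hv.right her hc2
      rw [Nat.add_comm 1]
      refine rd_readField (hm.ex_of_le hv.right hexc (Nat.sub_le _ _)) (by simp) ?_
      have hmono := hm.sum_le true hv.right (hm.ex_of_le hv.right hexc (Nat.sub_le c 1))
        (b' := m.fld v b (.endOf .right)) (by omega)
      simp only [cntField] at hmono
      have := getElem?_blockOps_of_flatMap hm hv.right her (by omega) hc2 ho
        (by simp only [cntField]; omega) (by simp only [cntField]; omega)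
      have hrec := ihr hv.right (by omega) hexc this
      simp only [cntField] at hrec
      convert hrec using 2
      omega

/-- `indexDequeue` computes the position of a dequeue in the root. -/
theorem rd_indexDequeue (hT : T.Good) {w : World p V} (hI : Inv T w) {o : OpId p} {k : ℕ}
    (hk : k < w.mem.head []) (hmem : o ∈ content false w.mem T [] k) (hv : T.Sub v t)
    (ho : o.1 ∈ t.leaves) {b j : ℕ} (h1 : 1 ≤ b) (hb : b < w.mem.head v)
    (hpos : (blockOps false w.mem t v b)[j]? = some o) :
    rd w.mem (indexDequeue v b (j + 1)) (9 * v.length) (fun r => 1 ≤ r.1 ∧ r.1 < w.mem.head [] ∧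
      ∃ j', r.2 = j' + 1 ∧ (blockOps false w.mem T [] r.1)[j']? = some o) := by
  have hm := hI.minv
  induction v generalizing t b j with
  | nil =>
    cases OTree.Sub.root.unique hv
    exact ⟨h1, hb, j, rfl, hpos⟩
  | cons d u ih =>
    obtain ⟨l, r, hu, rfl⟩ := hv.parent
    have hexb := hm.ex_lt hv hb
    obtain ⟨x, hx⟩ := hm.sup hv h1 hb
    obtain ⟨m₀, hm₀, rfl, hex₀, hle₀⟩ := hI.sup hv hx
    have hmle := hI.past_le m₀ hm₀
    have hinv₀ := hI.past_inv m₀ hm₀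
    -- the superblock
    obtain ⟨k', hk', hmem'⟩ := content_down hT.nodup hm hk hmem hu (OTree.leaves_child ho)
    have hexk := hm.ex_lt hu hk'
    -- The operation reached `u` through a child block below this end. It occurs only once in the
    -- child, in block `b`, so `b` itself is covered.
    have hbk : b ≤ w.mem.fld u k' (.endOf d) := by
      by_contra hcon
      rw [content_child_iff hT.nodup hm hu hexk ho] at hmem'
      have hnd := nodup_content hT.nodup hm false hv hexb
      obtain ⟨c, rfl⟩ : ∃ c, b = c + 1 := ⟨b - 1, by omega⟩
      rw [content_succ, List.nodup_append] at hnd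
      exact hnd.2.2 o (content_subset _ _ _ _ (by omega) hmem') o
        (List.mem_iff_getElem?.2 ⟨j, hpos⟩) rfl
    -- In the memory that gave `super`, these blocks ended below the child's head, which had not
    -- passed `b`.
    have hlow : ∀ y < m₀.head u, w.mem.fld u y (.endOf d) < b := by
      intro y hy
      have hexy := hinv₀.ex_lt hu hy
      rw [hmle.fld hexy (by simp)]
      exact (hinv₀.end_lt hu hexy d).trans_le hle₀
    have hxk : m₀.head u ≤ k' := not_lt.1 fun hlt => by
      have := hlow k' hlt
      omega
    have hexx := hm.ex_of_le hu hexk hxk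
    have hx1 := hinv₀.head_pos hu
    -- The superblock is the recorded index if its end reaches `b`; otherwise the next index, whose
    -- block covers `b` by `snap`.
    obtain ⟨s, hs, hs1, hsk, hslo, hshi⟩ : ∃ s, (if w.mem.fld u (m₀.head u) (.endOf d) < b then
        m₀.head u + 1 else m₀.head u) = s ∧ 1 ≤ s ∧ s ≤ k' ∧
        w.mem.fld u (s - 1) (.endOf d) < b ∧ b ≤ w.mem.fld u s (.endOf d) := by
      split_ifs with hlt
      · have hne : m₀.head u ≠ k' := by
          rintro heq
          rw [heq] at hlt
          omega
        refine ⟨_, rfl, by omega, by omega, hlt, ?_⟩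
        exact hI.snap hu (hm.ex_of_le hu hexk (by omega)) hm₀ (Nat.lt_succ_self _) hex₀
      · exact ⟨_, rfl, hx1, hxk, hlow _ (by omega), not_lt.1 hlt⟩
    have hexs := hm.ex_of_le hu hexk hsk
    have hexs' := hm.ex_of_le hu hexs (Nat.sub_le s 1)
    -- A right child needs nine reads, a left child only five.
    have hlen : 9 * (d :: u).length = 9 * u.length + 1 + 1 + 1 + 1 + 1 + 1 + 1 + 1 + 1 := by
      simp only [List.length_cons]
      ring
    rw [hlen]
    simp only [indexDequeue]
    refine rd_readSuper hx (rd_readField hexx (by simp) ?_)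
    rw [hs]
    refine rd_readField (hm.ex_of_le hv hexb (Nat.sub_le b 1)) (by simp) (rd_readField hexs' (by simp)
      (rd_readField (hm.ex_end hu hexs' d) (by simp) ?_))
    have hflat := getElem?_flatMap_blockOps hm hv (hm.ex_end hu hexs d) hslo hshi hpos
    have hops := blockOps_node (p := p) false l r hexs' hexs
    have hsl : s < w.mem.head u := hsk.trans_lt hk'
    cases d with
    | left =>
      have hj' := (List.getElem?_eq_some_iff.1 hflat).1
      refine rd_weaken (n := 9 * u.length) ?_ (by omega) fun _ h => h
      have hrec := ih hu (OTree.leaves_child ho) hs1 hsl (j := w.mem.fld (.left :: u) (b - 1) .sumDeq -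
        w.mem.fld (.left :: u) (w.mem.fld u (s - 1) (.endOf .left)) .sumDeq + j) (by
          rw [hops, List.getElem?_append_left]
          · exact hflat
          · exact hj')
      show rd w.mem (indexDequeue u s _) _ _
      convert hrec using 2
      omega
    | right =>
      have hexl := hm.ex_end hu hexs .left
      have hmono := hm.end_le hu hexs (Nat.sub_le s 1) .left
      refine rd_readField hexs (by simp) (rd_readField hexl (by simp)
        (rd_readField hexs' (by simp) (rd_readField (hm.ex_end hu hexs' .left) (by simp) ?_)))
      have hlenl := length_flatMap_blockOps hm false hu.left hexl hmono
      simp only [cntField] at hlenl hflat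
      have hrec := ih hu (OTree.leaves_child ho) hs1 hsl (j := w.mem.fld (.right :: u) (b - 1) .sumDeq -
        w.mem.fld (.right :: u) (w.mem.fld u (s - 1) (.endOf .right)) .sumDeq + j +
        (w.mem.fld (.left :: u) (w.mem.fld u s (.endOf .left)) .sumDeq -
        w.mem.fld (.left :: u) (w.mem.fld u (s - 1) (.endOf .left)) .sumDeq)) (by
          rw [hops, List.getElem?_append_right (by omega), ← hflat]
          congr 1
          omega)
      show rd w.mem (indexDequeue u s _) _ _
      convert hrec using 2
      omega

end Content

end WFQueue

namespace WFQueue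

variable {p : ℕ} {V : Type}

/-! ## The sequential execution -/

theorem queueAfter_append_enqs (L : List (SeqOp p)) (E : List (OpId p)) :
    queueAfter (L ++ E.map SeqOp.enq) = queueAfter L ++ E := by
  induction E using List.reverseRecOn with
  | nil => simp
  | append_singleton E o ih =>
    rw [List.map_append, ← List.append_assoc, queueAfter, List.foldl_append, ← queueAfter, ih]
    simp

theorem queueAfter_append_deqs (L : List (SeqOp p)) (D : List (OpId p)) :
    queueAfter (L ++ D.map SeqOp.deq) = (queueAfter L).drop D.length := by
  induction D using List.reverseRecOn with
  | nil => simp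
  | append_singleton D o ih =>
    rw [List.map_append, ← List.append_assoc, queueAfter, List.foldl_append, ← queueAfter, ih]
    simp [List.tail_drop]

theorem Dequeues.append {L : List (SeqOp p)} {d e : OpId p} {n : ℕ} (h : Dequeues L d e n)
    (R : List (SeqOp p)) : Dequeues (L ++ R) d e n := by
  obtain ⟨L₁, L₂, rest, rfl, h⟩ := h
  exact ⟨L₁, L₂ ++ R, rest, by simp, h⟩

theorem EnqueuedAt.append {L : List (SeqOp p)} {e : OpId p} {n : ℕ} (h : EnqueuedAt L e n)
    (R : List (SeqOp p)) : EnqueuedAt (L ++ R) e n := by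
  obtain ⟨L₁, L₂, rfl, h⟩ := h
  exact ⟨L₁, L₂ ++ R, by simp, h⟩

/-- Makes the point at which an operation is linearized unique, and with it the queue at that point.
-/
theorem eq_of_nodup_append_cons {α : Type} {L₁ L₂ L₁' L₂' : List α} {x : α}
    (h : L₁ ++ x :: L₂ = L₁' ++ x :: L₂') (hnd : (L₁ ++ x :: L₂).Nodup) : L₁ = L₁' := by
  rw [h, List.nodup_append, List.nodup_cons] at hnd
  exact ((List.append_cons_inj_of_notMem (fun hx => hnd.2.2 x hx x (by simp) rfl)
    hnd.2.1.1).1 h.symm).1.symm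

theorem exists_eq_append_cons {α : Type} {L : List α} {j : ℕ} {x : α} (h : L[j]? = some x) :
    ∃ A B, L = A ++ x :: B ∧ A.length = j := by
  obtain ⟨hj, rfl⟩ := List.getElem?_eq_some_iff.1 h
  exact ⟨L.take j, L.drop (j + 1), by simp, List.length_take_of_le hj.le⟩

theorem Dequeues.unique {L : List (SeqOp p)} (hL : L.Nodup) {d e e' : OpId p} {n n' : ℕ}
    (h : Dequeues L d e n) (h' : Dequeues L d e' n') : e = e' ∧ n = n' := by
  obtain ⟨L₁, L₂, rest, rfl, hq, rfl⟩ := h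
  obtain ⟨L₁', L₂', rest', heq, hq', rfl⟩ := h'
  obtain rfl := eq_of_nodup_append_cons heq hL
  rw [hq] at hq'
  exact ⟨(List.cons.inj hq').1, rfl⟩

theorem EnqueuedAt.unique {L : List (SeqOp p)} (hL : L.Nodup) {e : OpId p} {n n' : ℕ}
    (h : EnqueuedAt L e n) (h' : EnqueuedAt L e n') : n = n' := by
  obtain ⟨L₁, L₂, rfl, rfl⟩ := h
  obtain ⟨L₁', L₂', heq, rfl⟩ := h'
  rw [eq_of_nodup_append_cons heq hL]

theorem Dequeues.not_null {L : List (SeqOp p)} (hL : L.Nodup) {d e : OpId p} {n : ℕ}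
    (h : Dequeues L d e n) : ¬ IsNullDequeue L d := by
  rintro ⟨L₁', L₂', heq, hq'⟩
  obtain ⟨L₁, L₂, rest, rfl, hq, rfl⟩ := h
  obtain rfl := eq_of_nodup_append_cons heq hL
  rw [hq] at hq'
  cases hq'

theorem Dequeues.linearized {L : List (SeqOp p)} {d e : OpId p} {n : ℕ} (h : Dequeues L d e n) :
    ¬ NotLinearized L d := by
  obtain ⟨L₁, L₂, rest, rfl, -⟩ := h
  simp [NotLinearized]

/-! ## The linearization -/

/-- The sequential execution of the operations in the blocks of the root with indices in `l`. -/
def rootOps (T : OTree p) (m : Memory V) (l : List ℕ) : List (SeqOp p) :=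
  l.flatMap fun b =>
    (blockOps true m T [] b).map SeqOp.enq ++ (blockOps false m T [] b).map SeqOp.deq

section Linearization

variable {T : OTree p} {m m' : Memory V}

theorem rootOps_append (l l' : List ℕ) :
    rootOps T m (l ++ l') = rootOps T m l ++ rootOps T m l' := List.flatMap_append

theorem rootOps_succ (b : ℕ) : rootOps T m (indexRange 0 (b + 1)) = rootOps T m (indexRange 0 b) ++
    ((blockOps true m T [] (b + 1)).map SeqOp.enq ++
      (blockOps false m T [] (b + 1)).map SeqOp.deq) := by
  rw [indexRange_append (Nat.zero_le b) b.le_succ, rootOps_append, indexRange_succ]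
  simp [rootOps]

theorem rootOps_mono (hm : MInv T m) (hle : MLe m m') {b : ℕ} (hb : m.ex [] b) :
    rootOps T m' (indexRange 0 b) = rootOps T m (indexRange 0 b) := by
  refine List.flatMap_congr fun k hk => ?_
  have hex := hm.ex_of_le .root hb (mem_indexRange.1 hk).2
  rw [blockOps_mono hm hle _ .root hex, blockOps_mono hm hle _ .root hex]

theorem linearization_eq_append (hm : MInv T m) {b : ℕ} (hb : m.ex [] b) :
    linearization T m = rootOps T m (indexRange 0 b) ++
      rootOps T m (indexRange b (m.head [])) := by
  rw [← rootOps_append, ← indexRange_append (Nat.zero_le b) (hm.le_head .root hb)]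
  rfl

/-- The linearization runs up to index `head`, where the block may be null and then contributes
nothing. -/
theorem exists_linearization_eq (hm : MInv T m) :
    ∃ b, m.ex [] b ∧ linearization T m = rootOps T m (indexRange 0 b) := by
  have h1 := hm.head_pos .root
  by_cases hex : m.ex [] (m.head [])
  · exact ⟨_, hex, rfl⟩
  · obtain ⟨h, hh⟩ : ∃ h, m.head [] = h + 1 := ⟨m.head [] - 1, by omega⟩
    refine ⟨h, hm.ex_lt .root (by omega), ?_⟩
    show rootOps T m (indexRange 0 (m.head [])) = _
    rw [hh] at hex ⊢
    rw [rootOps_succ, blockOps_of_not_ex _ _ hex, blockOps_of_not_ex _ _ hex]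
    simp

/-- The linearization only grows at its end. -/
theorem linearization_mono (hm : MInv T m) (hm' : MInv T m') (hle : MLe m m') :
    ∃ R, linearization T m' = linearization T m ++ R := by
  obtain ⟨b, hb, h⟩ := exists_linearization_eq hm
  rw [linearization_eq_append hm' (hle.ex hb), rootOps_mono hm hle hb, h]
  exact ⟨_, rfl⟩

/-- Up to order, it consists of all enqueues and then all dequeues in the root. -/
theorem nodup_linearization (hT : T.leaves.Nodup) (hm : MInv T m) : (linearization T m).Nodup := by
  obtain ⟨b, hb, h⟩ := exists_linearization_eq hm
  have key : ∀ b, (rootOps T m (indexRange 0 b)).Perm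
      ((content true m T [] b).map SeqOp.enq ++ (content false m T [] b).map SeqOp.deq) := by
    intro b
    induction b with
    | zero => simp [indexRange_self, rootOps, content_zero]
    | succ b ih =>
      rw [rootOps_succ, content_succ, content_succ, List.map_append, List.map_append]
      refine (ih.append_right _).trans ?_
      simp only [List.append_assoc]
      refine List.Perm.append_left _ ?_
      rw [← List.append_assoc, ← List.append_assoc]
      exact List.perm_append_comm.append_right _
  rw [h, (key b).nodup_iff, List.nodup_append]
  refine ⟨(nodup_content hT hm _ .root hb).map fun _ _ h => SeqOp.enq.inj h,
    (nodup_content hT hm _ .root hb).map fun _ _ h => SeqOp.deq.inj h, ?_⟩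
  intro a ha b hb hab
  subst hab
  obtain ⟨o, -, rfl⟩ := List.mem_map.1 ha
  obtain ⟨o', -, h⟩ := List.mem_map.1 hb
  cases h

/-- The field `size` is at most the number of enqueues. -/
theorem size_le_sumEnq (hm : MInv T m) {l r : OTree p} (hT : T.Sub [] (.node l r)) {b : ℕ}
    (hb : m.ex [] b) : m.fld [] b .size ≤ m.fld [] b .sumEnq := by
  induction b with
  | zero => rw [hm.zero .root (by simp), hm.zero .root (by simp)]
  | succ b ih =>
    have hb' := hm.ex_of_le .root hb b.le_succ
    have h1 := hm.size hT hb
    have h2 := hm.sum_le true .root hb b.le_succ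
    have h3 := ih hb'
    simp only [cntField] at h2
    omega

/-- The content of the queue after the blocks `1, …, b` of the root. -/
theorem queueAfter_rootOps (hm : MInv T m) {l r : OTree p} (hT : T.Sub [] (.node l r)) {b : ℕ}
    (hb : m.ex [] b) : queueAfter (rootOps T m (indexRange 0 b)) =
      (content true m T [] b).drop (m.fld [] b .sumEnq - m.fld [] b .size) := by
  induction b with
  | zero => simp [indexRange_self, rootOps, content_zero, queueAfter]
  | succ b ih =>
    have hb' := hm.ex_of_le .root hb b.le_succ
    have hsz := hm.size hT hb
    have hle := size_le_sumEnq hm hT hb'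
    have hlen := length_content hm true .root hb'
    have hE := length_blockOps hm true .root hb
    have hD := length_blockOps hm false .root hb
    have hlen' := length_content hm true .root hb
    simp only [cntField] at hlen hE hD hlen'
    rw [rootOps_succ, ← List.append_assoc, queueAfter_append_deqs, queueAfter_append_enqs, ih hb',
      ← List.drop_append_of_le_length (by omega), ← content_succ, List.drop_drop]
    -- If the dequeues outnumber the available elements, `size` is truncated to 0 and both lists are
    -- empty.
    by_cases hc : m.fld [] (b + 1) .sumDeq - m.fld [] b .sumDeq ≤
        m.fld [] b .size + (m.fld [] (b + 1) .sumEnq - m.fld [] b .sumEnq)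
    · congr 1
      omega
    · rw [List.drop_eq_nil_of_le (by omega), List.drop_eq_nil_of_le (by omega)]

/-- The state of the queue when a dequeue is linearized. -/
theorem queueAfter_dequeue (hm : MInv T m) {l r : OTree p} (hT : T.Sub [] (.node l r)) {b j : ℕ}
    {d : OpId p} (hb : m.ex [] (b + 1)) (hd : (blockOps false m T [] (b + 1))[j]? = some d) :
    ∃ L₁ L₂, linearization T m = L₁ ++ SeqOp.deq d :: L₂ ∧ queueAfter L₁ =
      (content true m T [] (b + 1)).drop (m.fld [] b .sumEnq - m.fld [] b .size + j) := by
  have hb' := hm.ex_of_le .root hb b.le_succ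
  have hle := size_le_sumEnq hm hT hb'
  have hlen := length_content hm true .root hb'
  simp only [cntField] at hlen
  obtain ⟨A, B, hAB, rfl⟩ := exists_eq_append_cons hd
  refine ⟨rootOps T m (indexRange 0 b) ++ (blockOps true m T [] (b + 1)).map SeqOp.enq ++
    A.map SeqOp.deq, B.map SeqOp.deq ++ rootOps T m (indexRange (b + 1) (m.head [])), ?_, ?_⟩
  · rw [linearization_eq_append hm hb, rootOps_succ, hAB]
    simp
  · rw [queueAfter_append_deqs, queueAfter_append_enqs, queueAfter_rootOps hm hT hb',
      ← List.drop_append_of_le_length (by omega), ← content_succ, List.drop_drop]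

/-- The state of the queue when an enqueue is linearized. -/
theorem enqueuedAt_of_blockOps (hm : MInv T m) {l r : OTree p} (hT : T.Sub [] (.node l r))
    {b j : ℕ} {e : OpId p} (hb : m.ex [] (b + 1))
    (he : (blockOps true m T [] (b + 1))[j]? = some e) :
    EnqueuedAt (linearization T m) e (m.fld [] b .size + j + 1) := by
  have hb' := hm.ex_of_le .root hb b.le_succ
  have hle := size_le_sumEnq hm hT hb'
  have hlen := length_content hm true .root hb'
  simp only [cntField] at hlen
  obtain ⟨A, B, hAB, rfl⟩ := exists_eq_append_cons he
  refine ⟨rootOps T m (indexRange 0 b) ++ A.map SeqOp.enq, B.map SeqOp.enq ++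
    (blockOps false m T [] (b + 1)).map SeqOp.deq ++
      rootOps T m (indexRange (b + 1) (m.head [])), ?_, ?_⟩
  · rw [linearization_eq_append hm hb, rootOps_succ, hAB]
    simp
  · have : [SeqOp.enq e] = [e].map SeqOp.enq := rfl
    rw [this, queueAfter_append_enqs, queueAfter_append_enqs, queueAfter_rootOps hm hT hb']
    simp only [List.length_append, List.length_drop, List.length_singleton]
    omega

/-- The dequeue that removes an element is not much later than the enqueue that inserted it. -/
theorem block_distance (hm : MInv T m) {l r : OTree p} (hT : T.Sub [] (.node l r)) {a b q : ℕ}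
    (hb : m.ex [] (b + 1)) (hab : a ≤ b) (h1 : m.fld [] a .sumEnq ≤ q)
    (h2 : q < m.fld [] (a + 1) .sumEnq) (h3 : m.fld [] b .sumEnq - m.fld [] b .size ≤ q)
    (h4 : q < m.fld [] (b + 1) .sumEnq) :
    b - a < (m.fld [] a .size + (q - m.fld [] a .sumEnq) + 1) + (m.fld [] (b + 1) .sumEnq - q) := by
  have hb' := hm.ex_of_le .root hb b.le_succ
  have hsum : ∀ e, ∀ {x y}, y ≤ b → x ≤ y → m.fld [] x (cntField e) ≤ m.fld [] y (cntField e) :=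
    fun e x y hy hxy => hm.sum_le e .root (hm.ex_of_le .root hb' hy) hxy
  have hE : ∀ {x y}, y ≤ b → x ≤ y → m.fld [] x .sumEnq ≤ m.fld [] y .sumEnq := hsum true
  have hD : ∀ {x y}, y ≤ b → x ≤ y → m.fld [] x .sumDeq ≤ m.fld [] y .sumDeq := hsum false
  -- `sumEnq - size` counts the elements removed so far, so it never decreases.
  have hdel : ∀ x y, y ≤ b → x ≤ y → m.fld [] x .sumEnq - m.fld [] x .size ≤
      m.fld [] y .sumEnq - m.fld [] y .size := by
    intro x y hy hxy
    induction y, hxy using Nat.le_induction with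
    | base => exact le_rfl
    | succ y hxy ih =>
      have h5 := hm.size hT (hm.ex_of_le .root hb' hy)
      have h6 := ih (by omega)
      have h7 := hE hy y.le_succ
      have h8 := size_le_sumEnq hm hT (hm.ex_of_le .root hb' (b' := y) (by omega))
      omega
  have key : ∀ x, a ≤ x → x ≤ b → m.fld [] x .sumEnq + m.fld [] a .sumDeq + m.fld [] a .size =
      m.fld [] x .size + m.fld [] x .sumDeq + m.fld [] a .sumEnq := by
    intro x hx hxb
    induction x, hx using Nat.le_induction with
    | base => omega
    | succ x hx ih =>
      have h5 := hm.size hT (hm.ex_of_le .root hb' hxb)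
      have h6 := ih (by omega)
      have h7 := hE hxb x.le_succ
      have h8 := hD hxb x.le_succ
      have h9 := hdel (x + 1) b le_rfl hxb
      have h10 := hE hxb (x := a + 1) (by omega)
      omega
  have h5 := key b hab le_rfl
  have h6 := size_le_sumEnq hm hT hb'
  have h7 := size_le_sumEnq hm hT (hm.ex_of_le .root hb' hab)
  have h8 := hm.sum_le true .root hb b.le_succ
  simp only [cntField] at h8
  -- Blocks `a + 2, …, b` contain at least one operation each: enqueues behind `q`, or dequeues of
  -- elements in front of `q`.
  rcases hab.lt_or_eq with h | rfl
  · have h9 := hm.sub_le_sums .root hb' (b' := a + 1) h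
    have h10 := hD (y := a + 1) h a.le_succ
    omega
  · omega

end Linearization

end WFQueue

namespace WFQueue

variable {p : ℕ} {V : Type}

/-! ## The code of a dequeue -/

/-- `staged T i Z P n w`: if process `i` runs `P` from the state `w`, then, whatever the other
processes do, it preserves the invariant and within `n` steps reaches a point where the rest of the
program and the state satisfy `Z`. -/
def staged {α : Type} (T : OTree p) (i : Fin p) (Z : Prog V α → World p V → Prop) :
    Prog V α → ℕ → World p V → Prop
  | .ret a, _, w => Z (.ret a) w
  | .op a k, n, w => Z (.op a k) w ∨ ∃ n', n = n' + 1 ∧ ∀ w', Le T i w w' → Inv T w' →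
      Inv T (w'.setMem (a.exec w'.mem).2) ∧
      (∀ j, j ≠ i → Le T j w' (w'.setMem (a.exec w'.mem).2)) ∧
      staged T i Z (k (a.exec w'.mem).1) n' (w'.setMem (a.exec w'.mem).2)

section Staged

variable {α β : Type} {T : OTree p} {i : Fin p} {w : World p V} {n n' : ℕ}

theorem staged_of {Z : Prog V α → World p V → Prop} {P : Prog V α} (h : Z P w) :
    staged T i Z P n w := by
  cases P with
  | ret a => exact h
  | op a k => exact .inl h

theorem staged_weaken {Z : Prog V α → World p V → Prop} {P : Prog V α} (h : staged T i Z P n w)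
    (hn : n ≤ n') : staged T i Z P n' w := by
  induction P generalizing n n' w with
  | ret a => exact h
  | op a k ih =>
    rcases h with h | ⟨m, rfl, h⟩
    · exact .inl h
    · refine .inr ⟨n' - 1, by omega, fun w' hle hI => ?_⟩
      obtain ⟨h1, h2, h3⟩ := h w' hle hI
      exact ⟨h1, h2, ih _ h3 (by omega)⟩

theorem staged_bind {Z : Prog V β → World p V → Prop} {P : Prog V α} {f : α → Prog V β}
    (h : wp T i P n (fun a w' => staged T i Z (f a) n' w') w) :
    staged T i Z (P >>= f) (n + n') w := by
  induction P generalizing n w with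
  | ret a => exact staged_weaken (P := f a) h (by omega)
  | op a k ih =>
    obtain ⟨m, rfl, h⟩ := h
    refine .inr ⟨m + n', by omega, fun w' hle hI => ?_⟩
    obtain ⟨h1, h2, h3⟩ := h w' hle hI
    exact ⟨h1, h2, ih _ h3⟩

theorem staged_mono {Z : Prog V α → World p V → Prop} {P : Prog V α} {w' : World p V}
    (h : staged T i Z P n w) (hle : Le T i w w') (hZ : Z P w → Z P w') : staged T i Z P n w' := by
  cases P with
  | ret a => exact hZ h
  | op a k =>
    rcases h with h | ⟨m, rfl, h⟩
    · exact .inl (hZ h)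
    · exact .inr ⟨m, rfl, fun w'' hle' hI => h w'' (hle.trans hle') hI⟩

end Staged

/-- A bound for the number of steps a dequeue takes to find its response once it knows that its
response is not null. -/
def searchSteps (H c qe qd : ℕ) : ℕ := 2 * Nat.clog 2 (qe + qd) + (9 + Nat.clog 2 c) * H + 5

theorem searchSteps_mono {H c c' qe qd : ℕ} (h : c ≤ c') :
    searchSteps H c qe qd ≤ searchSteps H c' qe qd := by
  unfold searchSteps
  gcongr

section Dequeue

variable {T : OTree p} {i : Fin p} {w : World p V} {k : ℕ}

/-- The `k`th operation of process `i` is a dequeue that knows whether its response is null, and if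
not, then `P` finds it. -/
def Resolved (T : OTree p) (i : Fin p) (k : ℕ) (P : Prog V (Option V)) (w : World p V) : Prop :=
  Done T i k false w ∧ (P = .ret none ∨ ∃ e qd qe n,
    Dequeues (linearization T w.mem) (i, k) e qd ∧ EnqueuedAt (linearization T w.mem) e qe ∧
    n ≤ searchSteps T.height w.cmax qe qd ∧
    wp T i P n (fun r w' => Done T i k false w' ∧ ∃ x, r = some x ∧ w'.arg e (.enqueue x)) w)

/-- The part of `findResponse` after the decision that the response is not null. -/
theorem rd_findResponse {m : Memory V} (hm : MInv T m) {l r : OTree p} (hT : T.Sub [] (.node l r))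
    {c : ℕ} (hW : ∀ {v l r b}, T.Sub v (.node l r) → m.ex v (b + 1) → ∀ d,
      m.fld v (b + 1) (.endOf d) ≤ m.fld v b (.endOf d) + c)
    {b j : ℕ} {d : OpId p} (hb : m.ex [] (b + 1))
    (hd : (blockOps false m T [] (b + 1))[j]? = some d)
    (hj : j < m.fld [] b .size + (m.fld [] (b + 1) .sumEnq - m.fld [] b .sumEnq)) :
    ∃ e qd qe, Dequeues (linearization T m) d e qd ∧ EnqueuedAt (linearization T m) e qe ∧
      rd m (do
        let s ← readField [] b .sumEnq
        let z ← readField [] b .size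
        let bₑ ← rootSearch (b + 1) (j + 1 + s - z)
        let s' ← readField [] (bₑ - 1) .sumEnq
        getEnqueue T [] bₑ (j + 1 + s - z - s')) (searchSteps T.height c qe qd)
        (fun r => r.isSome ∧ ∃ u, T.Sub u (.leaf e.1) ∧ 1 ≤ e.2 ∧ m.ex u e.2 ∧ m.elem u e.2 = r) := by
  have hb' := hm.ex_of_le .root hb b.le_succ
  have hle := size_le_sumEnq hm hT hb'
  have hmono := hm.sum_le true .root hb b.le_succ
  have hlen := length_content hm true .root hb
  simp only [cntField] at hmono hlen
  obtain ⟨L₁, L₂, hL, hq⟩ := queueAfter_dequeue hm hT hb hd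
  -- The position among all enqueues of the element to be removed: behind those removed in earlier
  -- blocks and those removed by the `j` preceding dequeues of this block.
  set q := m.fld [] b .sumEnq - m.fld [] b .size + j with hqdef
  have hqlt : q < (content true m T [] (b + 1)).length := by omega
  obtain ⟨e, he⟩ : ∃ e, (content true m T [] (b + 1))[q]? = some e :=
    ⟨_, List.getElem?_eq_getElem hqlt⟩
  -- the block of the enqueue
  obtain ⟨a, hab, ha1, ha2⟩ : ∃ a ≤ b, m.fld [] a .sumEnq ≤ q ∧ q < m.fld [] (a + 1) .sumEnq := by
    have hex : ∃ x, q < m.fld [] x .sumEnq := ⟨b + 1, by omega⟩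
    have h0 : Nat.find hex ≠ 0 := by
      intro h0
      have := Nat.find_spec hex
      rw [h0, hm.zero .root (by simp)] at this
      omega
    have hle : Nat.find hex ≤ b + 1 := Nat.find_le (by omega)
    obtain ⟨a, ha⟩ : ∃ a, Nat.find hex = a + 1 := ⟨Nat.find hex - 1, by omega⟩
    refine ⟨a, by omega, not_lt.1 (Nat.find_min hex (by omega)), ?_⟩
    rw [← ha]
    exact Nat.find_spec hex
  have hexa := hm.ex_of_le .root hb (b' := a + 1) (by omega)
  have hpos : (blockOps true m T [] (a + 1))[q - m.fld [] a .sumEnq]? = some e := by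
    have := getElem?_blockOps_of_flatMap (b := a + 1) hm .root hb (Nat.succ_pos a) (by omega) he
    simp only [hm.zero .root (cntField_ne_super _), Nat.add_sub_cancel, Nat.zero_add,
      Nat.sub_zero] at this
    exact this ha1 ha2
  have hEnq := enqueuedAt_of_blockOps hm hT hexa hpos
  have hdist := block_distance hm hT hb hab ha1 ha2 (by omega) (by omega)
  refine ⟨e, _, _, ⟨L₁, L₂,
    (content true m T [] (b + 1)).drop (q + 1), hL, ?_, rfl⟩, hEnq, ?_⟩
  · rw [hq, List.drop_eq_getElem_cons hqlt]
    rw [List.getElem?_eq_getElem hqlt] at he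
    rw [Option.some.inj he]
  · rw [hq, List.length_drop, hlen]
    have hpow := Nat.le_pow_clog (b := 2) (by norm_num)
      (m.fld [] a .size + (q - m.fld [] a .sumEnq) + 1 + (m.fld [] (b + 1) .sumEnq - q))
    -- Two reads, the search in the root, one more read, and the descent.
    refine rd_weaken (n := (2 * Nat.clog 2 (m.fld [] a .size + (q - m.fld [] a .sumEnq) + 1 +
      (m.fld [] (b + 1) .sumEnq - q)) + 1 + ((9 + Nat.clog 2 c) * T.height + 1 + 1)) + 1 + 1) ?_
      (by unfold searchSteps; omega) fun _ h => h
    refine rd_readField hb' (by simp) (rd_readField hb' (by simp) ?_)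
    have hq1 : j + 1 + m.fld [] b .sumEnq - m.fld [] b .size = q + 1 := by omega
    rw [hq1]
    refine rd_bind (rd_weaken (rd_rootSearch (bₑ := a + 1) hm hb (by omega) (by omega) ha2
      (by simpa using Nat.lt_succ_of_le ha1) (by omega)) le_rfl ?_)
    rintro _ rfl
    refine rd_readField (hm.ex_of_le .root hexa a.le_succ) (by simp) ?_
    have hq2 : q + 1 - m.fld [] a .sumEnq = (q - m.fld [] a .sumEnq) + 1 := by omega
    rw [Nat.add_sub_cancel, hq2]
    refine rd_getEnqueue hm (fun hv hex d => (hW hv hex d).trans ?_) .root (by omega) hexa hpos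
    gcongr
    exact Nat.le_pow_clog (by norm_num) c

/-- The deciding point comes after `append`, one read of the leaf's head, `indexDequeue`, and the
three reads of `findResponse` that precede its test. This gives 9 + 1 + 3 steps, plus 48 + 9 per
level. -/
theorem staged_dequeue (hT : T.Good) (hr : Ready T i k w) (hI : Inv T w)
    (ha : w.arg (i, k) .dequeue) : staged T i (Resolved T i k) (code T i .dequeue)
      (13 + 57 * (T.leafOf i).length) w := by
  have hv := OTree.sub_leafOf (hT.mem i)
  obtain ⟨l, r, hlr⟩ := hT.node
  have hroot : T.Sub [] (.node l r) := hlr ▸ .root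
  refine staged_weaken (n := (9 + 48 * (T.leafOf i).length) +
    (1 + (9 * (T.leafOf i).length + (3 + 0)))) ?_ (by omega)
  -- By reassociation of binds, which holds definitionally here, the part up to the end of `append`
  -- is split off.
  refine staged_bind (P := do
    let sumEnq ← readField (T.leafOf i) ((← readHead (T.leafOf i)) - 1) .sumEnq
    let sumDeq ← readField (T.leafOf i) ((← readHead (T.leafOf i)) - 1) .sumDeq
    append (T.leafOf i) ⟨sumEnq, sumDeq + 1, none, 0, 0, none, 0⟩)
    (f := fun _ => do
      let h ← readHead (T.leafOf i)
      let bi ← indexDequeue (T.leafOf i) (h - 1) 1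
      findResponse T bi.1 bi.2) ?_
  refine wp_readSums_append hT (x := none) (n := 0) hr hI ha
    (B := fun a b => ⟨a, b + 1, none, 0, 0, none, 0⟩) (g := pure) ?_
    (fun a b => (bind_pure_prog _).symm) ?_
  · intro a b
    refine ⟨rfl, rfl, fun e => ?_⟩
    cases e <;> simp [cntField, Block.get]
  intro w₁ hI₁ hd₁
  refine staged_bind (P := readHead (T.leafOf i)) ⟨0, rfl, fun w₂ hle₂ hI₂ => ?_⟩
  simp only [MemOp.exec, hI₂.setMem_self]
  refine ⟨hI₂, fun j _ => Le.refl _ _ _, ?_⟩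
  have hd₂ := hd₁.mono hI₁ hle₂
  show staged T i _ (indexDequeue (T.leafOf i) (w₂.mem.head (T.leafOf i) - 1) 1 >>= fun bi =>
    findResponse T bi.1 bi.2) _ w₂
  rw [hd₂.head_eq hT hI₂]
  have hm₂ := hI₂.minv
  obtain ⟨kr, hkr, hmem⟩ := hd₂.mem
  obtain ⟨hi, h1, u, hu, hexu, hel⟩ := content_sound hm₂ .root (hm₂.ex_lt .root hkr) hmem
  obtain rfl := hu.leaf_eq_leafOf hT.nodup
  have hpos : (blockOps false w₂.mem (.leaf i) (T.leafOf i) k)[0]? = some (i, k) := by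
    rw [blockOps_leaf _ _ hexu, if_pos ⟨h1, hel⟩]
    rfl
  refine staged_bind (wp_weaken (rd_wp (rd_indexDequeue hT hI₂ hkr hmem hv (by simp [OTree.leaves])
    h1 hd₂.lt_head hpos) (MLe.refl _) hI₂) le_rfl ?_)
  rintro ⟨b, x⟩ w₃ ⟨hle₃, hI₃, hb1, hb, j, hx, hpos'⟩
  obtain ⟨b, rfl⟩ : ∃ c, b = c + 1 := ⟨b - 1, by simp at hb1; omega⟩
  simp only at hb hx hpos'
  subst hx
  have hexb := hm₂.ex_lt .root hb
  have hexb' := hm₂.ex_of_le .root hexb b.le_succ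
  have hrd : rd w₂.mem (do
      let a ← readField [] (b + 1) .sumEnq
      let c ← readField [] b .sumEnq
      let z ← readField [] b .size
      pure (a - c, z) : Prog V (ℕ × ℕ)) 3
      (fun y => y = (w₂.mem.fld [] (b + 1) .sumEnq - w₂.mem.fld [] b .sumEnq,
        w₂.mem.fld [] b .size)) :=
    rd_readField hexb (by simp) (rd_readField hexb' (by simp) (rd_readField hexb' (by simp) rfl))
  refine staged_bind (P := do
      let a ← readField [] (b + 1) .sumEnq
      let c ← readField [] b .sumEnq
      let z ← readField [] b .size
      pure (a - c, z)) (f := fun y => if y.2 + y.1 < j + 1 then pure none else do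
        let s ← readField [] b .sumEnq
        let z ← readField [] b .size
        let bₑ ← rootSearch (b + 1) (j + 1 + s - z)
        let s' ← readField [] (bₑ - 1) .sumEnq
        getEnqueue T [] bₑ (j + 1 + s - z - s')) (wp_weaken (rd_wp hrd hle₃.mem hI₃) le_rfl ?_)
  rintro _ w₄ ⟨hle₄, hI₄, rfl⟩
  have hle := hle₃.trans hle₄
  refine staged_of ⟨hd₂.mono hI₂ hle, ?_⟩
  by_cases hc : w₂.mem.fld [] b .size + (w₂.mem.fld [] (b + 1) .sumEnq - w₂.mem.fld [] b .sumEnq) <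
      j + 1
  · left
    simp only [hc, if_true]
    rfl
  · right
    simp only [hc, if_false]
    obtain ⟨e, qd, qe, h1, h2, h3⟩ := rd_findResponse hm₂ hroot hI₂.width hexb hpos' (by omega)
    -- The search is analysed on `w₂.mem`, whose linearization is a prefix of the present one; the
    -- enqueue and both sizes are therefore unchanged.
    obtain ⟨R, hR⟩ := linearization_mono hm₂ hI₄.minv hle.mem
    refine ⟨e, qd, qe, _, hR ▸ h1.append R, hR ▸ h2.append R, searchSteps_mono hle.cmax,
      wp_weaken (rd_wp h3 hle.mem hI₄) le_rfl ?_⟩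
    rintro x w₅ ⟨hle₅, hI₅, hx, u, hu, he1, hexu, rfl⟩
    refine ⟨hd₂.mono hI₂ (hle.trans hle₅), ?_⟩
    obtain ⟨y, hy⟩ := Option.isSome_iff_exists.1 hx
    refine ⟨y, hy, ?_⟩
    have := hI₂.elem hu he1 hexu
    rw [hy] at this
    exact (hle.trans hle₅).arg this

end Dequeue

end WFQueue

namespace WFQueue

variable {p : ℕ} {V : Type}

/-! ## Traces -/

theorem steps_append (tr : List (Event p V)) (ev : Event p V) (o : OpId p) :
    steps (tr ++ [ev]) o = steps tr o + steps [ev] o := List.countP_append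

theorem steps_step (o o' : OpId p) :
    steps [(Event.step o' : Event p V)] o = if o' = o then 1 else 0 := by
  simp only [steps, List.countP_cons, List.countP_nil]
  split_ifs <;> simp_all

@[simp] theorem steps_invoke (o o' : OpId p) (a : QueueOp V) :
    steps [Event.invoke o' a] o = 0 := by simp [steps]

@[simp] theorem steps_respond (o o' : OpId p) (r : Option V) :
    steps [Event.respond o' r] o = 0 := by simp [steps]

/-- What the trace of an execution says about the processes that are running. -/
structure TraceInv (tr : List (Event p V)) (C : Config p V) : Prop where
  fresh : ∀ o, C.invoked o.1 < o.2 →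
    steps tr o = 0 ∧ (∀ a, Event.invoke o a ∉ tr) ∧ ∀ r, Event.respond o r ∉ tr
  running : ∀ i P, C.running i = some P → (∃ a, Event.invoke (i, C.invoked i) a ∈ tr) ∧
    ∀ r, Event.respond (i, C.invoked i) r ∉ tr
  finished : ∀ o a, Event.invoke o a ∈ tr → (C.running o.1 = none ∨ o.2 ≠ C.invoked o.1) →
    ∃ r, Event.respond o r ∈ tr

theorem Execution.traceInv {T : OTree p} {tr : List (Event p V)} {C : Config p V}
    (h : Execution T tr C) : TraceInv tr C := by
  induction h with
  | init => exact ⟨by simp [steps], by simp [Config.init], by simp⟩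
  | invoke tr C i a _ hidle ih =>
    refine ⟨?_, ?_, ?_⟩
    · rintro ⟨j, k⟩ hk
      by_cases hj : j = i
      · subst hj
        simp only [Function.update_self] at hk
        obtain ⟨h1, h2, h3⟩ := ih.fresh (j, k) (by simp only; omega)
        refine ⟨by simp [steps_append, h1], ?_, by simp [h3]⟩
        simp only [List.mem_append, h2, List.mem_singleton, false_or]
        intro b hb
        cases hb
        omega
      · simp only [Function.update_of_ne hj] at hk
        obtain ⟨h1, h2, h3⟩ := ih.fresh (j, k) hk
        exact ⟨by simp [steps_append, h1], by simp [h2, hj], by simp [h3]⟩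
    · intro j P hP
      by_cases hj : j = i
      · subst hj
        simp only [Function.update_self]
        refine ⟨⟨a, by simp⟩, ?_⟩
        have := (ih.fresh (j, C.invoked j + 1) (Nat.lt_succ_self _)).2.2
        simpa using this
      · simp only [Function.update_of_ne hj] at hP ⊢
        obtain ⟨⟨b, hb⟩, h2⟩ := ih.running j P hP
        exact ⟨⟨b, by simp [hb]⟩, by simpa using h2⟩
    · rintro ⟨j, k⟩ b hb hor
      by_cases hj : j = i
      · subst hj
        simp only [Function.update_self, reduceCtorEq, false_or] at hor
        simp only [List.mem_append, List.mem_singleton, Event.invoke.injEq, Prod.mk.injEq,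
          true_and] at hb
        rcases hb with hb | hb
        · obtain ⟨r, hr⟩ := ih.finished _ _ hb (.inl hidle)
          exact ⟨r, by simp [hr]⟩
        · exact absurd hb.1 hor
      · simp only [Function.update_of_ne hj] at hor
        have hb' : Event.invoke (j, k) b ∈ tr := by simpa [hj] using hb
        obtain ⟨r, hr⟩ := ih.finished _ _ hb' hor
        exact ⟨r, by simp [hr]⟩
  | step tr C i a k _ hrun ih =>
    refine ⟨?_, ?_, ?_⟩
    · intro o ho
      obtain ⟨h1, h2, h3⟩ := ih.fresh o ho
      refine ⟨?_, by simp [h2], by simp [h3]⟩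
      rw [steps_append, steps_step, h1, if_neg]
      rintro rfl
      simp at ho
    · intro j P hP
      have : ∃ P', C.running j = some P' := by
        by_cases hj : j = i
        · subst hj; exact ⟨_, hrun⟩
        · exact ⟨P, by simpa [Function.update_of_ne hj] using hP⟩
      obtain ⟨P', hP'⟩ := this
      obtain ⟨⟨b, hb⟩, h2⟩ := ih.running j P' hP'
      exact ⟨⟨b, by simp [hb]⟩, by simpa using h2⟩
    · rintro ⟨j, n⟩ b hb hor
      have hb' : Event.invoke (j, n) b ∈ tr := by simpa using hb
      have : C.running j = none ∨ n ≠ C.invoked j := by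
        refine hor.imp_left fun h => ?_
        by_cases hj : j = i
        · subst hj; simp at h
        · simpa [Function.update_of_ne hj] using h
      obtain ⟨r, hr⟩ := ih.finished _ _ hb' this
      exact ⟨r, by simp [hr]⟩
  | respond tr C i r _ hrun ih =>
    refine ⟨?_, ?_, ?_⟩
    · intro o ho
      obtain ⟨h1, h2, h3⟩ := ih.fresh o ho
      refine ⟨by simp [steps_append, h1], by simp [h2], ?_⟩
      simp only [List.mem_append, h3, List.mem_singleton, false_or]
      intro r' hr'
      cases hr'
      simp at ho
    · intro j P hP
      by_cases hj : j = i
      · subst hj; simp at hP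
      · simp only [Function.update_of_ne hj] at hP
        obtain ⟨⟨b, hb⟩, h2⟩ := ih.running j P hP
        exact ⟨⟨b, by simp [hb]⟩, by simpa [hj] using h2⟩
    · rintro ⟨j, n⟩ b hb hor
      have hb' : Event.invoke (j, n) b ∈ tr := by simpa using hb
      by_cases hc : C.running j = none ∨ n ≠ C.invoked j
      · obtain ⟨r', hr'⟩ := ih.finished _ _ hb' hc
        exact ⟨r', by simp [hr']⟩
      · push Not at hc
        obtain ⟨hc1, rfl⟩ := hc
        by_cases hj : j = i
        · subst hj; exact ⟨r, by simp⟩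
        · simp [Function.update_of_ne hj, hc1] at hor

/-- A pending operation is the last one of a running process, and every running process has one. -/
theorem TraceInv.pointContention_eq {tr : List (Event p V)} {C : Config p V}
    (h : TraceInv tr C) : pointContention tr =
      (Finset.univ.filter fun i => (C.running i).isSome = true).card := by
  have hinj : Function.Injective fun i : Fin p => (i, C.invoked i) :=
    fun i j hij => (Prod.mk.inj hij).1
  rw [← Finset.card_image_of_injective _ hinj, ← Set.ncard_coe_finset, pointContention]
  congr 1
  ext ⟨i, k⟩
  simp only [Set.mem_ofPred_eq, Finset.coe_image, Finset.coe_filter, Finset.mem_univ, true_and,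
    Set.mem_image, Prod.mk.injEq]
  constructor
  · rintro ⟨⟨a, ha⟩, hr⟩
    by_contra hcon
    have : C.running i = none ∨ k ≠ C.invoked i := by
      by_contra hc
      push Not at hc
      exact hcon ⟨i, Option.isSome_iff_ne_none.2 hc.1, rfl, hc.2.symm⟩
    obtain ⟨r, hr'⟩ := h.finished _ _ ha this
    exact hr r hr'
  · rintro ⟨j, hj, rfl, rfl⟩
    obtain ⟨P, hP⟩ := Option.isSome_iff_exists.1 hj
    exact h.running _ P hP

theorem pointContention_le_maxContention (tr : List (Event p V)) :
    pointContention tr ≤ maxContention tr := by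
  have := Finset.le_sup (f := fun n => pointContention (tr.take n))
    (Finset.mem_range.2 (Nat.lt_succ_self tr.length))
  simpa [maxContention] using this

theorem maxContention_append (tr : List (Event p V)) (ev : Event p V) :
    maxContention (tr ++ [ev]) = max (maxContention tr) (pointContention (tr ++ [ev])) := by
  unfold maxContention
  rw [List.length_append, List.length_singleton, Finset.range_add_one, Finset.sup_insert, max_comm]
  congr 1
  · refine Finset.sup_congr rfl fun n hn => ?_
    rw [List.take_append_of_le_length (by simpa [Nat.lt_succ_iff] using hn)]
  · rw [List.take_of_length_le (by simp)]

theorem Execution.maxContention_le {T : OTree p} {tr : List (Event p V)} {C : Config p V}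
    (h : Execution T tr C) : maxContention tr ≤ p := by
  have key : ∀ {tr : List (Event p V)} {C : Config p V}, Execution T tr C →
      pointContention tr ≤ p := by
    intro tr C h
    rw [h.traceInv.pointContention_eq]
    exact (Finset.card_le_univ _).trans (by simp)
  have hall := key h
  induction h with
  | init => simpa [maxContention] using hall
  | invoke tr C i a hE hidle ih =>
    rw [maxContention_append]
    exact max_le (ih (key hE)) hall
  | step tr C i a k hE hrun ih =>
    rw [maxContention_append]
    exact max_le (ih (key hE)) hall
  | respond tr C i r hE hrun ih =>
    rw [maxContention_append]
    exact max_le (ih (key hE)) hall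

end WFQueue

namespace WFQueue

variable {p : ℕ} {V : Type}

/-! ## The running and the finished operations of an execution -/

section Counters

variable {T : OTree p} {w : World p V} {inv : Fin p → ℕ} {run : Fin p → Bool}
  {arg : OpId p → QueueOp V → Prop} {c : ℕ}

/-- The clauses about blocks do not depend on the counters or are monotone in them; only `done` and
`contention` have to be supplied anew. -/
theorem Inv.of_counters (h : Inv T w) (hinv : ∀ j, w.invoked j ≤ inv j)
    (harg : ∀ {o a}, w.arg o a → arg o a) (hc : w.cmax ≤ c)
    (hdone : ∀ {i b}, 1 ≤ b → b ≤ inv i → (run i = true → b < inv i) →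
      ∃ e, ∃ k < w.mem.head [], (i, b) ∈ content e w.mem T [] k)
    (hcont : (Finset.univ.filter fun i => run i = true).card ≤ c) :
    Inv T ⟨w.mem, w.past, inv, run, arg, c⟩ where
  past_inv := h.past_inv
  past_le := h.past_le
  mem_past := h.mem_past
  snap := h.snap
  sup := h.sup
  width hv hb d := (h.width hv hb d).trans (by simpa using hc)
  owner hv hb := (h.owner hv hb).trans (hinv _)
  elem hv h1 hb := harg (h.elem hv h1 hb)
  done := hdone
  contention := hcont

theorem Le.of_counters {j : Fin p} (hinv : inv j = w.invoked j) (hrun : run j = w.run j)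
    (harg : ∀ {o a}, w.arg o a → arg o a) (hc : w.cmax ≤ c) :
    Le T j w ⟨w.mem, w.past, inv, run, arg, c⟩ where
  mem := MLe.refl _
  past := subset_rfl
  fresh _ h := .inl h
  cmax := hc
  invoked := hinv
  run := hrun
  own h := h
  arg := harg

end Counters

/-! ### Invariants of the initial memory -/

section Init

theorem Memory.init_ex {v : Node} {b : ℕ} : (Memory.init V).ex v b ↔ b = 0 := by
  by_cases hb : b = 0 <;> simp [Memory.ex, Memory.init, hb]

theorem Memory.init_fld {v : Node} {b : ℕ} {f : Field} : (Memory.init V).fld v b f = 0 := by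
  by_cases hb : b = 0
  · subst hb
    rcases f with _ | _ | _ | (_ | _) | _ <;> rfl
  · simp [Memory.fld, Memory.init, hb]

theorem Memory.init_sup {v : Node} {b : ℕ} : (Memory.init V).sup v b = none := by
  by_cases hb : b = 0 <;> simp [Memory.sup, Memory.init, hb, Block.empty]

theorem MInv.init (T : OTree p) : MInv T (Memory.init V) where
  head_pos _ := le_rfl
  ex_lt _ h := Memory.init_ex.2 (Nat.lt_one_iff.1 h)
  le_head _ h := by rw [Memory.init_ex.1 h]; exact Nat.zero_le _
  zero _ _ := Memory.init_fld
  leaf _ h := absurd (Memory.init_ex.1 h) (Nat.succ_ne_zero _)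
  end_mono _ h := absurd (Memory.init_ex.1 h) (Nat.succ_ne_zero _)
  end_lt _ _ _ := by rw [Memory.init_fld]; exact Nat.one_pos
  sum _ _ _ := by simp only [Memory.init_fld]
  strict _ h := absurd (Memory.init_ex.1 h) (Nat.succ_ne_zero _)
  size _ h := absurd (Memory.init_ex.1 h) (Nat.succ_ne_zero _)
  sup _ h h' := absurd (Nat.lt_one_iff.1 h') (by omega)

/-- The initial state. -/
def World.init (p : ℕ) (V : Type) : World p V :=
  ⟨Memory.init V, {Memory.init V}, fun _ => 0, fun _ => false, fun _ _ => False, 0⟩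

theorem Inv.init (T : OTree p) : Inv T (World.init p V) where
  past_inv := by rintro _ rfl; exact MInv.init T
  past_le := by rintro _ rfl; exact MLe.refl _
  mem_past := rfl
  snap {v l r b d b' m} _ hb hm hlt _ := by
    cases hm
    cases Memory.init_ex.1 hb
    exact absurd hlt (Nat.not_lt_zero _)
  sup {d v t b x} _ h := by
    have : (Memory.init V).sup (d :: v) b = some x := h
    simp [Memory.init_sup] at this
  width _ h := absurd (Memory.init_ex.1 h) (Nat.succ_ne_zero _)
  owner _ h := by rw [Memory.init_ex.1 h]; exact Nat.zero_le _
  elem _ h1 h := absurd (Memory.init_ex.1 h) (by omega)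
  done h1 h2 := absurd (h1.trans h2) (Nat.not_succ_le_zero 0)
  contention := by simp [World.init]

end Init

/-! ### Progress of a single operation -/

section Ops

variable {T : OTree p} {w w' : World p V} {i : Fin p} {k s : ℕ}

/-- In the linearization, the dequeue `d` removes the element of the enqueue `e` from a queue of
size `qd`, and `e` produces a queue of size `qe`. -/
def Removes (T : OTree p) (m : Memory V) (d e : OpId p) (qd qe : ℕ) : Prop :=
  Dequeues (linearization T m) d e qd ∧ EnqueuedAt (linearization T m) e qe

theorem Removes.mono {m m' : Memory V} {d e : OpId p} {qd qe : ℕ} (h : Removes T m d e qd qe)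
    (hm : MInv T m) (hm' : MInv T m') (hle : MLe m m') : Removes T m' d e qd qe := by
  obtain ⟨R, hR⟩ := linearization_mono hm hm' hle
  rw [Removes, hR]
  exact ⟨h.1.append _, h.2.append _⟩

/-- A bound for the number of steps of an enqueue, and of a dequeue until it knows whether its
response is null. -/
def opSteps (T : OTree p) : ℕ := 13 + 57 * T.height

/-- A dequeue that has a response different from null to find can do so with `P`. -/
def Searching (T : OTree p) (i : Fin p) (k : ℕ) (P : Prog V (Option V)) (s : ℕ) (w : World p V) :
    Prop :=
  ∃ e qd qe n, Removes T w.mem (i, k) e qd qe ∧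
    s + n ≤ opSteps T + searchSteps T.height w.cmax qe qd ∧
    wp T i P n (fun r w' => Done T i k false w' ∧ ∃ x, r = some x ∧ w'.arg e (.enqueue x)) w

/-- The `k`th operation of process `i`, which has taken `s` steps, runs correctly. -/
def Runs (T : OTree p) (i : Fin p) (k : ℕ) (P : Prog V (Option V)) (s : ℕ) (w : World p V) :
    QueueOp V → Prop
  | .enqueue _ => ∃ n, s + n ≤ opSteps T ∧ wp T i P n (fun _ w' => Done T i k true w') w
  | .dequeue => (∃ n, s + n ≤ opSteps T ∧ staged T i (Resolved T i k) P n w) ∨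
      Searching T i k P s w

/-- The operation `o` has responded `r` after `s` steps, correctly. -/
def Responded (T : OTree p) (o : OpId p) (r : Option V) (s : ℕ) (w : World p V) :
    QueueOp V → Prop
  | .enqueue _ => s ≤ opSteps T
  | .dequeue => (r = none ∧ s ≤ opSteps T) ∨ ∃ x e qd qe, r = some x ∧
      Removes T w.mem o e qd qe ∧ w.arg e (.enqueue x) ∧
      s ≤ opSteps T + searchSteps T.height w.cmax qe qd

/-- A program with an instruction left is not `.ret none`, so a resolved dequeue that still runs is
non-null. -/
theorem Resolved.searching {a : MemOp V} {f : a.Resp → Prog V (Option V)} (hs : s ≤ opSteps T)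
    (h : Resolved T i k (.op a f) w) : Searching T i k (.op a f) s w := by
  obtain ⟨-, h | ⟨e, qd, qe, n, h1, h2, h3, h4⟩⟩ := h
  · cases h
  · exact ⟨e, qd, qe, n, ⟨h1, h2⟩, add_le_add hs h3, h4⟩

theorem Searching.mono {P : Prog V (Option V)} (h : Searching T i k P s w) (hI : Inv T w)
    (hI' : Inv T w') (hle : Le T i w w') : Searching T i k P s w' := by
  obtain ⟨e, qd, qe, n, h1, h2, h3⟩ := h
  refine ⟨e, qd, qe, n, h1.mono hI.minv hI'.minv hle.mem,
    h2.trans (Nat.add_le_add_left (searchSteps_mono hle.cmax) _), wp_mono h3 hle ?_⟩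
  rintro r ⟨hd, x, hx, ha⟩
  exact ⟨hd.mono hI hle, x, hx, hle.arg ha⟩

theorem Resolved.mono {P : Prog V (Option V)} (h : Resolved T i k P w) (hI : Inv T w)
    (hI' : Inv T w') (hle : Le T i w w') : Resolved T i k P w' := by
  refine ⟨h.1.mono hI hle, h.2.imp_right ?_⟩
  rintro ⟨e, qd, qe, n, h1, h2, h3, h4⟩
  obtain ⟨h1', h2'⟩ := Removes.mono ⟨h1, h2⟩ hI.minv hI'.minv hle.mem
  refine ⟨e, qd, qe, n, h1', h2', h3.trans (searchSteps_mono hle.cmax), wp_mono h4 hle ?_⟩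
  rintro r ⟨hd, x, hx, ha⟩
  exact ⟨hd.mono hI hle, x, hx, hle.arg ha⟩

theorem Runs.mono {P : Prog V (Option V)} {a : QueueOp V} (h : Runs T i k P s w a)
    (hI : Inv T w) (hI' : Inv T w') (hle : Le T i w w') : Runs T i k P s w' a := by
  cases a with
  | enqueue x =>
    obtain ⟨n, hn, h⟩ := h
    exact ⟨n, hn, wp_mono h hle fun _ hd => hd.mono hI hle⟩
  | dequeue =>
    refine h.imp ?_ fun h => h.mono hI hI' hle
    rintro ⟨n, hn, h⟩
    exact ⟨n, hn, staged_mono h hle fun h => h.mono hI hI' hle⟩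

theorem Responded.mono {o : OpId p} {r : Option V} {a : QueueOp V} (h : Responded T o r s w a)
    (hI : Inv T w) (hI' : Inv T w') (hle : MLe w.mem w'.mem) (hc : w.cmax ≤ w'.cmax)
    (harg : ∀ {o a}, w.arg o a → w'.arg o a) : Responded T o r s w' a := by
  cases a with
  | enqueue x => exact h
  | dequeue =>
    refine h.imp_right ?_
    rintro ⟨x, e, qd, qe, hx, h1, h2, h3⟩
    exact ⟨x, e, qd, qe, hx, h1.mono hI.minv hI'.minv hle, harg h2,
      h3.trans (Nat.add_le_add_left (searchSteps_mono hc) _)⟩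

theorem Searching.step {a : MemOp V} {f : a.Resp → Prog V (Option V)}
    (h : Searching T i k (.op a f) s w) (hI : Inv T w) :
    Inv T (w.setMem (a.exec w.mem).2) ∧
    (∀ j, j ≠ i → Le T j w (w.setMem (a.exec w.mem).2)) ∧
    Searching T i k (f (a.exec w.mem).1) (s + 1) (w.setMem (a.exec w.mem).2) := by
  obtain ⟨e, qd, qe, n, h1, h2, n', rfl, h3⟩ := h
  obtain ⟨h4, h5, h6⟩ := h3 w (Le.refl _ _ _) hI
  refine ⟨h4, h5, e, qd, qe, n', h1.mono hI.minv h4.minv ?_, by simp only [World.setMem]; omega, h6⟩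
  exact h4.past_le _ (.inr hI.mem_past)

/-- `wp` and `staged` allow for interference before the instruction; here they are used with none.
Steps of other processes are absorbed by `Runs.mono`. -/
theorem Runs.step {a : MemOp V} {f : a.Resp → Prog V (Option V)} {q : QueueOp V}
    (h : Runs T i k (.op a f) s w q) (hI : Inv T w) :
    Inv T (w.setMem (a.exec w.mem).2) ∧
    (∀ j, j ≠ i → Le T j w (w.setMem (a.exec w.mem).2)) ∧
    Runs T i k (f (a.exec w.mem).1) (s + 1) (w.setMem (a.exec w.mem).2) q := by
  cases q with
  | enqueue x =>
    obtain ⟨n, hn, n', rfl, h⟩ := h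
    obtain ⟨h4, h5, h6⟩ := h w (Le.refl _ _ _) hI
    exact ⟨h4, h5, n', by omega, h6⟩
  | dequeue =>
    rcases h with ⟨n, hn, h | ⟨n', rfl, h⟩⟩ | h
    · obtain ⟨h4, h5, h6⟩ := (h.searching (s := s) (by omega)).step hI
      exact ⟨h4, h5, .inr h6⟩
    · obtain ⟨h4, h5, h6⟩ := h w (Le.refl _ _ _) hI
      exact ⟨h4, h5, .inl ⟨n', by omega, h6⟩⟩
    · obtain ⟨h4, h5, h6⟩ := h.step hI
      exact ⟨h4, h5, .inr h6⟩

theorem Runs.ret {r : Option V} {q : QueueOp V} (h : Runs T i k (.ret r) s w q) :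
    (∃ e, Done T i k e w) ∧ Responded T (i, k) r s w q := by
  cases q with
  | enqueue x =>
    obtain ⟨n, hn, h⟩ := h
    exact ⟨⟨_, h⟩, show s ≤ _ by omega⟩
  | dequeue =>
    rcases h with ⟨n, hn, hd, h | ⟨e, qd, qe, n', h1, h2, h3, h4, x, hx, ha⟩⟩ |
      ⟨e, qd, qe, n, h1, h2, hd, x, hx, ha⟩
    · cases h
      exact ⟨⟨_, hd⟩, .inl ⟨rfl, by omega⟩⟩
    · exact ⟨⟨_, hd⟩, .inr ⟨x, e, qd, qe, hx, ⟨h1, h2⟩, ha, by omega⟩⟩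
    · exact ⟨⟨_, hd⟩, .inr ⟨x, e, qd, qe, hx, h1, ha, by omega⟩⟩

theorem Runs.of_code (hT : T.Good) (hr : Ready T i k w) (hI : Inv T w) {q : QueueOp V}
    (ha : w.arg (i, k) q) : Runs T i k (code T i q) 0 w q := by
  have hl := T.length_leafOf i
  cases q with
  | enqueue x =>
    exact ⟨_, by rw [opSteps]; omega, wp_weaken (wp_enqueue hT hr hI ha) le_rfl fun _ _ h => h.2⟩
  | dequeue => exact .inl ⟨_, by rw [opSteps]; omega, staged_dequeue hT hr hI ha⟩

end Ops

/-! ## Executions -/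

/-- The state `w` describes the configuration `C` reached by the trace `tr`. -/
structure Describes (T : OTree p) (tr : List (Event p V)) (C : Config p V) (w : World p V) :
    Prop where
  inv : Inv T w
  mem : w.mem = C.mem
  invoked : w.invoked = C.invoked
  run : ∀ i, w.run i = (C.running i).isSome
  arg : ∀ o a, w.arg o a ↔ Event.invoke o a ∈ tr
  cmax : w.cmax = maxContention tr
  idle : ∀ i, C.running i = none → C.invoked i < C.mem.head (T.leafOf i)
  running : ∀ i P a, C.running i = some P → Event.invoke (i, C.invoked i) a ∈ tr →
    Runs T i (C.invoked i) P (steps tr (i, C.invoked i)) w a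
  finished : ∀ o a r, Event.invoke o a ∈ tr → Event.respond o r ∈ tr →
    Responded T o r (steps tr o) w a

theorem TraceInv.card_le {tr : List (Event p V)} {C : Config p V} (h : TraceInv tr C) :
    (Finset.univ.filter fun i => (C.running i).isSome = true).card ≤ maxContention tr :=
  h.pointContention_eq ▸ pointContention_le_maxContention tr

theorem Describes.init (T : OTree p) :
    Describes T [] (Config.init p V) (World.init p V) where
  inv := Inv.init T
  mem := rfl
  invoked := rfl
  run _ := rfl
  arg _ _ := by simp [World.init]
  cmax := by simp [World.init, maxContention, pointContention]
  idle _ _ := Nat.one_pos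
  running _ _ _ h := by cases h
  finished _ _ _ h := by cases h

section Describes

variable {T : OTree p} {tr : List (Event p V)} {C : Config p V} {w : World p V} {i : Fin p}

/-- The state `w` with its counters as in the configuration `C` reached by the trace `tr`. -/
noncomputable def World.count (w : World p V) (tr : List (Event p V)) (C : Config p V) : World p V :=
  ⟨w.mem, w.past, C.invoked, fun j => (C.running j).isSome, fun o a => Event.invoke o a ∈ tr,
    maxContention tr⟩

theorem Describes.arg_append (h : Describes T tr C w) (ev : Event p V) {o : OpId p}
    {a : QueueOp V} (ha : w.arg o a) : Event.invoke o a ∈ tr ++ [ev] :=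
  List.mem_append_left _ ((h.arg o a).1 ha)

theorem Describes.cmax_append (h : Describes T tr C w) (ev : Event p V) :
    w.cmax ≤ maxContention (tr ++ [ev]) := by
  rw [h.cmax, maxContention_append]; exact le_max_left _ _

theorem Describes.le_count (h : Describes T tr C w) (ev : Event p V) {C' : Config p V} {j : Fin p}
    (hinv : C'.invoked j = C.invoked j) (hrun : (C'.running j).isSome = (C.running j).isSome) :
    Le T j w (w.count (tr ++ [ev]) C') :=
  Le.of_counters (hinv.trans (congrFun h.invoked j).symm) (hrun.trans (h.run j).symm)
    (h.arg_append ev) (h.cmax_append ev)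

theorem Describes.inv_count (h : Describes T tr C w) (ev : Event p V) {C' : Config p V}
    (ht' : TraceInv (tr ++ [ev]) C') (hinv : ∀ j, C.invoked j ≤ C'.invoked j)
    (hdone : ∀ {i b}, 1 ≤ b → b ≤ C'.invoked i → ((C'.running i).isSome = true → b < C'.invoked i) →
      ∃ e, ∃ k < w.mem.head [], (i, b) ∈ content e w.mem T [] k) :
    Inv T (w.count (tr ++ [ev]) C') :=
  h.inv.of_counters (h.invoked ▸ hinv) (h.arg_append ev) (h.cmax_append ev) hdone ht'.card_le

theorem Describes.done (h : Describes T tr C w) {b : ℕ} (h1 : 1 ≤ b) (h2 : b ≤ C.invoked i)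
    (h3 : (C.running i).isSome = true → b < C.invoked i) :
    ∃ e, ∃ k < w.mem.head [], (i, b) ∈ content e w.mem T [] k :=
  h.inv.done h1 (h.invoked ▸ h2) (by rw [h.run, h.invoked]; exact h3)

theorem Describes.responded_count (h : Describes T tr C w) (ev : Event p V) {C' : Config p V}
    (hI' : Inv T (w.count (tr ++ [ev]) C')) {o : OpId p} {a : QueueOp V} {r : Option V}
    (ha : Event.invoke o a ∈ tr) (hr : Event.respond o r ∈ tr) :
    Responded T o r (steps tr o) (w.count (tr ++ [ev]) C') a :=
  (h.finished o a r ha hr).mono h.inv hI' (MLe.refl _) (h.cmax_append ev) (h.arg_append ev)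

/-- The leaf has no block beyond the number of invoked operations, and for an idle process its head
has passed the last of them. -/
theorem Describes.ready (hT : T.Good) (h : Describes T tr C w) (hidle : C.running i = none) :
    ¬ w.mem.ex (T.leafOf i) (C.invoked i + 1) ∧ w.mem.head (T.leafOf i) = C.invoked i + 1 := by
  have hv := OTree.sub_leafOf (hT.mem i)
  have hex : ¬ w.mem.ex (T.leafOf i) (C.invoked i + 1) := fun hex => by
    have := h.inv.owner hv hex
    rw [h.invoked] at this
    omega
  refine ⟨hex, le_antisymm (not_lt.1 fun hlt => hex (h.inv.minv.ex_lt hv hlt)) ?_⟩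
  rw [h.mem]
  exact h.idle i hidle

/-- The preceding operation of the process now has to count as finished, and it does because the
process was idle. -/
theorem Describes.invoke (hT : T.Good) (h : Describes T tr C w) (ht : TraceInv tr C)
    {a : QueueOp V} {C' : Config p V} (hidle : C.running i = none)
    (hC' : C' = ⟨C.mem, Function.update C.running i (some (code T i a)),
      Function.update C.invoked i (C.invoked i + 1)⟩)
    (ht' : TraceInv (tr ++ [.invoke (i, C.invoked i + 1) a]) C') :
    Describes T (tr ++ [.invoke (i, C.invoked i + 1) a]) C'
      (w.count (tr ++ [.invoke (i, C.invoked i + 1) a]) C') := by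
  have hi : C'.invoked i = C.invoked i + 1 := by simp [hC']
  have hri : C'.running i = some (code T i a) := by simp [hC']
  have hj : ∀ j, j ≠ i → C'.invoked j = C.invoked j ∧ C'.running j = C.running j :=
    fun j hj => by simp [hC', hj]
  have hfresh := ht.fresh (i, C.invoked i + 1) (Nat.lt_succ_self _)
  have hI' : Inv T (w.count (tr ++ [.invoke (i, C.invoked i + 1) a]) C') := by
    refine h.inv_count _ ht' (fun j => ?_) fun {j b} h1 h2 h3 => ?_
    · by_cases hji : j = i
      · subst hji; omega
      · rw [(hj j hji).1]
    · by_cases hji : j = i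
      · subst hji
        have := h3 (by rw [hri]; rfl)
        exact h.done h1 (by omega) (by simp [hidle])
      · rw [(hj j hji).1] at h2 h3
        rw [(hj j hji).2] at h3
        exact h.done h1 h2 h3
  refine ⟨hI', by rw [hC']; exact h.mem, rfl, fun _ => rfl, fun _ _ => Iff.rfl, rfl, ?_, ?_, ?_⟩
  · intro j hjr
    by_cases hji : j = i
    · subst hji; simp [hri] at hjr
    · rw [(hj j hji).2] at hjr
      rw [(hj j hji).1, hC']
      exact h.idle j hjr
  · intro j P b hP hb
    rw [steps_append, steps_invoke, add_zero]
    by_cases hji : j = i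
    · subst hji
      rw [hri] at hP
      cases hP
      have hab : b = a := by simpa [hi, hfresh.2.1] using hb
      subst hab
      rw [hi, hfresh.1]
      obtain ⟨h1, h2⟩ := h.ready hT hidle
      have hr : Ready T j (C.invoked j + 1)
          (w.count (tr ++ [.invoke (j, C.invoked j + 1) b]) C') := ⟨hi, h1, h2⟩
      exact Runs.of_code hT hr hI' (by rw [hi] at hb; exact hb)
    · rw [(hj j hji).1] at hb ⊢
      rw [(hj j hji).2] at hP
      refine (h.running j P b hP (by simpa [hji] using hb)).mono h.inv hI' ?_
      exact h.le_count _ (hj j hji).1 (by rw [(hj j hji).2])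
  · intro o b r hb hr
    rw [steps_append, steps_invoke, add_zero]
    have hr : Event.respond o r ∈ tr := by simpa using hr
    have hb : Event.invoke o b ∈ tr := by
      rcases List.mem_append.1 hb with hb | hb
      · exact hb
      · cases List.mem_singleton.1 hb
        exact absurd hr (hfresh.2.2 r)
    exact h.responded_count _ hI' hb hr

/-- The ghost counters are first moved to the new trace, then the instruction is executed. For every
other process both changes are interference permitted by `Le`. -/
theorem Describes.step (h : Describes T tr C w) (ht : TraceInv tr C) {a : MemOp V}
    {f : a.Resp → Prog V (Option V)} {C' : Config p V} (hrun : C.running i = some (.op a f))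
    (hC' : C' = ⟨(a.exec C.mem).2, Function.update C.running i (some (f (a.exec C.mem).1)),
      C.invoked⟩)
    (ht' : TraceInv (tr ++ [.step (i, C.invoked i)]) C') :
    Describes T (tr ++ [.step (i, C.invoked i)]) C'
      ((w.count (tr ++ [.step (i, C.invoked i)]) C').setMem (a.exec w.mem).2) := by
  have hinv : ∀ j, C'.invoked j = C.invoked j := fun j => by rw [hC']
  have hri : C'.running i = some (f (a.exec C.mem).1) := by simp [hC']
  have hj : ∀ j, j ≠ i → C'.running j = C.running j := fun j hj => by simp [hC', hj]
  have hsome : ∀ j, (C'.running j).isSome = (C.running j).isSome := by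
    intro j
    by_cases hji : j = i
    · subst hji; rw [hri, hrun]; rfl
    · rw [hj j hji]
  have hmem : C'.mem = (a.exec w.mem).2 := by rw [hC', h.mem]
  have hI₁ : Inv T (w.count (tr ++ [.step (i, C.invoked i)]) C') := by
    refine h.inv_count _ ht' (fun j => (hinv j).ge) fun {j b} h1 h2 h3 => ?_
    rw [hinv] at h2 h3
    rw [hsome] at h3
    exact h.done h1 h2 h3
  have hle : ∀ j, Le T j w (w.count (tr ++ [.step (i, C.invoked i)]) C') :=
    fun j => h.le_count _ (hinv j) (hsome j)
  obtain ⟨⟨b, hb⟩, hnr⟩ := ht.running i _ hrun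
  have key : ∀ b, Event.invoke (i, C.invoked i) b ∈ tr → _ := fun b hb =>
    ((h.running i _ b hrun hb).mono h.inv hI₁ (hle i)).step hI₁
  obtain ⟨hI', hle', -⟩ := key b hb
  have hmle : MLe w.mem (a.exec w.mem).2 := hI'.past_le _ (.inr hI₁.mem_past)
  refine ⟨hI', hmem.symm, rfl, fun _ => rfl, fun _ _ => Iff.rfl, rfl, ?_, ?_, ?_⟩
  · intro j hjr
    have hjr' : C.running j = none := by
      rw [← Option.not_isSome_iff_eq_none] at hjr ⊢
      rwa [← hsome]
    rw [hinv, hmem]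
    exact (h.mem ▸ h.idle j hjr').trans_le (hmle.head _)
  · intro j P c hP hc
    have hc' : Event.invoke (j, C.invoked j) c ∈ tr := by simpa [hinv] using hc
    rw [hinv, steps_append, steps_step]
    by_cases hji : j = i
    · subst hji
      rw [hri] at hP
      cases hP
      rw [if_pos rfl, ← h.mem]
      exact (key c hc').2.2
    · rw [if_neg (by simp [Ne.symm hji]), add_zero]
      rw [hj j hji] at hP
      exact (h.running j P c hP hc').mono h.inv hI' ((hle j).trans (hle' j hji))
  · intro o c r hc hr
    have hc : Event.invoke o c ∈ tr := by simpa using hc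
    have hr : Event.respond o r ∈ tr := by simpa using hr
    rw [steps_append, steps_step, if_neg (by rintro rfl; exact hnr r hr), add_zero]
    exact (h.responded_count _ hI₁ hc hr).mono hI₁ hI' hmle le_rfl fun h => h

/-- By `Runs.ret` the responding operation has been propagated to the root, which `done` requires
from now on. -/
theorem Describes.respond (h : Describes T tr C w) (ht : TraceInv tr C) {r : Option V}
    {C' : Config p V} (hrun : C.running i = some (.ret r))
    (hC' : C' = ⟨C.mem, Function.update C.running i none, C.invoked⟩)
    (ht' : TraceInv (tr ++ [.respond (i, C.invoked i) r]) C') :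
    Describes T (tr ++ [.respond (i, C.invoked i) r]) C'
      (w.count (tr ++ [.respond (i, C.invoked i) r]) C') := by
  have hinv : ∀ j, C'.invoked j = C.invoked j := fun j => by rw [hC']
  have hri : C'.running i = none := by simp [hC']
  have hj : ∀ j, j ≠ i → C'.running j = C.running j := fun j hj => by simp [hC', hj]
  obtain ⟨⟨a, ha⟩, hnr⟩ := ht.running i _ hrun
  obtain ⟨⟨e, hd⟩, -⟩ := (h.running i _ a hrun ha).ret
  have hI' : Inv T (w.count (tr ++ [.respond (i, C.invoked i) r]) C') := by
    refine h.inv_count _ ht' (fun j => (hinv j).ge) fun {j b} h1 h2 h3 => ?_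
    rw [hinv] at h2 h3
    by_cases hji : j = i
    · subst hji
      rcases h2.lt_or_eq with hlt | rfl
      · exact h.done h1 h2 fun _ => hlt
      · obtain ⟨k, hk, hm⟩ := hd.mem
        exact ⟨e, k, hk, hm⟩
    · rw [hj j hji] at h3
      exact h.done h1 h2 h3
  refine ⟨hI', by rw [hC']; exact h.mem, rfl, fun _ => rfl, fun _ _ => Iff.rfl, rfl, ?_, ?_, ?_⟩
  · intro j hjr
    rw [hinv, show C'.mem = C.mem by rw [hC']]
    by_cases hji : j = i
    · subst hji
      exact h.mem ▸ hd.lt_head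
    · exact h.idle j (hj j hji ▸ hjr)
  · intro j P c hP hc
    have hji : j ≠ i := by rintro rfl; simp [hri] at hP
    rw [hj j hji] at hP
    have hc : Event.invoke (j, C.invoked j) c ∈ tr := by simpa [hinv] using hc
    rw [hinv, steps_append, steps_respond, add_zero]
    exact (h.running j P c hP hc).mono h.inv hI' (h.le_count _ (hinv j) (by rw [hj j hji]))
  · intro o c r' hc hr
    have hc : Event.invoke o c ∈ tr := by simpa using hc
    rw [steps_append, steps_respond, add_zero]
    rcases List.mem_append.1 hr with hr | hr
    · exact h.responded_count _ hI' hc hr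
    · cases List.mem_singleton.1 hr
      exact (h.running i _ c hrun hc).ret.2.mono h.inv hI' (MLe.refl _) (h.cmax_append _)
        (h.arg_append _)

theorem Execution.exists_describes (hT : T.Good) (h : Execution T tr C) :
    ∃ w, Describes T tr C w := by
  induction h with
  | init => exact ⟨_, Describes.init T⟩
  | invoke tr C i a hE hidle ih =>
    obtain ⟨w, hw⟩ := ih
    exact ⟨_, hw.invoke hT hE.traceInv hidle rfl (hE.invoke _ _ _ _ hidle).traceInv⟩
  | step tr C i a k hE hrun ih =>
    obtain ⟨w, hw⟩ := ih
    exact ⟨_, hw.step hE.traceInv hrun rfl (hE.step _ _ _ _ _ hrun).traceInv⟩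
  | respond tr C i r hE hrun ih =>
    obtain ⟨w, hw⟩ := ih
    exact ⟨_, hw.respond hE.traceInv hrun rfl (hE.respond _ _ _ _ hrun).traceInv⟩

end Describes

end WFQueue

namespace WFQueue

variable {p : ℕ} {V : Type}

/-! ## The step bounds -/

theorem OTree.IsOrderingTree.good {T : OTree p} (hT : T.IsOrderingTree) (hp : 2 ≤ p) : T.Good where
  nodup := List.nodup_iff_count_le_one.2 fun i => (hT.one_leaf_per_process i).le
  mem i := List.count_pos_iff.1 (by rw [hT.one_leaf_per_process]; exact Nat.one_pos)
  node := by
    cases T with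
    | leaf i =>
      have := hT.height_eq
      have h2 := Nat.clog_pos Nat.one_lt_two hp
      simp only [OTree.height] at this
      omega
    | node l r => exact ⟨l, r, rfl⟩

section Bounds

variable {T : OTree p} {tr : List (Event p V)} {C : Config p V} {w : World p V} {o : OpId p}

/-- An operation that has been invoked either has responded or is running. -/
theorem Describes.cases (h : Describes T tr C w) (ht : TraceInv tr C) {a : QueueOp V}
    (ha : Event.invoke o a ∈ tr) :
    (∃ r, Event.respond o r ∈ tr ∧ Responded T o r (steps tr o) w a) ∨
    ((∀ r, Event.respond o r ∉ tr) ∧ ∃ P, Runs T o.1 o.2 P (steps tr o) w a) := by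
  by_cases hc : C.running o.1 = none ∨ o.2 ≠ C.invoked o.1
  · obtain ⟨r, hr⟩ := ht.finished o a ha hc
    exact .inl ⟨r, hr, h.finished o a r ha hr⟩
  · push Not at hc
    obtain ⟨hc, ho⟩ := hc
    obtain ⟨P, hP⟩ := Option.ne_none_iff_exists'.1 hc
    obtain ⟨i, k⟩ := o
    obtain rfl : k = C.invoked i := ho
    exact .inr ⟨(ht.running i P hP).2, P, h.running i P a hP ha⟩

theorem Describes.steps_enqueue (h : Describes T tr C w) (ht : TraceInv tr C) {x : V}
    (ha : Event.invoke o (.enqueue x) ∈ tr) : steps tr o ≤ opSteps T := by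
  rcases h.cases ht ha with ⟨r, -, h⟩ | ⟨-, P, n, hn, -⟩
  · exact h
  · omega

/-- More than `opSteps T` steps are possible only after the dequeue has been resolved as non-null,
and then it is already linearized. -/
theorem Describes.steps_dequeue (h : Describes T tr C w) (ht : TraceInv tr C)
    (ha : Event.invoke o .dequeue ∈ tr) : steps tr o ≤ opSteps T ∨
      Event.respond o none ∉ tr ∧ ∃ e qd qe, Removes T C.mem o e qd qe ∧
        steps tr o ≤ opSteps T + searchSteps T.height (maxContention tr) qe qd := by
  rw [← h.mem, ← h.cmax]
  by_cases hn : Event.respond o none ∈ tr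
  · rcases h.finished o _ _ ha hn with ⟨-, hs⟩ | ⟨x, e, qd, qe, hx, -⟩
    · exact .inl hs
    · cases hx
  · rcases h.cases ht ha with ⟨r, -, ⟨-, hs⟩ | ⟨x, e, qd, qe, -, hr, -, hs⟩⟩ |
      ⟨-, P, ⟨n, hs, -⟩ | ⟨e, qd, qe, n, hr, hs, -⟩⟩
    · exact .inl hs
    · exact .inr ⟨hn, e, qd, qe, hr, hs⟩
    · exact .inl (by omega)
    · exact .inr ⟨hn, e, qd, qe, hr, by omega⟩

theorem Describes.removes (h : Describes T tr C w) {x : V} (ha : Event.invoke o .dequeue ∈ tr)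
    (hr : Event.respond o (some x) ∈ tr) :
    ∃ e qd qe, Removes T C.mem o e qd qe ∧ Event.invoke e (.enqueue x) ∈ tr := by
  rcases h.finished o _ _ ha hr with ⟨hx, -⟩ | ⟨y, e, qd, qe, hx, hr, he, -⟩
  · cases hx
  · cases hx
    exact ⟨e, qd, qe, h.mem ▸ hr, (h.arg _ _).1 he⟩

end Bounds

/-- For `n = 0` the default values `Nat.clog 2 0 = 0` and `Real.logb 2 0 = 0` are used. -/
theorem clog_le_logb (n : ℕ) : (Nat.clog 2 n : ℝ) ≤ Real.logb 2 n + 1 := by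
  rcases Nat.eq_zero_or_pos n with rfl | hn
  · simp
  · have h0 : 0 ≤ Real.logb 2 n := Real.logb_nonneg one_lt_two (by exact_mod_cast hn)
    have := (Nat.ceil_lt_add_one h0).le
    rwa [show (2 : ℝ) = (2 : ℕ) by norm_num, Real.natCeil_logb_natCast] at this

theorem one_le_logb_of_two_le (hp : 2 ≤ p) : 1 ≤ Real.logb 2 p := by
  rw [Real.le_logb_iff_rpow_le one_lt_two (by positivity)]
  simpa using (by exact_mod_cast hp : (2 : ℝ) ≤ p)

theorem opSteps_le {T : OTree p} (hT : T.IsOrderingTree) (hp : 2 ≤ p) :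
    (opSteps T : ℝ) ≤ 140 * Real.logb 2 p := by
  have h1 := one_le_logb_of_two_le hp
  have h2 := clog_le_logb p
  rw [opSteps, hT.height_eq]
  push_cast
  linarith

/-- One unit pays for `a + b ≤ 2 * max a b`, the other for rounding up. -/
theorem clog_add_le {a b : ℕ} (ha : 1 ≤ a) (hb : 1 ≤ b) :
    (Nat.clog 2 (a + b) : ℝ) ≤ Real.logb 2 (max a b : ℕ) + 2 := by
  have hm : 1 ≤ max a b := ha.trans (le_max_left _ _)
  have h1 : Real.logb 2 (a + b : ℕ) ≤ Real.logb 2 ((2 : ℝ) * (max a b : ℕ)) := by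
    refine Real.logb_le_logb_of_le one_lt_two (by positivity) ?_
    have : a + b ≤ 2 * max a b := by omega
    exact_mod_cast this
  rw [Real.logb_mul (by norm_num) (by positivity), Real.logb_self_eq_one one_lt_two] at h1
  linarith [clog_le_logb (a + b)]

theorem searchSteps_le {T : OTree p} (hT : T.IsOrderingTree) (hp : 2 ≤ p) {c qe qd : ℕ}
    (he : 1 ≤ qe) (hd : 1 ≤ qd) : (searchSteps T.height c qe qd : ℝ) ≤
      29 * Real.logb 2 p + 2 * Real.logb 2 p * Real.logb 2 c +
        2 * Real.logb 2 (max qe qd : ℕ) := by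
  have h1 := one_le_logb_of_two_le hp
  have h2 := clog_le_logb p
  have h3 := clog_le_logb c
  have h4 := clog_add_le he hd
  rw [searchSteps, hT.height_eq]
  push_cast at h4 ⊢
  have h5 : (9 + (Nat.clog 2 c : ℝ)) * Nat.clog 2 p ≤
      (10 + Real.logb 2 c) * (2 * Real.logb 2 p) := by
    refine mul_le_mul (by linarith) (by linarith) (by positivity) ?_
    linarith [(Nat.cast_nonneg (Nat.clog 2 c) : (0 : ℝ) ≤ _)]
  nlinarith

theorem Dequeues.one_le {L : List (SeqOp p)} {d e : OpId p} {n : ℕ} (h : Dequeues L d e n) :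
    1 ≤ n := by
  obtain ⟨L₁, L₂, rest, -, h, rfl⟩ := h
  simp [h]

theorem EnqueuedAt.one_le {L : List (SeqOp p)} {e : OpId p} {n : ℕ} (h : EnqueuedAt L e n) :
    1 ≤ n := by
  obtain ⟨L₁, L₂, -, rfl⟩ := h
  simp [queueAfter]

theorem logb_max_le {a b : ℕ} (ha : 1 ≤ a) (hb : 1 ≤ b) :
    Real.logb 2 (max a b : ℕ) ≤ Real.logb 2 a + Real.logb 2 b := by
  have h1 : 0 ≤ Real.logb 2 a := Real.logb_nonneg one_lt_two (by exact_mod_cast ha)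
  have h2 : 0 ≤ Real.logb 2 b := Real.logb_nonneg one_lt_two (by exact_mod_cast hb)
  rcases max_choice a b with h | h <;> rw [h] <;> linarith

end WFQueue

theorem mainTheorem2 :
    ∃ K : ℝ, 0 < K ∧
      ∀ (p : ℕ) (_ : 2 ≤ p) (T : OTree p) (_ : T.IsOrderingTree) (V : Type)
        (tr : List (Event p V)) (C : Config p V) (_ : Execution T tr C),
        -- enqueues
        (∀ (o : OpId p) (x : V), Event.invoke o (.enqueue x) ∈ tr →
          (steps tr o : ℝ) ≤ K * Real.logb 2 p) ∧
        -- null dequeues, and dequeues that have not been linearized yet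
        (∀ d : OpId p, Event.invoke d .dequeue ∈ tr →
          (Event.respond d none ∈ tr ∨ IsNullDequeue (linearization T C.mem) d ∨
            NotLinearized (linearization T C.mem) d) →
          (steps tr d : ℝ) ≤ K * Real.logb 2 p) ∧
        -- non-null dequeues
        (∀ (d e : OpId p) (qd qe : ℕ), Event.invoke d .dequeue ∈ tr →
          Dequeues (linearization T C.mem) d e qd → EnqueuedAt (linearization T C.mem) e qe →
          (steps tr d : ℝ) ≤ K * (Real.logb 2 p * (1 + Real.logb 2 (maxContention tr))
            + Real.logb 2 qe + Real.logb 2 qd) ∧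
          (steps tr d : ℝ) ≤ K * (Real.logb 2 p ^ 2 + Real.logb 2 (max qe qd : ℕ))) ∧
        -- the value returned by a non-null dequeue is the one inserted by the enqueue above
        (∀ (d : OpId p) (x : V), Event.invoke d .dequeue ∈ tr → Event.respond d (some x) ∈ tr →
          ∃ (e : OpId p) (qd qe : ℕ), Dequeues (linearization T C.mem) d e qd ∧
            EnqueuedAt (linearization T C.mem) e qe ∧ Event.invoke e (.enqueue x) ∈ tr) := by
  -- The two phases give 140 + 29 = 169 times `log p`, and the other terms have coefficient 2. For
  -- the second bound, `log p ≤ (log p) ^ 2` and `c ≤ p` merge the first two terms; 200 is generous.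
  refine ⟨200, by norm_num, fun p hp T hT V tr C hE => ?_⟩
  have hG := hT.good hp
  have ht := hE.traceInv
  obtain ⟨w, hw⟩ := hE.exists_describes hG
  have hL : (linearization T C.mem).Nodup := hw.mem ▸ nodup_linearization hG.nodup hw.inv.minv
  have hlog := one_le_logb_of_two_le hp
  have hop := opSteps_le hT hp
  have small : ∀ o, steps tr o ≤ opSteps T → (steps tr o : ℝ) ≤ 140 * Real.logb 2 p :=
    fun o ho => (Nat.cast_le.2 ho).trans hop
  refine ⟨fun o x ho => ?_, fun d hd hnull => ?_, fun d e qd qe hd hde hqe => ?_,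
    fun d x hd hr => ?_⟩
  · linarith [small o (hw.steps_enqueue ht ho)]
  · rcases hw.steps_dequeue ht hd with hs | ⟨hn, e, qd, qe, ⟨h1, -⟩, -⟩
    · linarith [small d hs]
    -- Beyond the small bound, the dequeue removes an element in the linearization and has not
    -- responded null, against each alternative.
    · rcases hnull with h | h | h
      · exact absurd h hn
      · exact absurd h (h1.not_null hL)
      · exact absurd h h1.linearized
  · have hd1 := hde.one_le
    have he1 := hqe.one_le
    have hlqd : 0 ≤ Real.logb 2 qd := Real.logb_nonneg one_lt_two (by exact_mod_cast hd1)
    have hlqe : 0 ≤ Real.logb 2 qe := Real.logb_nonneg one_lt_two (by exact_mod_cast he1)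
    have hmax : 0 ≤ Real.logb 2 (max qe qd : ℕ) :=
      Real.logb_nonneg one_lt_two (by exact_mod_cast hd1.trans (le_max_right _ _))
    -- Contention 0 is covered by the default value of the logarithm at 0.
    have hc0 : 0 ≤ Real.logb 2 (maxContention tr) := by
      rcases Nat.eq_zero_or_pos (maxContention tr) with h | h
      · simp [h]
      · exact Real.logb_nonneg one_lt_two (by exact_mod_cast h)
    have hcp : Real.logb 2 (maxContention tr) ≤ Real.logb 2 p := by
      rcases Nat.eq_zero_or_pos (maxContention tr) with h | h
      · rw [h]; simp; linarith
      · exact Real.logb_le_logb_of_le one_lt_two (by exact_mod_cast h)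
          (by exact_mod_cast hE.maxContention_le)
    have hs : (steps tr d : ℝ) ≤ 169 * Real.logb 2 p +
        2 * Real.logb 2 p * Real.logb 2 (maxContention tr) +
        2 * Real.logb 2 (max qe qd : ℕ) := by
      rcases hw.steps_dequeue ht hd with hs | ⟨-, e', qd', qe', ⟨h1, h2⟩, hs⟩
      · have := mul_nonneg (zero_le_one.trans hlog) hc0
        linarith [small d hs]
      -- As the linearization has no repetitions, the given enqueue and sizes are the ones found by
      -- the dequeue.
      · obtain ⟨rfl, rfl⟩ := hde.unique hL h1
        obtain rfl := hqe.unique hL h2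
        have hs' : (steps tr d : ℝ) ≤ opSteps T + searchSteps T.height (maxContention tr) qe qd := by
          exact_mod_cast hs
        linarith [searchSteps_le hT hp (c := maxContention tr) he1 hd1]
    constructor
    · have := logb_max_le he1 hd1
      nlinarith [mul_nonneg (zero_le_one.trans hlog) hc0]
    · have h1 : Real.logb 2 p ≤ Real.logb 2 p ^ 2 := by nlinarith
      have h2 := mul_le_mul_of_nonneg_left hcp (zero_le_one.trans hlog)
      nlinarith
  · obtain ⟨e, qd, qe, ⟨h1, h2⟩, h3⟩ := hw.removes hd hr
    exact ⟨e, qd, qe, h1, h2, h3⟩
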